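/- **Setting.** A single item is sold to $n\ge 1$ bidders with independent values $v_i\sim D^i$, $\mathbf D=D^1\times\dots\times D^n$. Each $D^i$ is a regular distribution on $[0,\infty)$: it has a density $f_i$ that is positive exactly on an interval, and the virtual value $v-\frac{1-F_i(v)}{f_i(v)}$ is non-decreasing there. A mechanism is a measurable allocation rule $x$ ($x_i\ge 0$, $\sum_i x_i\le 1$) together with a measurable payment rule $p$, which is dominant strategy incentive compatible (DSIC) and individually rational (IR) on all non-negative value profiles. $\mathrm{Rev}(M,\mathbf D)=\mathbb E_{v\sim\mathbf D}[\sum_i p_i(v)]$, and $\mathrm{OPT}(\mathbf D)$ is the supremum of $\mathrm{Rev}(M,\mathbf D)$ over all such mechanisms whose revenue is integrable. **Myerson's auction** for a product $\mathbf E=E^1\times\dots\times E^n$ of finitely supported distributions: the ironed virtual value of $v$ under $E^i$ is the right slope, at the quantile $\Pr[X>v]$, of the least concave majorant on $[0,1]$ of the points $(\Pr[X\ge p],\,p\Pr[X\ge p])$, $p\ge 0$ (and $-\infty$ if $\Pr[X>v]=1$). The item goes to the bidder with the highest ironed virtual value, provided that it is non-negative; ties are broken by an arbitrary fixed order of the bidders.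 The winner pays the smallest non-negative report with which she would still win. **Algorithm (empirical Myerson, regular).** Parameters $\epsilon,\gamma\in(0,1)$ and constants $c_0,c_1,c_2$. All samples are independent draws from $\mathbf D$. 1. With $m_0=\lceil c_0\log\frac n\epsilon\rceil$ samples, for each bidder $i$ let $\mathrm{SRev}_i$ be $\frac32$ times the maximum of $p\,\hat q_i(p)$ over the prices $p\ge 0$ with $\hat q_i(p)\ge\frac14$, where $\hat q_i(p)$ is the fraction of the samples of bidder $i$ that are at least $p$. Let $\mathrm{SRev}=\sum_i\mathrm{SRev}_i$. 2. With $2m_1$ fresh samples, $m_1=\lceil c_1\frac n\epsilon\log\frac1\epsilon\rceil$, run VCG (the second-price auction) with two copies of each bidder $m_1$ times, capping the values at $\frac1\epsilon\mathrm{SRev}$. Let $\mathrm{Apx}$ be the average revenue. 3. Let $V=\{\frac8\epsilon(1-\epsilon)^k\mathrm{Apx}: k\in\mathbb N,\ \frac8\epsilon(1-\epsilon)^k\ge\frac\epsilon8\}\cup\{\frac\epsilon8\mathrm{Apx},\,0\}$. 4. Take $m_2=\lceil c_2\,\epsilon^{-3}(\frac n\epsilon\log\frac1\epsilon\log\frac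 n\epsilon+\log\frac1\gamma)\rceil$ fresh samples, round their values down to $V$, and let $E^i$ be the uniform distribution over the $m_2$ rounded samples of bidder $i$. Output Myerson's auction $M$ for $E^1\times\dots\times E^n$, where every reported value is first rounded down to $V$. **Theorem.** There are absolute constants $K,C>0$ such that, for all $c_0,c_1,c_2\ge K$: - There is a constant $B$, depending only on $c_0,c_1,c_2$, such that for all $n\ge1$ and $\epsilon,\gamma\in(0,1)$ the total number $m_0+2m_1+m_2$ of samples is at most $B\big(n\epsilon^{-4}(1+\log\frac1\epsilon)(1+\log\frac n\epsilon)+\epsilon^{-3}\log\frac1\gamma\big)$; for $\gamma=\epsilon$ this is $\tilde O(n\epsilon^{-4})$. - For all $n\ge1$, $\epsilon,\gamma\in(0,1)$ and every tie-breaking order, the output $M$ is a DSIC and IR mechanism for all non-negative samples, and for all regular $D^1,\dots,D^n$: $\mathrm{OPT}(\mathbf D)$ is finite; with probability at least $1-C\epsilon-\gamma$ over the samples, $\mathrm{Rev}(M,\mathbf D)\ge(1-C\epsilon)\,\mathrm{OPT}(\mathbf D)$; and $\mathrm{Rev}(M,\mathbf D)$ is integrable over the samples, with $$\mathbb E_{\text{samples}}[\mathrm{Rev}(M,\mathbf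 D)]\ \ge\ (1-C\epsilon-\gamma)\,\mathrm{OPT}(\mathbf D).$$ In particular, with $\gamma=\epsilon$ the algorithm is a $1-O(\epsilon)$ approximation. -/

import Mathlib

open MeasureTheory Set
open scoped ENNReal

namespace SampleAuction

noncomputable section

/-! ### Single-item auctions -/

/-- A direct revelation mechanism: the winning probabilities `alloc v i` and the payments `pay v i`
as functions of the reported value profile `v`. Only non-negative profiles are meaningful. -/
structure Mechanism (n : ℕ) where
  alloc : (Fin n → ℝ) → Fin n → ℝ
  pay : (Fin n → ℝ) → Fin n → ℝ

/-- At most one item is allocated, and the rules are measurable. -/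
def Mechanism.IsFeasible {n : ℕ} (M : Mechanism n) : Prop :=
  Measurable M.alloc ∧ Measurable M.pay ∧
    ∀ v : Fin n → ℝ, 0 ≤ v → (∀ i, 0 ≤ M.alloc v i) ∧ ∑ i, M.alloc v i ≤ 1

/-- Dominant strategy incentive compatibility: `v i` is the true value of bidder `i`, the other
coordinates of `v` are arbitrary reports, `b` is a possible misreport. -/
def Mechanism.IsDSIC {n : ℕ} (M : Mechanism n) : Prop :=
  ∀ v : Fin n → ℝ, 0 ≤ v → ∀ (i : Fin n) (b : ℝ), 0 ≤ b →
    v i * M.alloc (Function.update v i b) i - M.pay (Function.update v i b) i ≤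
      v i * M.alloc v i - M.pay v i

/-- Individual rationality. -/
def Mechanism.IsIR {n : ℕ} (M : Mechanism n) : Prop :=
  ∀ v : Fin n → ℝ, 0 ≤ v → ∀ i : Fin n, 0 ≤ v i * M.alloc v i - M.pay v i

/-- The mechanisms over which the optimal revenue is taken. -/
def Mechanism.IsAdmissible {n : ℕ} (M : Mechanism n) : Prop :=
  M.IsFeasible ∧ M.IsDSIC ∧ M.IsIR

/-- Expected revenue when the values are drawn independently, `v i` from `D i`. -/
def rev {n : ℕ} (M : Mechanism n) (D : Fin n → Measure ℝ) : ℝ :=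
  ∫ v, ∑ i, M.pay v i ∂(Measure.pi D)

/-- The expected revenues that admissible mechanisms can have on `D`. -/
def achievableRevenues {n : ℕ} (D : Fin n → Measure ℝ) : Set ℝ :=
  {r | ∃ M : Mechanism n, M.IsAdmissible ∧
    Integrable (fun v => ∑ i, M.pay v i) (Measure.pi D) ∧ r = rev M D}

/-- The optimal revenue. -/
def opt {n : ℕ} (D : Fin n → Measure ℝ) : ℝ := sSup (achievableRevenues D)

/-! ### Regular distributions -/

/-- The virtual value function `v - (1 - F v) / f v` of a distribution with density `f`. -/
def virtualValue (D : Measure ℝ) (f : ℝ → ℝ) (v : ℝ) : ℝ :=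
  v - (1 - ProbabilityTheory.cdf D v) / f v

/-- A probability distribution of non-negative values with a density `f` is regular if its virtual
value function is non-decreasing. The virtual value is `-∞` where `f v = 0` and `F v < 1`, so
monotonicity forces the set `{v | 0 < f v}`, on which it is finite, to be an interval. -/
def IsRegular (D : Measure ℝ) : Prop :=
  IsProbabilityMeasure D ∧ ∃ f : ℝ → ℝ, Measurable f ∧ (∀ v, 0 ≤ f v) ∧ (∀ v < 0, f v = 0) ∧
    D = volume.withDensity (fun v => ENNReal.ofReal (f v)) ∧
    OrdConnected {v | 0 < f v} ∧ MonotoneOn (virtualValue D f) {v | 0 < f v}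

/-! ### Myerson's auction for a product distribution, with ironing -/

/-- The ironed revenue curve of `E`: the least concave majorant (infimum of the affine majorants)
of the points `(P(X ≥ v), v * P(X ≥ v))`, for prices `v ≥ 0`, as a function of the quantile. -/
def ironedRevenue (E : Measure ℝ) (q : ℝ) : ℝ :=
  sInf {y | ∃ a b : ℝ, (∀ v : ℝ, 0 ≤ v → v * E.real (Ici v) ≤ a + b * E.real (Ici v)) ∧
    y = a + b * q}

/-- The ironed virtual value: the slope of the ironed revenue curve just to the right of the
quantile `P(X > v)` (for a concave curve, the supremum of the slopes of its chords to the right).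
If `v` is an atom, this is the slope on the quantile interval `(P(X > v), P(X ≥ v)]` of `v`. For
finite support, a value off the support is treated as the next support value below, and as `-∞` if
there is none. -/
def ironedVirtualValue (E : Measure ℝ) (v : ℝ) : EReal :=
  ⨆ q ∈ Ioc (E.real (Ioi v)) 1,
    (((ironedRevenue E q - ironedRevenue E (E.real (Ioi v))) / (q - E.real (Ioi v)) : ℝ) : EReal)

/-- Bidder `i` wins if its ironed virtual value is non-negative and the highest one, ties being
broken in favour of the smaller rank `τ`. -/
def MyersonWins {n : ℕ} (τ : Equiv.Perm (Fin n)) (E : Fin n → Measure ℝ) (v : Fin n → ℝ)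
    (i : Fin n) : Prop :=
  0 ≤ ironedVirtualValue (E i) (v i) ∧
    ∀ j, j ≠ i → ironedVirtualValue (E j) (v j) < ironedVirtualValue (E i) (v i) ∨
      (ironedVirtualValue (E j) (v j) = ironedVirtualValue (E i) (v i) ∧ τ i < τ j)

open Classical in
/-- Myerson's auction for `E 1 × ... × E n`. The winner pays the smallest report that still wins. -/
def myerson {n : ℕ} (τ : Equiv.Perm (Fin n)) (E : Fin n → Measure ℝ) : Mechanism n where
  alloc v i := if MyersonWins τ E v i then 1 else 0
  pay v i := if MyersonWins τ E v i then
    sInf {p | 0 ≤ p ∧ MyersonWins τ E (Function.update v i p) i} else 0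

/-- The uniform distribution over the `m` samples `s 1, ..., s m`. -/
def empirical {m : ℕ} (s : Fin m → ℝ) : Measure ℝ :=
  (m : ℝ≥0∞)⁻¹ • ∑ k, Measure.dirac (s k)

/-! ### The algorithm -/

/-- The samples are split into `m₀` samples for the first crude estimate of the revenue, `m₁` pairs
of samples for the runs of VCG with duplicates, and `m₂` samples for the empirical distribution. -/
abbrev SampleIdx (m₀ m₁ m₂ : ℕ) : Type := Fin m₀ ⊕ (Fin m₁ × Fin 2) ⊕ Fin m₂

/-- A 2-approximation of the optimal revenue from a single bidder: `3/2` times the best empirical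
revenue `p * P(X ≥ p)` among the prices `p` that at least a quarter of the samples accept. -/
def singleRevenue {m : ℕ} (s : Fin m → ℝ) : ℝ :=
  3 / 2 * sSup {r | ∃ p : ℝ, 0 ≤ p ∧ 1 / 4 ≤ (empirical s).real (Ici p) ∧
    r = p * (empirical s).real (Ici p)}

/-- Sum over all bidders of the single-bidder estimates. -/
def separateRevenue {n m₀ m₁ m₂ : ℕ} (S : SampleIdx m₀ m₁ m₂ → Fin n → ℝ) : ℝ :=
  ∑ i, singleRevenue (fun k : Fin m₀ => S (Sum.inl k) i)

/-- The second highest of a finite family of numbers (with multiplicity): the revenue of VCG, that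
is of the second-price auction, for one item. -/
def vcgRevenue {ι : Type} (w : ι → ℝ) : ℝ :=
  ⨆ p : {p : ι × ι // p.1 ≠ p.2}, min (w p.1.1) (w p.1.2)

/-- The estimate of the optimal revenue: the average revenue of `m₁` runs of VCG with two copies of
each bidder, the values being capped at `separateRevenue / ε`. -/
def apx {n m₀ m₁ m₂ : ℕ} (ε : ℝ) (S : SampleIdx m₀ m₁ m₂ → Fin n → ℝ) : ℝ :=
  (∑ k : Fin m₁, vcgRevenue (fun b : Fin n × Fin 2 =>
    min (S (Sum.inr (Sum.inl (k, b.2))) b.1) (separateRevenue S / ε))) / m₁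

/-- The discretized values: the numbers `8 / ε * (1 - ε) ^ k * A` that are at least `ε / 8 * A`,
and `ε / 8 * A`, and `0`. -/
def valueGrid (ε A : ℝ) : Set ℝ :=
  {w | ∃ k : ℕ, ε / 8 ≤ 8 / ε * (1 - ε) ^ k ∧ w = 8 / ε * (1 - ε) ^ k * A} ∪ {ε / 8 * A, 0}

/-- The largest element of the finite set `V` that is at most `x`. -/
def roundDown (V : Set ℝ) (x : ℝ) : ℝ := sSup {w | w ∈ V ∧ w ≤ x}

/-- Empirical Myerson for regular distributions: Myerson's auction for the product of the empirical
distributions of the rounded samples, run on the rounded reports. -/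
def empiricalMyerson {n m₀ m₁ m₂ : ℕ} (τ : Equiv.Perm (Fin n)) (ε : ℝ)
    (S : SampleIdx m₀ m₁ m₂ → Fin n → ℝ) : Mechanism n :=
  let V : Set ℝ := valueGrid ε (apx ε S)
  let M : Mechanism n := myerson τ
    (fun i => empirical (fun k : Fin m₂ => roundDown V (S (Sum.inr (Sum.inr k)) i)))
  { alloc := fun v => M.alloc (fun i => roundDown V (v i))
    pay := fun v => M.pay (fun i => roundDown V (v i)) }

/-- The sample sizes, with the constants hidden in the asymptotic notation made explicit. -/
def size₀ (c : ℝ) (n : ℕ) (ε : ℝ) : ℕ := ⌈c * Real.log (n / ε)⌉₊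

def size₁ (c : ℝ) (n : ℕ) (ε : ℝ) : ℕ := ⌈c * (n / ε * Real.log (1 / ε))⌉₊

def size₂ (c : ℝ) (n : ℕ) (ε γ : ℝ) : ℕ :=
  ⌈c * (1 / ε ^ 3 * (n / ε * Real.log (1 / ε) * Real.log (n / ε) + Real.log (1 / γ)))⌉₊

/-- The index set of all samples that the algorithm takes. -/
abbrev AllSamples (c₀ c₁ c₂ : ℝ) (n : ℕ) (ε γ : ℝ) : Type :=
  SampleIdx (size₀ c₀ n ε) (size₁ c₁ n ε) (size₂ c₂ n ε γ)

/-- The law of independent samples, indexed by `κ`, from the product distribution of `D`. -/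
def sampleLaw {n : ℕ} (κ : Type) [Fintype κ] (D : Fin n → Measure ℝ) :
    Measure (κ → Fin n → ℝ) :=
  Measure.pi (fun _ : κ => Measure.pi D)

end

end SampleAuction

/-!
The scale of the problem is a median `T` of the highest value. The only feature of regularity that
is used is a tail property (`IsRegular.hasRegularTail`): raising the price beyond one that is
accepted with a small probability hardly raises the revenue from a single bidder
(`mul_survival_le`). The posted price `T` earns `T / 2`, and the tail property bounds everything
that can be earned from values above `T`, so that `T / 2 ≤ opt D ≤ 3 * T` (`half_le_opt`, `opt_le`).

*Rounding.* For finitely supported distributions, Myerson's auction is optimal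
(`rev_le_rev_roundedMyerson`): an ironed virtual value is at least `c` exactly from a monopoly price
for cost `c` on, where the revenue curve touches its concave majorant (`exists_threshold`), so every
bidder faces a threshold at which the expected payment equals the ironed virtual surplus. Let the
values be rounded down to a grid that is fine up to the factor `1 - ε`, reaches from `ε * T` to
`T / ε` up to constant factors, and contains `0`. For any mechanism, the payments averaged over the
cells of the grid satisfy the incentive constraints of the rounded values up to a factor close to
one (`SingleAgent.integral_pay_le_rounded`); values above the grid are rare and, by the tail
property, contribute little. Hence Myerson's auction for the rounded distributions loses only a
fraction of order `ε` (`opt_le_rounded`, `opt_le_rev_rounded`).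

*Sampling.* The output of the algorithm is optimal for the product of the empirical distributions.
It is therefore nearly optimal for the true distributions if the revenues of that auction and of
the auction for the true rounded distributions are each nearly the same under both products. An
expectation under the product of the empirical distributions is an average, over all ways to match
up the samples of the different bidders, of averages over `m` independent profiles. By convexity its
exponential moments obey the bounds for `m` independent profiles
(`integral_exp_mul_integral_empirical_le`), and the Chernoff bound follows. A union bound over all
auctions that the algorithm can output, which are indexed by the histograms of `m` samples on the
grid (`exists_histogram`), gives the guarantee for a fixed grid (`rev_empirical_ge`).

*The scale of the grid.* The crude estimate is correct up to a factor of order `n`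
(`crudeRevenue_bad_le`), which is enough to cap the revenue of VCG: with two copies of each bidder
its expectation is of the order of `T`, and the cap makes the average of the runs concentrate
(`apx_bad_le`). The grid depends only on samples that are independent of those used for the
empirical distributions, so the guarantee for a fixed grid applies conditionally on it
(`rev_empiricalMyerson_lt_le`). Fubini's theorem needs the revenue to be jointly measurable in the
scale, the samples and the reports; this holds since the auction commutes with scaling, so that up
to a factor it depends only on rounded ratios, which take finitely many values (`samplePay_scaled`).
-/

namespace SampleAuction

noncomputable section

/-! ### Tails of regular distributions -/

/-- The area under the survival function over `(s, t]`, computed by exchanging integrals. -/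
theorem setIntegral_survival {D : Measure ℝ} [IsFiniteMeasure D] {s t : ℝ} (hst : s ≤ t) :
    ∫ u in Ioc s t, D.real (Ici u) =
      (∫ v in Ico s t, (v - s) ∂D) + (t - s) * D.real (Ici t) := by
  have hmeas : MeasurableSet {p : ℝ × ℝ | p.1 ≤ p.2} :=
    measurableSet_le measurable_fst measurable_snd
  have hint : Integrable (Function.uncurry fun u v : ℝ => (Ici u).indicator (fun _ => (1 : ℝ)) v)
      ((volume.restrict (Ioc s t)).prod D) := by
    have : (Function.uncurry fun u v : ℝ => (Ici u).indicator (fun _ => (1 : ℝ)) v) =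
        {p : ℝ × ℝ | p.1 ≤ p.2}.indicator (fun _ => 1) := by
      ext ⟨u, v⟩; simp [Function.uncurry, indicator]
    rw [this]
    exact (integrable_const _).indicator hmeas
  have h1 : ∀ u : ℝ, D.real (Ici u) = ∫ v, (Ici u).indicator (fun _ => (1 : ℝ)) v ∂D := by
    intro u
    rw [integral_indicator measurableSet_Ici]; simp
  have h2 : ∀ v : ℝ, ∫ u in Ioc s t, (Ici u).indicator (fun _ => (1 : ℝ)) v =
      (Ico s t).indicator (fun v => v - s) v + (Ici t).indicator (fun _ => t - s) v := by
    intro v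
    have : (fun u : ℝ => (Ici u).indicator (fun _ => (1 : ℝ)) v) =
        (Iic v).indicator (fun _ => 1) := by
      ext u; simp [indicator]
    rw [this, integral_indicator measurableSet_Iic, Measure.restrict_restrict measurableSet_Iic]
    have h3 : Iic v ∩ Ioc s t = Ioc s (min t v) := by
      ext x; simp only [mem_inter_iff, mem_Iic, mem_Ioc, le_min_iff]; tauto
    rw [h3]
    simp only [integral_const, smul_eq_mul, mul_one, measureReal_restrict_apply_univ,
      Real.volume_real_Ioc, indicator, mem_Ico, mem_Ici]
    split_ifs with h4 h5 h5
    · linarith [h4.2]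
    · rw [min_eq_right h4.2.le, max_eq_left (by linarith [h4.1])]; ring
    · rw [min_eq_left h5, max_eq_left (by linarith)]; ring
    · have : v < s := by
        by_contra h6; push Not at h5 h6; exact h4 ⟨h6, h5⟩
      rw [max_eq_right]; · simp
      linarith [min_le_right t v]
  simp_rw [h1]
  rw [integral_integral_swap hint]
  simp_rw [h2]
  rw [integral_add, integral_indicator measurableSet_Ico, integral_indicator measurableSet_Ici]
  · simp [mul_comm]
  · rw [integrable_indicator_iff measurableSet_Ico]
    refine Measure.integrableOn_of_bounded (M := t - s) (measure_ne_top _ _)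
      (by fun_prop) ?_
    filter_upwards [ae_restrict_mem measurableSet_Ico] with v hv
    rw [Real.norm_eq_abs, abs_of_nonneg (by linarith [hv.1])]; linarith [hv.2]
  · exact (integrable_const _).indicator measurableSet_Ici

/-- The features of a regular distribution on which the analysis rests: values are non-negative,
there are no atoms, and the odds `(1 - q) / q` of a value below `t`, where `q = P(X ≥ t)`, grow at
least linearly: `t * q / (1 - q)` is non-increasing in `t`. The last property says that the revenue
curve lies above its chords to the point `(1, 0)`. -/
structure HasRegularTail (D : Measure ℝ) : Prop where
  prob : IsProbabilityMeasure D
  noAtoms : NullSingletonClass D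
  nonneg : D (Iio 0) = 0
  tail : ∀ s t : ℝ, 0 ≤ s → s ≤ t →
    t * D.real (Ici t) * (1 - D.real (Ici s)) ≤ s * D.real (Ici s) * (1 - D.real (Ici t))

theorem setIntegral_withDensity_ofReal {f : ℝ → ℝ} (hf : Measurable f) (hf0 : ∀ v, 0 ≤ f v)
    {s : Set ℝ} (hs : MeasurableSet s) (g : ℝ → ℝ) :
    ∫ v in s, g v ∂(volume.withDensity fun v => ENNReal.ofReal (f v)) = ∫ v in s, f v * g v := by
  rw [setIntegral_withDensity_eq_setIntegral_toReal_smul (by fun_prop) (by simp) _ hs]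
  simp [ENNReal.toReal_ofReal (hf0 _)]

theorem IsRegular.hasRegularTail {D : Measure ℝ} (hD : IsRegular D) : HasRegularTail D := by
  obtain ⟨hP, f, hf, hf0, hfneg, hDf, hconn, hmono⟩ := hD
  have hNA : NullSingletonClass D := by rw [hDf]; infer_instance
  have hneg : D (Iio 0) = 0 := by
    rw [hDf, withDensity_apply _ measurableSet_Iio, setLIntegral_eq_zero_iff measurableSet_Iio
      (by fun_prop)]
    filter_upwards with v hv
    simp [hfneg v hv]
  refine ⟨hP, hNA, hneg, ?_⟩
  set q : ℝ → ℝ := fun t => D.real (Ici t) with hq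
  set φ : ℝ → ℝ := virtualValue D f with hφ
  have hcdf : ∀ v, 1 - ProbabilityTheory.cdf D v = q v := by
    intro v
    rw [ProbabilityTheory.cdf_eq_real, hq]
    have h1 : D.real (Ici v) = D.real (Ioi v) := by
      rw [measureReal_def, measureReal_def, measure_congr Ioi_ae_eq_Ici]
    simp only [h1]
    rw [← compl_Iic, probReal_compl_eq_one_sub measurableSet_Iic]
  have hq_zero : q 0 = 1 := by
    change D.real (Ici 0) = 1
    rw [← compl_Iio, probReal_compl_eq_one_sub measurableSet_Iio, measureReal_def, hneg]; simp
  have hq0 : ∀ t, 0 ≤ q t := fun t => measureReal_nonneg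
  have hq1 : ∀ t, q t ≤ 1 := fun t => measureReal_le_one
  have hqanti : Antitone q := fun a b hab => measureReal_mono (Ici_subset_Ici.2 hab)
  -- on the support, the definition of the virtual value solved for the survival function
  have hqf : ∀ u, 0 < f u → q u = f u * (u - φ u) := by
    intro u hu
    simp only [hφ, virtualValue, hcdf]
    field_simp; ring
  have hfint : Integrable f := by
    have : (∫⁻ v, ENNReal.ofReal (f v)) ≠ ∞ := by
      have h2 := measure_univ (μ := D)
      rw [hDf, withDensity_apply _ MeasurableSet.univ, setLIntegral_univ] at h2
      rw [h2]; simp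
    refine ⟨hf.aestronglyMeasurable, ?_⟩
    rw [hasFiniteIntegral_iff_ofReal (Filter.Eventually.of_forall hf0)]
    exact this.lt_top
  have hmass : ∀ s t, s ≤ t → ∫ v in Ico s t, f v = q s - q t := by
    intro s t hst
    have h1 := setIntegral_withDensity_ofReal hf hf0 (measurableSet_Ico (a := s) (b := t))
      (fun _ => (1 : ℝ))
    rw [← hDf] at h1
    simp only [integral_const, mul_one, smul_eq_mul, measureReal_restrict_apply_univ] at h1
    rw [← h1, ← Ici_sdiff_Ici, measureReal_sdiff (Ici_subset_Ici.2 hst) measurableSet_Ici]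
  have hIfv : ∀ s t c, IntegrableOn (fun v => f v * (v - c)) (Ico s t) := by
    intro s t c
    refine (hfint.integrableOn).mul_bdd (c := max |s - c| |t - c|) (by fun_prop) ?_
    filter_upwards [ae_restrict_mem measurableSet_Ico] with v hv
    rw [Real.norm_eq_abs]
    exact abs_le_max_abs_abs (by linarith [hv.1]) (by linarith [hv.2])
  have hIq : ∀ s t, IntegrableOn q (Ico s t) := fun s t =>
    Measure.integrableOn_of_bounded (M := 1) (by simp) hqanti.measurable.aestronglyMeasurable
      (Filter.Eventually.of_forall fun v => by
        rw [Real.norm_eq_abs, abs_of_nonneg (hq0 v)]; exact hq1 v)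
  have harea : ∀ s t, s ≤ t →
      ∫ u in Ico s t, q u = (∫ v in Ico s t, f v * (v - s)) + (t - s) * q t := by
    intro s t hst
    rw [← setIntegral_withDensity_ofReal hf hf0 measurableSet_Ico (fun v => v - s), ← hDf,
      ← setIntegral_survival hst, integral_Ico_eq_integral_Ioo, integral_Ioc_eq_integral_Ioo]
  have hshift : ∀ s t c, s ≤ t → ∫ v in Ico s t, f v * (v - c) =
      (∫ v in Ico s t, f v * (v - s)) + (s - c) * (q s - q t) := by
    intro s t c hst
    rw [← hmass s t hst, ← integral_const_mul, ← integral_add (hIfv s t s)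
      ((hfint.integrableOn).const_mul _)]
    congr 1; ext v; ring
  -- the chord of the revenue curve between two points of the support
  have hright : ∀ s t, 0 < f s → 0 < f t → s ≤ t → t * q t - s * q s ≤ -φ s * (q s - q t) := by
    intro s t hs ht hst
    have h1 : ∫ u in Ico s t, q u ≤ ∫ u in Ico s t, f u * (u - φ s) := by
      refine setIntegral_mono_on (hIq s t) (hIfv s t _) measurableSet_Ico fun u hu => ?_
      have hu' : 0 < f u := hconn.out hs ht ⟨hu.1, hu.2.le⟩
      rw [hqf u hu']
      have := hmono hs hu' hu.1
      exact mul_le_mul_of_nonneg_left (by linarith) hu'.le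
    rw [harea s t hst, hshift s t (φ s) hst] at h1
    linarith
  -- the chord of the revenue curve to the quantile `1`
  have hleft : ∀ s, 0 < f s → 0 ≤ s → -φ s * (1 - q s) ≤ s * q s := by
    intro s hs hs0
    have h1 : ∫ u in Ico 0 s, f u * (u - φ s) ≤ ∫ u in Ico 0 s, q u := by
      refine setIntegral_mono_on (hIfv 0 s _) (hIq 0 s) measurableSet_Ico fun u hu => ?_
      rcases (hf0 u).eq_or_lt with h2 | h2
      · rw [← h2, zero_mul]; exact hq0 u
      · rw [hqf u h2]
        have := hmono h2 hs hu.2.le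
        exact mul_le_mul_of_nonneg_left (by linarith) h2.le
    rw [harea 0 s hs0, hshift 0 s (φ s) hs0, hq_zero] at h1
    linarith
  intro s t hs0 hst
  change t * q t * (1 - q s) ≤ s * q s * (1 - q t)
  by_cases hqs : q s = 1
  · rw [hqs]; simp
    exact mul_nonneg hs0 (by linarith [hq1 t])
  by_cases hqt : q t = 0
  · rw [hqt]; simp
    exact mul_nonneg hs0 (hq0 s)
  -- neither tail is trivial, so there is mass on both sides of `s` and to the right of `t`
  have hlow : ∃ a, a < s ∧ 0 < f a := by
    by_contra! h
    apply hqs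
    have h1 := hmass 0 s hs0
    have h2 : ∫ v in Ico 0 s, f v = 0 := by
      rw [setIntegral_congr_fun (g := fun _ => (0:ℝ)) measurableSet_Ico
        (fun v hv => le_antisymm (h v hv.2) (hf0 v))]; simp
    linarith
  have hhigh : ∃ b, t ≤ b ∧ 0 < f b := by
    by_contra! h
    apply hqt
    have : D (Ici t) = 0 := by
      rw [hDf, withDensity_apply _ measurableSet_Ici, setLIntegral_eq_zero_iff measurableSet_Ici
        (by fun_prop)]
      filter_upwards with v hv
      simp [h v hv]
    simp [hq, measureReal_def, this]
  obtain ⟨a, has, ha⟩ := hlow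
  obtain ⟨b, htb, hb⟩ := hhigh
  have hfs : 0 < f s := hconn.out ha hb ⟨has.le, hst.trans htb⟩
  have hft : 0 < f t := hconn.out ha hb ⟨(has.trans_le hst).le, htb⟩
  have h1 := hright s t hfs hft hst
  have h2 := hleft s hfs hs0
  have h3 : 0 ≤ 1 - q s := by linarith [hq1 s]
  have h4 : 0 ≤ q s - q t := by linarith [hqanti hst]
  nlinarith [mul_le_mul_of_nonneg_right h1 h3, mul_le_mul_of_nonneg_right h2 h4]

namespace HasRegularTail

variable {D : Measure ℝ}

theorem survival_zero (h : HasRegularTail D) : D.real (Ici 0) = 1 := by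
  have := h.prob
  rw [← compl_Iio, probReal_compl_eq_one_sub measurableSet_Iio, measureReal_def, h.nonneg]; simp

theorem ae_nonneg (h : HasRegularTail D) : ∀ᵐ v ∂D, 0 ≤ v := by
  rw [ae_iff]; simpa [Iio] using h.nonneg

theorem survival_eq (h : HasRegularTail D) (t : ℝ) :
    D.real (Ici t) = 1 - ProbabilityTheory.cdf D t := by
  have := h.prob
  have := h.noAtoms
  rw [ProbabilityTheory.cdf_eq_real, ← probReal_compl_eq_one_sub measurableSet_Iic, compl_Iic,
    measureReal_def, measureReal_def, measure_congr Ioi_ae_eq_Ici]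

theorem continuous_survival (h : HasRegularTail D) : Continuous fun t => D.real (Ici t) := by
  have := h.prob
  have := h.noAtoms
  have hc : Continuous (ProbabilityTheory.cdf D) := by
    rw [continuous_iff_continuousAt]
    intro x
    refine (ProbabilityTheory.cdf D).mono.continuousAt_iff_leftLim_eq_rightLim.2 ?_
    rw [(ProbabilityTheory.cdf D).rightLim_eq]
    have h0 : (ProbabilityTheory.cdf D).measure {x} = 0 := by
      rw [ProbabilityTheory.measure_cdf]; exact measure_singleton x
    rw [StieltjesFunction.measure_singleton, ENNReal.ofReal_eq_zero] at h0
    exact le_antisymm ((ProbabilityTheory.cdf D).mono.leftLim_le le_rfl) (by linarith)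
  simp_rw [h.survival_eq]
  fun_prop

theorem tendsto_survival (h : HasRegularTail D) :
    Filter.Tendsto (fun t => D.real (Ici t)) Filter.atTop (nhds 0) := by
  have := h.prob
  simp_rw [h.survival_eq]
  simpa using (ProbabilityTheory.tendsto_cdf_atTop D).const_sub 1

/-- Beyond a price accepted with probability at most one half, no price raises the revenue by more
than a factor of two. -/
theorem mul_survival_le (h : HasRegularTail D) {s t : ℝ} (hs : 0 ≤ s) (hst : s ≤ t)
    (hq : D.real (Ici s) ≤ 1 / 2) : t * D.real (Ici t) ≤ 2 * s * D.real (Ici s) := by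
  have h1 := h.tail s t hs hst
  have h2 : 0 ≤ t * D.real (Ici t) := mul_nonneg (hs.trans hst) measureReal_nonneg
  have h3 : 0 ≤ s * D.real (Ici s) * D.real (Ici t) :=
    mul_nonneg (mul_nonneg hs measureReal_nonneg) measureReal_nonneg
  nlinarith

end HasRegularTail

/-! ### The single-agent view of a mechanism -/

/-- The allocation and the payment that a single bidder faces as functions of her own report, the
reports of the others being fixed: incentive compatible and individually rational. -/
structure SingleAgent (x p : ℝ → ℝ) : Prop where
  nonneg : ∀ a, 0 ≤ a → 0 ≤ x a
  le_one : ∀ a, 0 ≤ a → x a ≤ 1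
  ic : ∀ a b, 0 ≤ a → 0 ≤ b → a * x b - p b ≤ a * x a - p a
  ir : ∀ a, 0 ≤ a → p a ≤ a * x a

namespace SingleAgent

variable {x p : ℝ → ℝ}

theorem pay_sub_le (h : SingleAgent x p) {a b : ℝ} (ha : 0 ≤ a) (hb : 0 ≤ b) :
    p b - p a ≤ b * (x b - x a) := by
  linarith [h.ic b a hb ha]

theorem mono (h : SingleAgent x p) {a b : ℝ} (ha : 0 ≤ a) (hab : a ≤ b) : x a ≤ x b := by
  rcases hab.eq_or_lt with rfl | hlt
  · exact le_rfl
  have h1 := h.pay_sub_le ha (ha.trans hab)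
  have h2 := h.pay_sub_le (ha.trans hab) ha
  by_contra hcon
  push Not at hcon
  nlinarith

theorem pay_mono (h : SingleAgent x p) {a b : ℝ} (ha : 0 ≤ a) (hab : a ≤ b) : p a ≤ p b := by
  have h2 := h.pay_sub_le (ha.trans hab) ha
  nlinarith [h.mono ha hab]

/-- The expected payments on top of the payment at `H`, collected from values above `H`, are at most
the best revenue of a posted price above `H`, scaled by the increase of the allocation. The values
are grouped geometrically: a value in `[H r^k, H r^(k+1))` pays at most what `H r^(k+1)` pays, and
the increments of the payment along the sequence `H r^j` are bounded by incentive compatibility. -/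
theorem lintegral_pay_tail (h : SingleAgent x p) {D : Measure ℝ} [IsProbabilityMeasure D]
    {H S : ℝ} (hH : 0 < H) (hS : ∀ t, H ≤ t → t * D.real (Ici t) ≤ S) :
    ∫⁻ y in Ici H, ENNReal.ofReal (p y - p H) ∂D ≤ ENNReal.ofReal ((1 - x H) * S) := by
  have hS0 : 0 ≤ S := (mul_nonneg hH.le measureReal_nonneg).trans (hS H le_rfl)
  have key : ∀ r : ℝ, 1 < r →
      ∫⁻ y in Ici H, ENNReal.ofReal (p y - p H) ∂D ≤ ENNReal.ofReal (r * ((1 - x H) * S)) := by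
    intro r hr
    set g : ℕ → ℝ := fun j => H * r ^ j with hg
    have hr0 : 0 < r := by linarith
    have hg0 : ∀ j, 0 < g j := fun j => mul_pos hH (pow_pos hr0 j)
    have hgmono : Monotone g := fun i j hij =>
      mul_le_mul_of_nonneg_left (pow_le_pow_right₀ hr.le hij) hH.le
    have hgH : ∀ j, H ≤ g j := fun j => by simpa [hg] using hgmono (Nat.zero_le j)
    set d : ℕ → ℝ := fun j => x (g (j + 1)) - x (g j) with hd
    have hd0 : ∀ j, 0 ≤ d j := fun j => sub_nonneg.2 (h.mono (hg0 j).le (hgmono (Nat.le_succ j)))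
    have hpt : ∀ y ∈ Ici H, ENNReal.ofReal (p y - p H) ≤
        ∑' j, (Ici (g j)).indicator (fun _ => ENNReal.ofReal (g (j + 1) * d j)) y := by
      intro y hy
      have hy1 : 1 ≤ y / H := by rw [le_div_iff₀ hH]; simpa using hy
      obtain ⟨k, hk1, hk2⟩ := exists_nat_pow_near hy1 hr
      rw [le_div_iff₀ hH] at hk1
      rw [div_lt_iff₀ hH] at hk2
      have hyk : y ≤ g (k + 1) := by simp only [hg]; linarith
      have hky : g k ≤ y := by simp only [hg]; linarith
      have h1 : p y - p H ≤ ∑ j ∈ Finset.range (k + 1), g (j + 1) * d j := by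
        calc p y - p H ≤ p (g (k + 1)) - p (g 0) := by
              have : g 0 = H := by simp [hg]
              rw [this]
              linarith [h.pay_mono (hH.le.trans hy) hyk]
          _ = ∑ j ∈ Finset.range (k + 1), (p (g (j + 1)) - p (g j)) := by
              rw [Finset.sum_range_sub (fun j => p (g j))]
          _ ≤ _ := Finset.sum_le_sum fun j _ => h.pay_sub_le (hg0 j).le (hg0 (j + 1)).le
      calc ENNReal.ofReal (p y - p H)
          ≤ ENNReal.ofReal (∑ j ∈ Finset.range (k + 1), g (j + 1) * d j) :=
            ENNReal.ofReal_le_ofReal h1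
        _ = ∑ j ∈ Finset.range (k + 1), ENNReal.ofReal (g (j + 1) * d j) :=
            ENNReal.ofReal_sum_of_nonneg fun j _ => mul_nonneg (hg0 _).le (hd0 j)
        _ = ∑ j ∈ Finset.range (k + 1),
              (Ici (g j)).indicator (fun _ => ENNReal.ofReal (g (j + 1) * d j)) y := by
            refine Finset.sum_congr rfl fun j hj => ?_
            rw [indicator_of_mem]
            exact (hgmono (Nat.lt_succ_iff.1 (Finset.mem_range.1 hj))).trans hky
        _ ≤ _ := ENNReal.sum_le_tsum _
    calc ∫⁻ y in Ici H, ENNReal.ofReal (p y - p H) ∂D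
        ≤ ∫⁻ y in Ici H, ∑' j,
            (Ici (g j)).indicator (fun _ => ENNReal.ofReal (g (j + 1) * d j)) y ∂D :=
          setLIntegral_mono' measurableSet_Ici hpt
      _ ≤ ∫⁻ y, ∑' j, (Ici (g j)).indicator (fun _ => ENNReal.ofReal (g (j + 1) * d j)) y ∂D :=
          setLIntegral_le_lintegral _ _
      _ = ∑' j, ENNReal.ofReal (g (j + 1) * d j) * D (Ici (g j)) := by
          rw [lintegral_tsum fun j => (measurable_const.indicator measurableSet_Ici).aemeasurable]
          simp_rw [lintegral_indicator_const measurableSet_Ici]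
      _ ≤ ∑' j, ENNReal.ofReal (r * S * d j) := by
          refine ENNReal.tsum_le_tsum fun j => ?_
          rw [← ofReal_measureReal, ← ENNReal.ofReal_mul (mul_nonneg (hg0 _).le (hd0 j))]
          refine ENNReal.ofReal_le_ofReal ?_
          have : g (j + 1) = r * g j := by simp only [hg]; ring
          rw [this]
          have := mul_le_mul_of_nonneg_left (hS (g j) (hgH j)) (mul_nonneg hr0.le (hd0 j))
          linarith
      _ ≤ ENNReal.ofReal (r * ((1 - x H) * S)) := by
          refine ENNReal.tsum_le_of_sum_range_le fun N => ?_
          rw [← ENNReal.ofReal_sum_of_nonneg fun j _ =>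
            mul_nonneg (mul_nonneg hr0.le hS0) (hd0 j)]
          refine ENNReal.ofReal_le_ofReal ?_
          rw [← Finset.mul_sum, Finset.sum_range_sub (fun j => x (g j))]
          have h2 : g 0 = H := by simp [hg]
          rw [h2]
          have h3 := h.le_one (g N) (hg0 N).le
          have := mul_le_mul_of_nonneg_left (sub_le_sub_right h3 (x H)) (mul_nonneg hr0.le hS0)
          linarith
  have hlim : Filter.Tendsto (fun r : ℝ => ENNReal.ofReal (r * ((1 - x H) * S)))
      (nhdsWithin 1 (Ioi 1)) (nhds (ENNReal.ofReal ((1 - x H) * S))) := by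
    refine Filter.Tendsto.mono_left ?_ nhdsWithin_le_nhds
    have : Continuous fun r : ℝ => ENNReal.ofReal (r * ((1 - x H) * S)) :=
      ENNReal.continuous_ofReal.comp (by fun_prop)
    simpa using this.tendsto 1
  exact ge_of_tendsto hlim (Filter.eventually_of_mem self_mem_nhdsWithin key)

/-- Payments are bounded by the price `T` per allocated unit, plus the excess from values above
`T`. -/
theorem lintegral_pay_le (h : SingleAgent x p) {D : Measure ℝ} (hD : HasRegularTail D)
    (hx : Measurable x) {T : ℝ} (hT : 0 < T) (hq : D.real (Ici T) ≤ 1 / 2) :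
    ∫⁻ y, ENNReal.ofReal (p y) ∂D ≤
      ∫⁻ y, ENNReal.ofReal (T * x y) ∂D + ENNReal.ofReal (2 * T * D.real (Ici T)) := by
  have := hD.prob
  have h1 := h.lintegral_pay_tail hT fun t ht => hD.mul_survival_le hT.le ht hq
  have h2 : ∀ᵐ y ∂D, ENNReal.ofReal (p y) ≤ ENNReal.ofReal (T * x y) +
      (Ici T).indicator (fun y => ENNReal.ofReal (p y - p T)) y := by
    filter_upwards [hD.ae_nonneg] with y hy
    by_cases hyT : T ≤ y
    · rw [indicator_of_mem (by exact hyT), ← ENNReal.ofReal_add (mul_nonneg hT.le (h.nonneg y hy))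
        (sub_nonneg.2 (h.pay_mono hT.le hyT))]
      refine ENNReal.ofReal_le_ofReal ?_
      nlinarith [h.ir T hT.le, h.mono hT.le hyT]
    · rw [indicator_of_notMem (by exact hyT), add_zero]
      refine ENNReal.ofReal_le_ofReal ?_
      nlinarith [h.ir y hy, h.nonneg y hy]
  calc ∫⁻ y, ENNReal.ofReal (p y) ∂D
      ≤ ∫⁻ y, (ENNReal.ofReal (T * x y) +
          (Ici T).indicator (fun y => ENNReal.ofReal (p y - p T)) y) ∂D := lintegral_mono_ae h2
    _ = ∫⁻ y, ENNReal.ofReal (T * x y) ∂D + ∫⁻ y in Ici T, ENNReal.ofReal (p y - p T) ∂D := by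
        rw [lintegral_add_left (by fun_prop), lintegral_indicator measurableSet_Ici]
    _ ≤ _ := by
        refine add_le_add_right (h1.trans (ENNReal.ofReal_le_ofReal ?_)) _
        have := h.nonneg T hT.le
        have h3 : 0 ≤ 2 * T * D.real (Ici T) :=
          mul_nonneg (by linarith) measureReal_nonneg
        nlinarith

end SingleAgent

/-! ### Resampling one coordinate -/

section Resample

variable {ι : Type*} [Fintype ι] [DecidableEq ι] (D : ι → Measure ℝ)
  [∀ i, IsProbabilityMeasure (D i)]

theorem measurePreserving_update (i : ι) :
    MeasurePreserving (fun p : (ι → ℝ) × ℝ => Function.update p.1 i p.2)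
      ((Measure.pi D).prod (D i)) (Measure.pi D) := by
  refine ⟨measurable_update', ?_⟩
  symm
  refine Measure.pi_eq fun s hs => ?_
  rw [Measure.map_apply measurable_update' (MeasurableSet.univ_pi hs)]
  have : (fun p : (ι → ℝ) × ℝ => Function.update p.1 i p.2) ⁻¹' (Set.pi univ s) =
      (Set.pi univ (Function.update s i univ)) ×ˢ s i := by
    ext ⟨v, y⟩
    simp only [mem_preimage, mem_pi, mem_univ, true_imp_iff, mem_prod]
    constructor
    · intro h
      refine ⟨fun j => ?_, by simpa using h i⟩
      by_cases hj : j = i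
      · subst hj; simp
      · simpa [hj] using h j
    · rintro ⟨h1, h2⟩ j
      by_cases hj : j = i
      · subst hj; simpa using h2
      · simpa [hj] using h1 j
  rw [this, Measure.prod_prod, Measure.pi_pi, ← Finset.mul_prod_erase _ _ (Finset.mem_univ i),
    ← Finset.mul_prod_erase _ (fun i => D i (s i)) (Finset.mem_univ i)]
  simp only [Function.update_self, measure_univ, one_mul]
  rw [mul_comm]
  congr 1
  refine Finset.prod_congr rfl fun j hj => ?_
  rw [Function.update_of_ne (Finset.ne_of_mem_erase hj)]

theorem lintegral_update (i : ι) {F : (ι → ℝ) → ℝ≥0∞} (hF : Measurable F) :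
    ∫⁻ v, F v ∂Measure.pi D =
      ∫⁻ v, ∫⁻ y, F (Function.update v i y) ∂D i ∂Measure.pi D := by
  rw [← (measurePreserving_update D i).lintegral_comp hF,
    lintegral_prod (fun p : (ι → ℝ) × ℝ => F (Function.update p.1 i p.2))
      (hF.comp measurable_update').aemeasurable]

theorem integral_update (i : ι) {F : (ι → ℝ) → ℝ} (hF : Integrable F (Measure.pi D)) :
    ∫ v, F v ∂Measure.pi D =
      ∫ v, ∫ y, F (Function.update v i y) ∂D i ∂Measure.pi D := by
  have h := measurePreserving_update D i
  have h1 : ∫ v, F v ∂Measure.pi D =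
      ∫ p : (ι → ℝ) × ℝ, F (Function.update p.1 i p.2) ∂(Measure.pi D).prod (D i) := by
    conv_lhs => rw [← h.map_eq]
    rw [integral_map h.measurable.aemeasurable (by rw [h.map_eq]; exact hF.1)]
  rw [h1, integral_prod]
  exact h.integrable_comp_of_integrable hF

theorem integrable_update_prod (i : ι) {F : (ι → ℝ) → ℝ} (hF : Integrable F (Measure.pi D)) :
    Integrable (fun p : (ι → ℝ) × ℝ => F (Function.update p.1 i p.2))
      ((Measure.pi D).prod (D i)) :=
  (measurePreserving_update D i).integrable_comp_of_integrable hF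

end Resample

/-! ### Normalized mechanisms -/

theorem update_nonneg {n : ℕ} {v : Fin n → ℝ} (hv : 0 ≤ v) (i : Fin n) {y : ℝ} (hy : 0 ≤ y) :
    0 ≤ Function.update v i y := by
  intro j
  by_cases hj : j = i
  · subst hj; simpa using hy
  · simpa [hj] using hv j

/-- The mechanism in which every bidder pays, in addition, what she would receive on reporting the
value `0`. -/
def Mechanism.normalize {n : ℕ} (M : Mechanism n) : Mechanism n where
  alloc := M.alloc
  pay v i := M.pay v i - M.pay (Function.update v i 0) i

namespace Mechanism

variable {n : ℕ} {M : Mechanism n}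

theorem IsAdmissible.pay_zero_nonpos (hM : M.IsAdmissible) {v : Fin n → ℝ} (hv : 0 ≤ v)
    (i : Fin n) : M.pay (Function.update v i 0) i ≤ 0 := by
  have := hM.2.2 _ (update_nonneg hv i le_rfl) i
  simp only [Function.update_self, zero_mul] at this
  linarith

theorem IsAdmissible.normalize (hM : M.IsAdmissible) : M.normalize.IsAdmissible := by
  obtain ⟨⟨hx, hp, hfeas⟩, hds, hir⟩ := hM
  refine ⟨⟨hx, ?_, hfeas⟩, ?_, ?_⟩
  · refine measurable_pi_lambda _ fun i => ?_
    have h1 : Measurable fun v : Fin n → ℝ => M.pay v i := (measurable_pi_apply i).comp hp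
    exact h1.sub (h1.comp (measurable_update'.comp (measurable_id.prodMk measurable_const)))
  · intro v hv i b hb
    have := hds v hv i b hb
    simp only [Mechanism.normalize, Function.update_idem]
    linarith
  · intro v hv i
    have h1 := hds v hv i 0 le_rfl
    have h2 := hir _ (update_nonneg hv i le_rfl) i
    have h3 := (hfeas _ (update_nonneg hv i le_rfl)).1 i
    simp only [Mechanism.normalize]
    nlinarith [mul_nonneg (hv i) h3]

theorem IsAdmissible.normalize_pay_nonneg (hM : M.IsAdmissible) {v : Fin n → ℝ} (hv : 0 ≤ v)
    (i : Fin n) : 0 ≤ M.normalize.pay v i := by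
  have h1 := hM.2.1 _ (update_nonneg hv i le_rfl) i (v i) (hv i)
  simp only [Function.update_idem, Function.update_self, Function.update_eq_self] at h1
  simp only [Mechanism.normalize]
  linarith

theorem IsAdmissible.pay_le_normalize (hM : M.IsAdmissible) {v : Fin n → ℝ} (hv : 0 ≤ v)
    (i : Fin n) : M.pay v i ≤ M.normalize.pay v i := by
  have := hM.pay_zero_nonpos hv i
  simp only [Mechanism.normalize]
  linarith

theorem IsAdmissible.alloc_le_one (hM : M.IsAdmissible) {v : Fin n → ℝ} (hv : 0 ≤ v)
    (i : Fin n) : M.alloc v i ≤ 1 := by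
  obtain ⟨h1, h2⟩ := hM.1.2.2 v hv
  exact (Finset.single_le_sum (fun j _ => h1 j) (Finset.mem_univ i)).trans h2

theorem IsAdmissible.singleAgent (hM : M.IsAdmissible)
    {v : Fin n → ℝ} (hv : 0 ≤ v) (i : Fin n) :
    SingleAgent (fun y => M.alloc (Function.update v i y) i)
      (fun y => M.pay (Function.update v i y) i) where
  nonneg a ha := (hM.1.2.2 _ (update_nonneg hv i ha)).1 i
  le_one a ha := hM.alloc_le_one (update_nonneg hv i ha) i
  ic a b ha hb := by
    have := hM.2.1 _ (update_nonneg hv i ha) i b hb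
    simpa only [Function.update_idem, Function.update_self] using this
  ir a ha := by
    have := hM.2.2 _ (update_nonneg hv i ha) i
    simp only [Function.update_self] at this
    linarith

theorem IsFeasible.measurable_alloc (hM : M.IsFeasible) (i : Fin n) :
    Measurable fun v => M.alloc v i :=
  (measurable_pi_apply i).comp hM.1

theorem IsFeasible.measurable_pay (hM : M.IsFeasible) (i : Fin n) :
    Measurable fun v => M.pay v i :=
  (measurable_pi_apply i).comp hM.2.1

end Mechanism

/-! ### The optimal revenue up to a constant factor -/

section Benchmark

variable {n : ℕ} {D : Fin n → Measure ℝ}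

theorem ae_pi_nonneg (hD : ∀ i, HasRegularTail (D i)) : ∀ᵐ v ∂Measure.pi D, 0 ≤ v := by
  have := fun i => (hD i).prob
  have : ∀ i, ∀ᵐ v ∂Measure.pi D, 0 ≤ v i := fun i =>
    (measurePreserving_eval D i).quasiMeasurePreserving.ae (hD i).ae_nonneg
  filter_upwards [ae_all_iff.2 this] with v hv i using hv i

theorem lintegral_pay_pi_le (hD : ∀ i, HasRegularTail (D i)) {M : Mechanism n}
    (hM : M.IsAdmissible) {T : ℝ} (hT : 0 < T)
    (hq : ∀ i, (D i).real (Ici T) ≤ 1 / 2) :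
    ∑ i, ∫⁻ v, ENNReal.ofReal (M.pay v i) ∂Measure.pi D ≤
      ENNReal.ofReal (T + 2 * T * ∑ i, (D i).real (Ici T)) := by
  have := fun i => (hD i).prob
  have hx := hM.1.measurable_alloc
  have hp := hM.1.measurable_pay
  have h1 : ∀ i, ∫⁻ v, ENNReal.ofReal (M.pay v i) ∂Measure.pi D ≤
      ∫⁻ v, ENNReal.ofReal (T * M.alloc v i) ∂Measure.pi D +
        ENNReal.ofReal (2 * T * (D i).real (Ici T)) := by
    intro i
    have hx' : Measurable fun v => ENNReal.ofReal (T * M.alloc v i) := by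
      have := hx i; fun_prop
    rw [lintegral_update D i (hp i).ennreal_ofReal, lintegral_update D i hx']
    calc _ ≤ ∫⁻ v, ((∫⁻ y, ENNReal.ofReal (T * M.alloc (Function.update v i y) i) ∂D i) +
            ENNReal.ofReal (2 * T * (D i).real (Ici T))) ∂Measure.pi D := by
          refine lintegral_mono_ae ?_
          filter_upwards [ae_pi_nonneg hD] with v hv
          exact (hM.singleAgent hv i).lintegral_pay_le (hD i)
            ((hx i).comp (measurable_update v)) hT (hq i)
      _ = _ := by
          rw [lintegral_add_right _ measurable_const]; simp
  calc _ ≤ ∑ i, (∫⁻ v, ENNReal.ofReal (T * M.alloc v i) ∂Measure.pi D +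
        ENNReal.ofReal (2 * T * (D i).real (Ici T))) := Finset.sum_le_sum fun i _ => h1 i
    _ = ∫⁻ v, ∑ i, ENNReal.ofReal (T * M.alloc v i) ∂Measure.pi D +
          ENNReal.ofReal (2 * T * ∑ i, (D i).real (Ici T)) := by
        rw [Finset.sum_add_distrib, lintegral_finsetSum _ fun i _ => by
          have := hx i; fun_prop, Finset.mul_sum, ENNReal.ofReal_sum_of_nonneg]
        intro i _
        exact mul_nonneg (by linarith) measureReal_nonneg
    _ ≤ ∫⁻ v, ENNReal.ofReal T ∂Measure.pi D +
          ENNReal.ofReal (2 * T * ∑ i, (D i).real (Ici T)) := by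
        refine add_le_add_left (lintegral_mono_ae ?_) _
        filter_upwards [ae_pi_nonneg hD] with v hv
        obtain ⟨h2, h3⟩ := hM.1.2.2 v hv
        rw [← ENNReal.ofReal_sum_of_nonneg fun i _ => mul_nonneg hT.le (h2 i), ← Finset.mul_sum]
        exact ENNReal.ofReal_le_ofReal (by nlinarith)
    _ = _ := by
        rw [lintegral_const, measure_univ, mul_one, ENNReal.ofReal_add hT.le]
        exact mul_nonneg (by linarith) (Finset.sum_nonneg fun i _ => measureReal_nonneg)

theorem integrable_pay (hD : ∀ i, HasRegularTail (D i)) {M : Mechanism n}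
    (hM : M.IsAdmissible) (hpos : ∀ v, 0 ≤ v → ∀ i, 0 ≤ M.pay v i) {T : ℝ} (hT : 0 < T)
    (hq : ∀ i, (D i).real (Ici T) ≤ 1 / 2) (i : Fin n) :
    Integrable (fun v => M.pay v i) (Measure.pi D) := by
  refine ⟨(hM.1.measurable_pay i).aestronglyMeasurable, ?_⟩
  have hae : 0 ≤ᵐ[Measure.pi D] fun v => M.pay v i := by
    filter_upwards [ae_pi_nonneg hD] with v hv using hpos v hv i
  rw [hasFiniteIntegral_iff_ofReal hae]
  refine lt_of_le_of_lt ((Finset.single_le_sum (f := fun i =>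
    ∫⁻ v, ENNReal.ofReal (M.pay v i) ∂Measure.pi D) (fun _ _ => zero_le)
    (Finset.mem_univ i)).trans (lintegral_pay_pi_le hD hM hT hq)) ENNReal.ofReal_lt_top

theorem rev_le_of_nonneg (hD : ∀ i, HasRegularTail (D i)) {M : Mechanism n}
    (hM : M.IsAdmissible) (hpos : ∀ v, 0 ≤ v → ∀ i, 0 ≤ M.pay v i) {T : ℝ} (hT : 0 < T)
    (hq : ∀ i, (D i).real (Ici T) ≤ 1 / 2) :
    rev M D ≤ T + 2 * T * ∑ i, (D i).real (Ici T) := by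
  have hint := integrable_pay hD hM hpos hT hq
  have h0 : 0 ≤ T + 2 * T * ∑ i, (D i).real (Ici T) :=
    add_nonneg hT.le (mul_nonneg (by linarith) (Finset.sum_nonneg fun i _ => measureReal_nonneg))
  rw [rev, integral_finsetSum _ fun i _ => hint i]
  have h1 : ∀ i, ENNReal.ofReal (∫ v, M.pay v i ∂Measure.pi D) =
      ∫⁻ v, ENNReal.ofReal (M.pay v i) ∂Measure.pi D := fun i => by
    refine ofReal_integral_eq_lintegral_ofReal (hint i) ?_
    filter_upwards [ae_pi_nonneg hD] with v hv using hpos v hv i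
  have h2 := lintegral_pay_pi_le hD hM hT hq
  simp_rw [← h1] at h2
  rw [← ENNReal.ofReal_sum_of_nonneg fun i _ => integral_nonneg_of_ae (by
    filter_upwards [ae_pi_nonneg hD] with v hv using hpos v hv i)] at h2
  exact (ENNReal.ofReal_le_ofReal_iff h0).1 h2

theorem rev_le_rev_normalize (hD : ∀ i, HasRegularTail (D i)) {M : Mechanism n}
    (hM : M.IsAdmissible) (hint : Integrable (fun v => ∑ i, M.pay v i) (Measure.pi D))
    {T : ℝ} (hT : 0 < T) (hq : ∀ i, (D i).real (Ici T) ≤ 1 / 2) :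
    rev M D ≤ rev M.normalize D := by
  refine integral_mono_ae hint (integrable_finsetSum _ fun i _ => integrable_pay hD hM.normalize
    (fun v hv i => hM.normalize_pay_nonneg hv i) hT hq i) ?_
  filter_upwards [ae_pi_nonneg hD] with v hv
  exact Finset.sum_le_sum fun i _ => hM.pay_le_normalize hv i

theorem achievableRevenues_le (hD : ∀ i, HasRegularTail (D i)) {T : ℝ} (hT : 0 < T)
    (hq : ∀ i, (D i).real (Ici T) ≤ 1 / 2) {r : ℝ} (hr : r ∈ achievableRevenues D) :
    r ≤ T + 2 * T * ∑ i, (D i).real (Ici T) := by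
  obtain ⟨M, hM, hint, rfl⟩ := hr
  exact (rev_le_rev_normalize hD hM hint hT hq).trans
    (rev_le_of_nonneg hD hM.normalize (fun v hv i => hM.normalize_pay_nonneg hv i) hT hq)

/-- A median of the highest value: no bidder, respectively some bidder, has a value of at least `T`
with probability one half. -/
structure IsMedianMax (D : Fin n → Measure ℝ) (T : ℝ) : Prop where
  pos : 0 < T
  prod_eq : ∏ i, (1 - (D i).real (Ici T)) = 1 / 2

theorem exists_isMedianMax (hn : 1 ≤ n) (hD : ∀ i, HasRegularTail (D i)) :
    ∃ T, IsMedianMax D T := by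
  have := fun i => (hD i).prob
  set F : ℝ → ℝ := fun t => ∏ i, (1 - (D i).real (Ici t)) with hF
  have hc : Continuous F := continuous_finsetProd _ fun i _ =>
    continuous_const.sub (hD i).continuous_survival
  have h0 : F 0 = 0 := by
    rw [hF]
    refine Finset.prod_eq_zero (Finset.mem_univ (⟨0, hn⟩ : Fin n)) ?_
    rw [(hD _).survival_zero]; simp
  have hlim : Filter.Tendsto F Filter.atTop (nhds 1) := by
    have : Filter.Tendsto F Filter.atTop (nhds (∏ _i : Fin n, (1 - (0 : ℝ)))) :=
      tendsto_finsetProd _ fun i _ => (hD i).tendsto_survival.const_sub 1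
    simpa using this
  obtain ⟨b, hb0, hb⟩ := ((Filter.eventually_ge_atTop (0 : ℝ)).and
    (hlim.eventually (lt_mem_nhds (show (1 / 2 : ℝ) < 1 by norm_num)))).exists
  obtain ⟨T, hT, hTF⟩ := intermediate_value_Icc hb0 hc.continuousOn
    (show (1 / 2 : ℝ) ∈ Icc (F 0) (F b) from ⟨by rw [h0]; norm_num, hb.le⟩)
  refine ⟨T, lt_of_le_of_ne hT.1 ?_, hTF⟩
  rintro rfl
  rw [h0] at hTF; norm_num at hTF

namespace IsMedianMax

variable {T : ℝ}

theorem survival_le_half (h : IsMedianMax D T) (hD : ∀ i, HasRegularTail (D i)) (i : Fin n) :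
    (D i).real (Ici T) ≤ 1 / 2 := by
  have := fun i => (hD i).prob
  have h1 : ∏ j, (1 - (D j).real (Ici T)) ≤ 1 - (D i).real (Ici T) := by
    rw [← Finset.mul_prod_erase _ _ (Finset.mem_univ i)]
    refine mul_le_of_le_one_right (by linarith [measureReal_le_one (μ := D i) (s := Ici T)]) ?_
    refine Finset.prod_le_one (fun j _ => ?_) fun j _ => ?_
    · linarith [measureReal_le_one (μ := D j) (s := Ici T)]
    · linarith [measureReal_nonneg (μ := D j) (s := Ici T)]
  rw [h.prod_eq] at h1
  linarith

theorem sum_survival_le_one (h : IsMedianMax D T) (hD : ∀ i, HasRegularTail (D i)) :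
    ∑ i, (D i).real (Ici T) ≤ 1 := by
  by_contra! hcon
  have h1 : ∏ i, (1 - (D i).real (Ici T)) ≤ Real.exp (-∑ i, (D i).real (Ici T)) := by
    have := fun i => (hD i).prob
    rw [← Finset.sum_neg_distrib, Real.exp_sum]
    refine Finset.prod_le_prod (fun i _ => ?_) fun i _ => ?_
    · linarith [measureReal_le_one (μ := D i) (s := Ici T)]
    · linarith [Real.add_one_le_exp (-(D i).real (Ici T))]
  rw [h.prod_eq] at h1
  have h2 : Real.exp (-∑ i, (D i).real (Ici T)) ≤ Real.exp (-1) := Real.exp_le_exp.2 (by linarith)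
  have h3 : Real.exp (-1) < 1 / 2 := by
    rw [Real.exp_neg, inv_lt_comm₀ (Real.exp_pos 1) (by norm_num)]
    linarith [Real.exp_one_gt_d9]
  linarith

end IsMedianMax

/-- The first bidder in the order of `Fin n` whose value is at least `H` gets the item at
price `H`. -/
def postedPrice (n : ℕ) (H : ℝ) : Mechanism n where
  alloc v i := if H ≤ v i ∧ ∀ j < i, v j < H then 1 else 0
  pay v i := if H ≤ v i ∧ ∀ j < i, v j < H then H else 0

theorem postedPrice_sum_alloc (H : ℝ) (v : Fin n → ℝ) :
    ∑ i, (postedPrice n H).alloc v i = if ∃ i, H ≤ v i then 1 else 0 := by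
  classical
  simp only [postedPrice]
  split_ifs with h
  · have hne : (Finset.univ.filter fun i => H ≤ v i).Nonempty := by
      obtain ⟨i, hi⟩ := h; exact ⟨i, by simpa using hi⟩
    set i₀ := (Finset.univ.filter fun i => H ≤ v i).min' hne with hi₀
    have h1 : H ≤ v i₀ := by simpa using Finset.min'_mem _ hne
    have h2 : ∀ j < i₀, v j < H := fun j hj => by
      by_contra! hcon
      exact absurd (Finset.min'_le _ j (by simpa using hcon)) (not_le.2 hj)
    rw [Finset.sum_eq_single i₀]
    · rw [if_pos ⟨h1, h2⟩]
    · intro j _ hj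
      rw [if_neg]
      rintro ⟨h3, h4⟩
      rcases lt_or_gt_of_ne hj with h5 | h5
      · exact absurd h3 (not_le.2 (h2 j h5))
      · exact absurd h1 (not_le.2 (h4 i₀ h5))
    · simp
  · push Not at h
    refine Finset.sum_eq_zero fun i _ => ?_
    rw [if_neg]
    rintro ⟨h1, -⟩
    exact absurd h1 (not_le.2 (h i))

theorem postedPrice_isAdmissible (H : ℝ) : (postedPrice n H).IsAdmissible := by
  have hset : ∀ i : Fin n, MeasurableSet {v : Fin n → ℝ | H ≤ v i ∧ ∀ j < i, v j < H} := fun i =>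
    (measurableSet_le measurable_const (measurable_pi_apply i)).inter
      (by
        have : {v : Fin n → ℝ | ∀ j < i, v j < H} = ⋂ j, ⋂ (_ : j < i), {v | v j < H} := by
          ext v; simp
        change MeasurableSet {v : Fin n → ℝ | ∀ j < i, v j < H}
        rw [this]
        exact MeasurableSet.iInter fun j => MeasurableSet.iInter fun _ =>
          measurableSet_lt (measurable_pi_apply j) measurable_const)
  refine ⟨⟨?_, ?_, fun v _ => ⟨fun i => ?_, ?_⟩⟩, ?_, ?_⟩
  · exact measurable_pi_lambda _ fun i => Measurable.ite (hset i) measurable_const measurable_const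
  · exact measurable_pi_lambda _ fun i => Measurable.ite (hset i) measurable_const measurable_const
  · simp only [postedPrice]; split_ifs <;> norm_num
  · rw [postedPrice_sum_alloc]; split_ifs <;> norm_num
  · intro v hv i b hb
    have h1 : (∀ j < i, Function.update v i b j < H) ↔ ∀ j < i, v j < H := by
      refine forall₂_congr fun j hj => ?_
      rw [Function.update_of_ne hj.ne]
    simp only [postedPrice, Function.update_self, h1]
    split_ifs with h2 h3 h3
    · linarith
    · have : v i < H := by
        by_contra! h4; exact h3 ⟨h4, h2.2⟩
      linarith
    · linarith [h3.1]
    · simp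
  · intro v hv i
    simp only [postedPrice]
    split_ifs with h
    · linarith [h.1]
    · simp

theorem measureReal_exists_ge (hD : ∀ i, HasRegularTail (D i)) (H : ℝ) :
    (Measure.pi D).real {v | ∃ i, H ≤ v i} = 1 - ∏ i, (1 - (D i).real (Ici H)) := by
  have := fun i => (hD i).prob
  have h1 : {v : Fin n → ℝ | ∃ i, H ≤ v i} = (Set.pi univ fun _ => Iio H)ᶜ := by
    ext v; simp
  rw [h1, probReal_compl_eq_one_sub (MeasurableSet.univ_pi fun _ => measurableSet_Iio),
    measureReal_def, Measure.pi_pi, ENNReal.toReal_prod]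
  congr 1
  refine Finset.prod_congr rfl fun i _ => ?_
  rw [← measureReal_def, ← compl_Ici, probReal_compl_eq_one_sub measurableSet_Ici]

theorem postedPrice_mem_achievable (hD : ∀ i, HasRegularTail (D i)) (H : ℝ) :
    H * (1 - ∏ i, (1 - (D i).real (Ici H))) ∈ achievableRevenues D := by
  have := fun i => (hD i).prob
  have hs : MeasurableSet {v : Fin n → ℝ | ∃ i, H ≤ v i} := by
    have : {v : Fin n → ℝ | ∃ i, H ≤ v i} = ⋃ i, {v | H ≤ v i} := by ext v; simp
    rw [this]
    exact MeasurableSet.iUnion fun i => measurableSet_le measurable_const (measurable_pi_apply i)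
  have h1 : (fun v => ∑ i, (postedPrice n H).pay v i) =
      {v : Fin n → ℝ | ∃ i, H ≤ v i}.indicator fun _ => H := by
    ext v
    have h2 : ∀ i, (postedPrice n H).pay v i = H * (postedPrice n H).alloc v i := by
      intro i; simp only [postedPrice]; split_ifs <;> simp
    simp_rw [h2]
    rw [← Finset.mul_sum, postedPrice_sum_alloc, indicator]
    simp only [mem_ofPred_eq]
    split_ifs <;> simp
  refine ⟨postedPrice n H, postedPrice_isAdmissible H, ?_, ?_⟩
  · rw [h1]; exact (integrable_const _).indicator hs
  · rw [rev, h1, integral_indicator hs, setIntegral_const, measureReal_exists_ge hD, smul_eq_mul,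
      mul_comm]

variable {T : ℝ}

theorem bddAbove_achievableRevenues (hD : ∀ i, HasRegularTail (D i)) (hT : IsMedianMax D T) :
    BddAbove (achievableRevenues D) :=
  ⟨_, fun _ hr => achievableRevenues_le hD hT.pos (hT.survival_le_half hD) hr⟩

theorem rev_le_opt (hD : ∀ i, HasRegularTail (D i)) (hT : IsMedianMax D T) {M : Mechanism n}
    (hM : M.IsAdmissible) (hint : Integrable (fun v => ∑ i, M.pay v i) (Measure.pi D)) :
    rev M D ≤ opt D :=
  le_csSup (bddAbove_achievableRevenues hD hT) ⟨M, hM, hint, rfl⟩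

theorem half_le_opt (hD : ∀ i, HasRegularTail (D i)) (hT : IsMedianMax D T) :
    T / 2 ≤ opt D := by
  refine le_csSup (bddAbove_achievableRevenues hD hT) ?_
  have := postedPrice_mem_achievable hD T
  rw [hT.prod_eq] at this
  convert this using 1; ring

theorem opt_le (hD : ∀ i, HasRegularTail (D i)) (hT : IsMedianMax D T) : opt D ≤ 3 * T := by
  refine csSup_le ⟨_, postedPrice_mem_achievable hD T⟩ fun r hr => ?_
  have h1 := achievableRevenues_le hD hT.pos (hT.survival_le_half hD) hr
  nlinarith [hT.sum_survival_le_one hD, hT.pos]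

end Benchmark

/-! ### Ironing of finitely supported distributions -/

/-- A finite set of non-negative values that contains `0`. -/
structure IsGrid (V : Set ℝ) : Prop where
  finite : V.Finite
  zero_mem : 0 ∈ V
  nonneg : ∀ w ∈ V, 0 ≤ w

/-- A probability distribution on the grid `V`. -/
structure IsSupportedOn (E : Measure ℝ) (V : Set ℝ) : Prop where
  prob : IsProbabilityMeasure E
  grid : IsGrid V
  compl : E Vᶜ = 0

namespace IsSupportedOn

variable {E : Measure ℝ} {V : Set ℝ}

theorem ae_mem (h : IsSupportedOn E V) : ∀ᵐ v ∂E, v ∈ V := by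
  rw [ae_iff]; exact h.compl

theorem real_congr (h : IsSupportedOn E V) {A B : Set ℝ} (hAB : ∀ v ∈ V, v ∈ A ↔ v ∈ B) :
    E.real A = E.real B := by
  rw [measureReal_def, measureReal_def]
  congr 1
  refine measure_congr ?_
  filter_upwards [h.ae_mem] with v hv
  exact propext (hAB v hv)

theorem exists_mem_of_pos (h : IsSupportedOn E V) {A : Set ℝ} (hA : 0 < E.real A) :
    ∃ w ∈ V, w ∈ A := by
  by_contra! hcon
  have : E.real A = E.real ∅ := h.real_congr fun v hv => by simp [hcon v hv]
  simp at this
  linarith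

theorem exists_next (h : IsSupportedOn E V) {t : ℝ} (ht : 0 < E.real (Ioi t)) :
    ∃ w ∈ V, t < w ∧ E.real (Ici w) = E.real (Ioi t) := by
  obtain ⟨w₀, hw₀, hw₀t⟩ := h.exists_mem_of_pos ht
  obtain ⟨w, ⟨hwV, hwt⟩, hmin⟩ := (h.grid.finite.inter_of_left (Ioi t)).exists_minimalFor id _
    ⟨w₀, hw₀, hw₀t⟩
  refine ⟨w, hwV, hwt, h.real_congr fun v hv =>
    ⟨fun h1 => mem_Ioi.2 (lt_of_lt_of_le hwt (mem_Ici.1 h1)), fun h1 => ?_⟩⟩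
  by_contra hcon
  have := hmin ⟨hv, h1⟩ (not_le.1 hcon).le
  exact hcon this

theorem exists_ceil (h : IsSupportedOn E V) {t : ℝ} (ht : 0 < E.real (Ici t)) :
    ∃ w ∈ V, t ≤ w ∧ E.real (Ici w) = E.real (Ici t) := by
  obtain ⟨w₀, hw₀, hw₀t⟩ := h.exists_mem_of_pos ht
  obtain ⟨w, ⟨hwV, hwt⟩, hmin⟩ := (h.grid.finite.inter_of_left (Ici t)).exists_minimalFor id _
    ⟨w₀, hw₀, hw₀t⟩
  refine ⟨w, hwV, hwt, h.real_congr fun v hv =>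
    ⟨fun h1 => mem_Ici.2 (le_trans hwt (mem_Ici.1 h1)), fun h1 => ?_⟩⟩
  by_contra hcon
  have := hmin ⟨hv, h1⟩ (not_le.1 hcon).le
  exact hcon this

/-- A point above the whole grid. -/
theorem exists_top (h : IsSupportedOn E V) :
    ∃ b, 0 ≤ b ∧ (∀ w ∈ V, w < b) ∧ E.real (Ici b) = 0 := by
  obtain ⟨b, hb⟩ := h.grid.finite.bddAbove
  have hb' : ∀ w ∈ V, w < b + 1 := fun w hw => by linarith [hb hw]
  refine ⟨b + 1, by linarith [hb h.grid.zero_mem], hb', ?_⟩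
  rw [h.real_congr (B := ∅) fun v hv => by simp [hb' v hv]]
  simp

theorem survival_zero (h : IsSupportedOn E V) : E.real (Ici 0) = 1 := by
  have := h.prob
  rw [h.real_congr (B := univ) fun v hv => by simp [h.grid.nonneg v hv]]
  simp

theorem survival_sub (h : IsSupportedOn E V) (v : ℝ) :
    E.real (Ici v) - E.real (Ioi v) = E.real {v} := by
  have := h.prob
  rw [← Ioi_insert, ← union_singleton, measureReal_union (by simp) (measurableSet_singleton v)]
  ring

/-- The affine functions `a + b * q` that dominate the revenues of all prices. -/
theorem majorant_nonneg (h : IsSupportedOn E V) {a b : ℝ}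
    (hab : ∀ v : ℝ, 0 ≤ v → v * E.real (Ici v) ≤ a + b * E.real (Ici v)) {q : ℝ}
    (hq0 : 0 ≤ q) (hq1 : q ≤ 1) : 0 ≤ a + b * q := by
  obtain ⟨t, ht0, -, ht⟩ := h.exists_top
  have h1 := hab t ht0
  have h2 := hab 0 le_rfl
  rw [ht] at h1
  rw [h.survival_zero] at h2
  nlinarith

theorem ironedRevenue_le (h : IsSupportedOn E V) {a b : ℝ}
    (hab : ∀ v : ℝ, 0 ≤ v → v * E.real (Ici v) ≤ a + b * E.real (Ici v)) {q : ℝ}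
    (hq0 : 0 ≤ q) (hq1 : q ≤ 1) : ironedRevenue E q ≤ a + b * q := by
  refine csInf_le ⟨0, ?_⟩ ⟨a, b, hab, rfl⟩
  rintro y ⟨a', b', hab', rfl⟩
  exact h.majorant_nonneg hab' hq0 hq1

theorem majorant_zero (h : IsSupportedOn E V) :
    ∃ b, ∀ v : ℝ, 0 ≤ v → v * E.real (Ici v) ≤ 0 + b * E.real (Ici v) := by
  obtain ⟨b, hb0, hb, -⟩ := h.exists_top
  refine ⟨b, fun v _ => ?_⟩
  rcases (measureReal_nonneg (μ := E) (s := Ici v)).eq_or_lt with h1 | h1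
  · rw [← h1]; simp
  · obtain ⟨w, hw, hvw⟩ := h.exists_mem_of_pos h1
    rw [zero_add]
    exact mul_le_mul_of_nonneg_right (le_trans hvw (hb w hw).le) h1.le

theorem le_ironedRevenue_of_forall (h : IsSupportedOn E V) {q y : ℝ}
    (hy : ∀ a b : ℝ, (∀ v : ℝ, 0 ≤ v → v * E.real (Ici v) ≤ a + b * E.real (Ici v)) →
      y ≤ a + b * q) : y ≤ ironedRevenue E q := by
  obtain ⟨b, hb⟩ := h.majorant_zero
  refine le_csInf ⟨_, 0, b, hb, rfl⟩ ?_
  rintro _ ⟨a', b', hab', rfl⟩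
  exact hy a' b' hab'

theorem revenue_le_ironedRevenue (h : IsSupportedOn E V) {v : ℝ} (hv : 0 ≤ v) :
    v * E.real (Ici v) ≤ ironedRevenue E (E.real (Ici v)) :=
  h.le_ironedRevenue_of_forall fun _ _ hab => hab v hv

theorem ironedRevenue_concave (h : IsSupportedOn E V) {q₁ q₂ α : ℝ} (h1 : 0 ≤ q₁) (h1' : q₁ ≤ 1)
    (h2 : 0 ≤ q₂) (h2' : q₂ ≤ 1) (hα : 0 ≤ α) (hα' : α ≤ 1) :
    α * ironedRevenue E q₁ + (1 - α) * ironedRevenue E q₂ ≤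
      ironedRevenue E (α * q₁ + (1 - α) * q₂) := by
  refine h.le_ironedRevenue_of_forall fun a b hab => ?_
  have h3 := h.ironedRevenue_le hab h1 h1'
  have h4 := h.ironedRevenue_le hab h2 h2'
  nlinarith [mul_le_mul_of_nonneg_left h3 hα, mul_le_mul_of_nonneg_left h4 (sub_nonneg.2 hα')]

theorem ironedRevenue_zero (h : IsSupportedOn E V) : ironedRevenue E 0 = 0 := by
  obtain ⟨b, hb⟩ := h.majorant_zero
  refine le_antisymm ?_ (h.le_ironedRevenue_of_forall fun a b hab =>
    h.majorant_nonneg hab le_rfl zero_le_one)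
  simpa using h.ironedRevenue_le hb le_rfl zero_le_one

/-- For a slope `c`, let `t` be the smallest price that maximizes the revenue `(t - c) * P(X ≥ t)`
of a seller with production cost `c`. It stays a maximizer for slightly smaller costs. -/
theorem exists_monopoly_price (h : IsSupportedOn E V) (c : ℝ) :
    ∃ t δ : ℝ, 0 ≤ t ∧ 0 < δ ∧
      (∀ u, 0 ≤ u → (u - c) * E.real (Ici u) ≤ (t - c) * E.real (Ici t)) ∧
      (∀ u, 0 ≤ u → (u - (c - δ)) * E.real (Ici u) ≤ (t - (c - δ)) * E.real (Ici t)) ∧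
      (0 < E.real (Ici t) → t ∈ V ∧ 0 < E.real {t}) := by
  have := h.prob
  obtain ⟨b, hb0, hb, hbE⟩ := h.exists_top
  set Q : ℝ → ℝ := fun u => E.real (Ici u) with hQ
  have hQ0 : ∀ u, 0 ≤ Q u := fun u => measureReal_nonneg
  have hQanti : Antitone Q := fun u v huv => measureReal_mono (Ici_subset_Ici.2 huv)
  set W : Set ℝ := insert b V with hW
  have hWfin : W.Finite := h.grid.finite.insert b
  have hWnn : ∀ w ∈ W, 0 ≤ w := by
    rintro w (rfl | hw)
    · exact hb0
    · exact h.grid.nonneg w hw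
  -- prices outside the grid are dominated by grid prices with the same quantile
  have hred : ∀ d u, ∃ w ∈ W, (u - d) * Q u ≤ (w - d) * Q w ∧ Q w = Q u := by
    intro d u
    rcases (hQ0 u).eq_or_lt with h1 | h1
    · exact ⟨b, mem_insert _ _, by rw [← h1]; simp [hQ, hbE], by rw [← h1]; exact hbE⟩
    · obtain ⟨w, hw, huw, hwQ⟩ := h.exists_ceil h1
      have : Q w = Q u := hwQ
      refine ⟨w, mem_insert_of_mem _ hw, ?_, this⟩
      rw [this]
      exact mul_le_mul_of_nonneg_right (by linarith) h1.le
  obtain ⟨t₀, ht₀, hmax⟩ := hWfin.exists_maximalFor (fun w => (w - c) * Q w) W ⟨b, mem_insert _ _⟩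
  have hmax' : ∀ w ∈ W, (w - c) * Q w ≤ (t₀ - c) * Q t₀ := fun w hw => by
    rcases le_total ((w - c) * Q w) ((t₀ - c) * Q t₀) with h1 | h1
    · exact h1
    · exact hmax hw h1
  obtain ⟨t, ⟨htW, htmax⟩, htmin⟩ :=
    (hWfin.inter_of_left {w | (t₀ - c) * Q t₀ ≤ (w - c) * Q w}).exists_minimalFor id _
      ⟨t₀, ht₀, le_refl ((t₀ - c) * Q t₀)⟩
  have hle : ∀ w ∈ W, (w - c) * Q w ≤ (t - c) * Q t := fun w hw => (hmax' w hw).trans htmax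
  have hlt : ∀ w ∈ W, w < t → (w - c) * Q w < (t - c) * Q t := by
    intro w hw hwt
    refine lt_of_le_of_ne (hle w hw) fun heq => ?_
    have : t ≤ w := htmin ⟨hw, by simp only [mem_ofPred_eq]; rw [heq]; exact htmax⟩ hwt.le
    linarith
  have hev : ∀ w ∈ W, ∀ᶠ δ in nhdsWithin (0 : ℝ) (Ioi 0),
      (w - (c - δ)) * Q w ≤ (t - (c - δ)) * Q t := by
    intro w hw
    rcases le_or_gt t w with h1 | h1
    · filter_upwards [self_mem_nhdsWithin] with δ hδ
      have h2 := hle w hw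
      have h3 := mul_le_mul_of_nonneg_left (hQanti h1) (le_of_lt hδ)
      linarith
    · have h2 : Filter.Tendsto (fun δ : ℝ => (t - (c - δ)) * Q t - (w - (c - δ)) * Q w)
          (nhds 0) (nhds ((t - (c - 0)) * Q t - (w - (c - 0)) * Q w)) :=
        Continuous.tendsto (by fun_prop) 0
      have h3 := h2.eventually (lt_mem_nhds (show (0 : ℝ) < _ by
        have := hlt w hw h1; simp only [sub_zero]; linarith))
      filter_upwards [nhdsWithin_le_nhds h3] with δ hδ
      linarith
  obtain ⟨δ, hδ0, hδ⟩ := ((eventually_mem_nhdsWithin (a := (0 : ℝ)) (s := Ioi 0)).and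
    ((Filter.eventually_all_finite hWfin).2 hev)).exists
  refine ⟨t, δ, hWnn t htW, hδ0, fun u _ => ?_, fun u _ => ?_, fun hpos => ?_⟩
  · obtain ⟨w, hw, h1, -⟩ := hred c u
    exact h1.trans (hle w hw)
  · obtain ⟨w, hw, h1, -⟩ := hred (c - δ) u
    exact h1.trans (hδ w hw)
  · have htV : t ∈ V := by
      rcases htW with rfl | h1
      · rw [hbE] at hpos; exact absurd hpos (lt_irrefl _)
      · exact h1
    refine ⟨htV, lt_of_le_of_ne measureReal_nonneg fun h0 => ?_⟩
    have h1 := h.survival_sub t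
    rw [← h0] at h1
    obtain ⟨w, hw, htw, hwE⟩ := h.exists_next (t := t) (by linarith)
    have h2 := hle w (mem_insert_of_mem _ hw)
    have h3 : Q w = Q t := by simp only [hQ]; linarith
    rw [h3] at h2
    have : 0 < Q t := hpos
    nlinarith

/-- The values whose ironed virtual value is at least `c` are those at or above the monopoly price
`t` for cost `c`, where the ironed revenue curve agrees with the revenue curve and lies below its
tangent of slope `c`. -/
theorem exists_threshold (h : IsSupportedOn E V) (c : ℝ) :
    ∃ t : ℝ, 0 ≤ t ∧ ironedRevenue E (E.real (Ici t)) = t * E.real (Ici t) ∧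
      (∀ q, 0 ≤ q → q ≤ 1 → ironedRevenue E q ≤ t * E.real (Ici t) + c * (q - E.real (Ici t))) ∧
      (∀ v, (c : EReal) ≤ ironedVirtualValue E v ↔ t ≤ v ∧ 0 < E.real (Ici t)) ∧
      (0 < E.real (Ici t) → t ∈ V ∧ 0 < E.real {t}) := by
  have := h.prob
  obtain ⟨t, δ, ht0, hδ, hc, hcδ, hpos⟩ := h.exists_monopoly_price c
  have hQ1 : E.real (Ici t) ≤ 1 := measureReal_le_one
  have hQ0 : 0 ≤ E.real (Ici t) := measureReal_nonneg
  have hline : ∀ q, 0 ≤ q → q ≤ 1 →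
      ironedRevenue E q ≤ t * E.real (Ici t) + c * (q - E.real (Ici t)) := by
    intro q hq0 hq1
    have := h.ironedRevenue_le (a := (t - c) * E.real (Ici t)) (b := c)
      (fun v hv => by linarith [hc v hv]) hq0 hq1
    linarith
  -- the tangent can be tilted to the slope `c - δ`, so the slopes to the right of its point of
  -- contact are strictly smaller than `c`
  have hline' : ∀ q, 0 ≤ q → q ≤ 1 →
      ironedRevenue E q ≤ t * E.real (Ici t) + (c - δ) * (q - E.real (Ici t)) := by
    intro q hq0 hq1
    have := h.ironedRevenue_le (a := (t - (c - δ)) * E.real (Ici t)) (b := c - δ)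
      (fun v hv => by linarith [hcδ v hv]) hq0 hq1
    linarith
  have htouch : ironedRevenue E (E.real (Ici t)) = t * E.real (Ici t) := by
    refine le_antisymm ?_ (h.revenue_le_ironedRevenue ht0)
    simpa using hline _ hQ0 hQ1
  refine ⟨t, ht0, htouch, hline, fun v => ?_, hpos⟩
  have hequiv : E.real (Ioi v) < E.real (Ici t) ↔ t ≤ v ∧ 0 < E.real (Ici t) := by
    constructor
    · intro h1
      refine ⟨?_, lt_of_le_of_lt measureReal_nonneg h1⟩
      by_contra! h2
      exact absurd h1 (not_lt.2 (measureReal_mono fun x hx => lt_of_lt_of_le h2 hx))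
    · rintro ⟨h1, h2⟩
      have h3 := h.survival_sub t
      have h4 : E.real (Ioi v) ≤ E.real (Ioi t) := measureReal_mono (Ioi_subset_Ioi h1)
      linarith [(hpos h2).2]
  rw [← hequiv]
  set q₀ := E.real (Ioi v) with hq₀
  have hq₀0 : 0 ≤ q₀ := measureReal_nonneg
  constructor
  · intro h1
    by_contra! h2
    have h3 : ironedVirtualValue E v ≤ ((c - δ : ℝ) : EReal) := by
      refine iSup₂_le fun q hq => ?_
      rw [EReal.coe_le_coe_iff, div_le_iff₀ (sub_pos.2 hq.1)]
      have hqt : 0 < q - E.real (Ici t) := by linarith [hq.1]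
      have h4 := h.ironedRevenue_concave (q₁ := E.real (Ici t)) (q₂ := q)
        (α := (q - q₀) / (q - E.real (Ici t))) hQ0 hQ1 (hq₀0.trans hq.1.le) hq.2
        (div_nonneg (sub_nonneg.2 hq.1.le) hqt.le) ((div_le_one hqt).2 (by linarith))
      have h5 : (q - q₀) / (q - E.real (Ici t)) * E.real (Ici t) +
          (1 - (q - q₀) / (q - E.real (Ici t))) * q = q₀ := by
        field_simp; ring
      rw [h5, htouch] at h4
      have h6 := hline' q (hq₀0.trans hq.1.le) hq.2
      have h7 : (q - q₀) / (q - E.real (Ici t)) * (ironedRevenue E q - t * E.real (Ici t)) ≤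
          (q - q₀) / (q - E.real (Ici t)) * ((c - δ) * (q - E.real (Ici t))) :=
        mul_le_mul_of_nonneg_left (by linarith) (div_nonneg (sub_nonneg.2 hq.1.le) hqt.le)
      have h8 : (q - q₀) / (q - E.real (Ici t)) * ((c - δ) * (q - E.real (Ici t))) =
          (c - δ) * (q - q₀) := by
        field_simp
      rw [h8] at h7
      change ironedRevenue E q - ironedRevenue E q₀ ≤ _
      linarith
    have h9 := h1.trans h3
    rw [EReal.coe_le_coe_iff] at h9
    linarith
  · intro h1
    refine le_iSup₂_of_le (E.real (Ici t)) ⟨h1, hQ1⟩ ?_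
    rw [EReal.coe_le_coe_iff, le_div_iff₀ (sub_pos.2 h1), htouch]
    have := hline q₀ hq₀0 measureReal_le_one
    change _ ≤ _ - ironedRevenue E q₀
    linarith

theorem ironedVirtualValue_mono (h : IsSupportedOn E V) : Monotone (ironedVirtualValue E) := by
  intro v v' hvv
  by_contra! hcon
  obtain ⟨c, hc1, hc2⟩ := EReal.lt_iff_exists_real_btwn.1 hcon
  obtain ⟨t, -, -, -, ht, -⟩ := h.exists_threshold c
  obtain ⟨h1, h2⟩ := (ht v).1 hc2.le
  exact absurd ((ht v').2 ⟨h1.trans hvv, h2⟩) (not_le.2 hc1)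

/-- At an atom, the ironed virtual value is the slope of the ironed revenue curve over the quantiles
of the atom. -/
theorem ironedVirtualValue_eq (h : IsSupportedOn E V) {v : ℝ} (hv : 0 < E.real {v}) :
    ironedVirtualValue E v =
      (((ironedRevenue E (E.real (Ici v)) - ironedRevenue E (E.real (Ioi v))) /
        E.real {v} : ℝ) : EReal) := by
  have := h.prob
  have hsub := h.survival_sub v
  set q₀ := E.real (Ioi v) with hq₀
  set q₁ := E.real (Ici v) with hq₁
  have hq₀0 : 0 ≤ q₀ := measureReal_nonneg
  have hq₁1 : q₁ ≤ 1 := measureReal_le_one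
  refine le_antisymm ?_ ?_
  · by_contra! hcon
    obtain ⟨c, hc1, hc2⟩ := EReal.lt_iff_exists_real_btwn.1 hcon
    rw [EReal.coe_lt_coe_iff, div_lt_iff₀ hv] at hc1
    obtain ⟨t, -, htouch, hline, ht, -⟩ := h.exists_threshold c
    obtain ⟨h1, -⟩ := (ht v).1 hc2.le
    have h2 : q₁ ≤ E.real (Ici t) := measureReal_mono (Ici_subset_Ici.2 h1)
    set q₂ := E.real (Ici t) with hq₂
    have h02 : 0 < q₂ - q₀ := by linarith
    have h4 := h.ironedRevenue_concave (q₁ := q₀) (q₂ := q₂) (α := (q₂ - q₁) / (q₂ - q₀)) hq₀0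
      (by linarith) measureReal_nonneg measureReal_le_one
      (div_nonneg (by linarith) h02.le) ((div_le_one h02).2 (by linarith))
    have h5 : (q₂ - q₁) / (q₂ - q₀) * q₀ + (1 - (q₂ - q₁) / (q₂ - q₀)) * q₂ = q₁ := by
      field_simp; ring
    rw [h5, htouch] at h4
    have h6 := hline q₀ hq₀0 (by linarith)
    have h7 : (1 - (q₂ - q₁) / (q₂ - q₀)) = (q₁ - q₀) / (q₂ - q₀) := by
      field_simp; ring
    have h8 : (q₁ - q₀) / (q₂ - q₀) * (c * (q₂ - q₀)) ≤
        (q₁ - q₀) / (q₂ - q₀) * (t * q₂ - ironedRevenue E q₀) :=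
      mul_le_mul_of_nonneg_left (by linarith) (div_nonneg (by linarith) h02.le)
    have h9 : (q₁ - q₀) / (q₂ - q₀) * (c * (q₂ - q₀)) = c * (q₁ - q₀) := by
      field_simp
    have h10 : (q₂ - q₁) / (q₂ - q₀) = 1 - (q₁ - q₀) / (q₂ - q₀) := by linarith
    rw [h7, h10] at h4
    rw [h9] at h8
    rw [← hsub] at hc1
    linarith
  · refine le_iSup₂_of_le q₁ ⟨by linarith, hq₁1⟩ ?_
    rw [EReal.coe_le_coe_iff, ← hsub]

theorem exists_atom_le (h : IsSupportedOn E V) {p : ℝ} (hp : 0 ≤ ironedVirtualValue E p) :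
    ∃ u ∈ V, 0 < E.real {u} ∧ u ≤ p ∧ ironedVirtualValue E u = ironedVirtualValue E p := by
  have := h.prob
  obtain ⟨t, -, -, -, ht, htpos⟩ := h.exists_threshold 0
  obtain ⟨h1, h2⟩ := (ht p).1 (by simpa using hp)
  obtain ⟨u, ⟨huV, hu0, hup⟩, hmax⟩ :=
    (h.grid.finite.inter_of_left {u | 0 < E.real {u} ∧ u ≤ p}).exists_maximalFor id _
      ⟨t, (htpos h2).1, (htpos h2).2, h1⟩
  refine ⟨u, huV, hu0, hup, ?_⟩
  have hE : E.real (Ioi u) = E.real (Ioi p) := by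
    have h3 : E.real (Ioc u p) = 0 := by
      by_contra hne
      have hfin : (V ∩ Ioc u p).Finite := h.grid.finite.inter_of_left _
      have h4 : E.real (Ioc u p) = E.real (V ∩ Ioc u p) := h.real_congr fun v hv => by simp [hv]
      have h5 : E.real (V ∩ Ioc u p) = 0 := by
        rw [← hfin.coe_toFinset, ← sum_measureReal_singleton]
        refine Finset.sum_eq_zero fun w hw => ?_
        rw [Set.Finite.mem_toFinset] at hw
        by_contra hw0
        have h6 : 0 < E.real {w} := lt_of_le_of_ne measureReal_nonneg (Ne.symm hw0)
        exact absurd (hmax ⟨hw.1, h6, hw.2.2⟩ hw.2.1.le) (not_le.2 hw.2.1)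
      exact hne (h4.trans h5)
    rw [← Ioc_union_Ioi_eq_Ioi hup, measureReal_union _ measurableSet_Ioi, h3, zero_add]
    rw [Set.disjoint_left]
    intro x hx hx'
    exact absurd hx.2 (not_le.2 hx')
  simp only [ironedVirtualValue, hE]

end IsSupportedOn

/-! ### Thresholds in Myerson's auction -/

section Myerson

variable {n : ℕ} {E : Fin n → Measure ℝ} {V : Set ℝ} (τ : Equiv.Perm (Fin n))

theorem MyersonWins.of_le {v : Fin n → ℝ} {i : Fin n} {a b : ℝ}
    (hab : ironedVirtualValue (E i) a ≤ ironedVirtualValue (E i) b)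
    (ha : MyersonWins τ E (Function.update v i a) i) :
    MyersonWins τ E (Function.update v i b) i := by
  obtain ⟨h0, h1⟩ := ha
  simp only [Function.update_self] at h0 h1
  refine ⟨by simpa using h0.trans hab, fun j hj => ?_⟩
  have h2 := h1 j hj
  rw [Function.update_of_ne hj] at h2 ⊢
  rw [Function.update_self]
  rcases h2 with h2 | ⟨h2, h3⟩
  · exact Or.inl (h2.trans_le hab)
  · rcases hab.lt_or_eq with h4 | h4
    · exact Or.inl (h2 ▸ h4)
    · exact Or.inr ⟨h2.trans h4, h3⟩

theorem MyersonWins.unique {v : Fin n → ℝ} {i j : Fin n} (hi : MyersonWins τ E v i)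
    (hj : MyersonWins τ E v j) : i = j := by
  by_contra hne
  rcases hi.2 j (Ne.symm hne) with h1 | ⟨h1, h1'⟩ <;> rcases hj.2 i hne with h2 | ⟨h2, h2'⟩
  · exact absurd h1 (not_lt.2 h2.le)
  · exact absurd h2.symm h1.ne
  · exact absurd h1.symm h2.ne
  · exact absurd h1' (not_lt.2 h2'.le)

/-- Either a bidder never wins against the given reports of the others, or the winning reports are
those at or above a threshold that is an atom of her distribution and at which the ironed revenue
curve agrees with the revenue curve. -/
theorem myerson_threshold (hE : ∀ i, IsSupportedOn (E i) V) (v : Fin n → ℝ) (i : Fin n) :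
    (∀ p, ¬ MyersonWins τ E (Function.update v i p) i) ∨
    ∃ θ ∈ V, 0 < (E i).real {θ} ∧
      ironedRevenue (E i) ((E i).real (Ici θ)) = θ * (E i).real (Ici θ) ∧
      ∀ p, MyersonWins τ E (Function.update v i p) i ↔ θ ≤ p := by
  by_cases hwin : ∃ p, MyersonWins τ E (Function.update v i p) i
  swap
  · left; push Not at hwin; exact hwin
  right
  have hfloor : ∀ p, MyersonWins τ E (Function.update v i p) i →
      ∃ u ∈ V, 0 < (E i).real {u} ∧ u ≤ p ∧ MyersonWins τ E (Function.update v i u) i := by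
    intro p hp
    obtain ⟨u, hu, hu0, hup, hφ⟩ := (hE i).exists_atom_le (p := p) (by simpa using hp.1)
    exact ⟨u, hu, hu0, hup, hp.of_le τ hφ.symm.le⟩
  obtain ⟨p₀, hp₀⟩ := hwin
  obtain ⟨u₀, hu₀, hu₀0, -, hu₀w⟩ := hfloor p₀ hp₀
  obtain ⟨θ, ⟨hθV, hθ0, hθw⟩, hmin⟩ := ((hE i).grid.finite.inter_of_left
    {u | 0 < (E i).real {u} ∧ MyersonWins τ E (Function.update v i u) i}).exists_minimalFor id _
      ⟨u₀, hu₀, hu₀0, hu₀w⟩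
  have hmin' : ∀ u ∈ V, 0 < (E i).real {u} → MyersonWins τ E (Function.update v i u) i → θ ≤ u :=
    fun u hu hu0 huw => by
      rcases le_total θ u with h1 | h1
      · exact h1
      · exact hmin ⟨hu, hu0, huw⟩ h1
  refine ⟨θ, hθV, hθ0, ?_, fun p => ⟨fun hp => ?_, fun hp => ?_⟩⟩
  · have hφ := (hE i).ironedVirtualValue_eq hθ0
    obtain ⟨t, -, htouch, -, ht, htpos⟩ := (hE i).exists_threshold
      ((ironedRevenue (E i) ((E i).real (Ici θ)) - ironedRevenue (E i) ((E i).real (Ioi θ))) /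
        (E i).real {θ})
    obtain ⟨h1, h2⟩ := (ht θ).1 hφ.symm.le
    have h3 := (ht t).2 ⟨le_rfl, h2⟩
    rw [← hφ] at h3
    have h4 := hmin' t (htpos h2).1 (htpos h2).2 (hθw.of_le τ h3)
    rwa [le_antisymm h1 h4] at htouch
  · obtain ⟨u, hu, hu0, hup, huw⟩ := hfloor p hp
    exact (hmin' u hu hu0 huw).trans hup
  · exact hθw.of_le τ ((hE i).ironedVirtualValue_mono hp)

theorem sInf_winning {θ : ℝ} (hθ : 0 ≤ θ) {v : Fin n → ℝ} {i : Fin n}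
    (h : ∀ p, MyersonWins τ E (Function.update v i p) i ↔ θ ≤ p) :
    sInf {p | 0 ≤ p ∧ MyersonWins τ E (Function.update v i p) i} = θ := by
  have : {p | 0 ≤ p ∧ MyersonWins τ E (Function.update v i p) i} = Ici θ := by
    ext p
    simp only [mem_ofPred_eq, h, mem_Ici]
    exact ⟨fun h1 => h1.2, fun h1 => ⟨hθ.trans h1, h1⟩⟩
  rw [this, csInf_Ici]

theorem myerson_sum_alloc_le (v : Fin n → ℝ) : ∑ i, (myerson τ E).alloc v i ≤ 1 := by
  classical
  by_cases h : ∃ i, MyersonWins τ E v i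
  · obtain ⟨i, hi⟩ := h
    rw [Finset.sum_eq_single i]
    · simp [myerson, hi]
    · intro j _ hj
      have : ¬ MyersonWins τ E v j := fun hj' => hj (hj'.unique τ hi)
      simp [myerson, this]
    · simp
  · push Not at h
    simp [myerson, h]

theorem myerson_alloc_nonneg (v : Fin n → ℝ) (i : Fin n) : 0 ≤ (myerson τ E).alloc v i := by
  simp only [myerson]; split_ifs <;> norm_num

theorem myerson_pay_nonneg (v : Fin n → ℝ) (i : Fin n) : 0 ≤ (myerson τ E).pay v i := by
  simp only [myerson]
  split_ifs
  · exact Real.sInf_nonneg fun p hp => hp.1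
  · exact le_rfl

theorem myerson_pay_le {v : Fin n → ℝ} {i : Fin n} (hv : 0 ≤ v i) :
    (myerson τ E).pay v i ≤ v i * (myerson τ E).alloc v i := by
  simp only [myerson]
  split_ifs with h
  · rw [mul_one]
    exact csInf_le ⟨0, fun p hp => hp.1⟩ ⟨hv, by simpa using h⟩
  · simp

end Myerson

/-! ### Rounding values down to a grid -/

section Round

variable {V : Set ℝ}

namespace IsGrid

theorem roundDown_spec (hV : IsGrid V) {x : ℝ} (hx : 0 ≤ x) :
    roundDown V x ∈ V ∧ roundDown V x ≤ x ∧ ∀ w ∈ V, w ≤ x → w ≤ roundDown V x := by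
  have hfin : {w | w ∈ V ∧ w ≤ x}.Finite := hV.finite.subset fun w hw => hw.1
  have hmem : roundDown V x ∈ {w | w ∈ V ∧ w ≤ x} :=
    Set.Nonempty.csSup_mem ⟨0, hV.zero_mem, hx⟩ hfin
  exact ⟨hmem.1, hmem.2, fun w hw hwx => le_csSup hfin.bddAbove ⟨hw, hwx⟩⟩

theorem roundDown_of_neg (hV : IsGrid V) {x : ℝ} (hx : x < 0) : roundDown V x = 0 := by
  have : {w | w ∈ V ∧ w ≤ x} = ∅ := by
    ext w
    simp only [mem_ofPred_eq, mem_empty_iff_false, iff_false, not_and, not_le]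
    exact fun hw => hx.trans_le (hV.nonneg w hw)
  rw [roundDown, this, Real.sSup_empty]

theorem roundDown_mem (hV : IsGrid V) (x : ℝ) : roundDown V x ∈ V := by
  rcases le_or_gt 0 x with hx | hx
  · exact (hV.roundDown_spec hx).1
  · rw [hV.roundDown_of_neg hx]; exact hV.zero_mem

theorem roundDown_nonneg (hV : IsGrid V) (x : ℝ) : 0 ≤ roundDown V x :=
  hV.nonneg _ (hV.roundDown_mem x)

theorem roundDown_le (hV : IsGrid V) {x : ℝ} (hx : 0 ≤ x) : roundDown V x ≤ x :=
  (hV.roundDown_spec hx).2.1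

theorem le_roundDown (hV : IsGrid V) {x w : ℝ} (hw : w ∈ V) (hwx : w ≤ x) : w ≤ roundDown V x :=
  (hV.roundDown_spec ((hV.nonneg w hw).trans hwx)).2.2 w hw hwx

theorem roundDown_mono (hV : IsGrid V) : Monotone (roundDown V) := by
  intro x y hxy
  rcases le_or_gt 0 x with hx | hx
  · exact hV.le_roundDown (hV.roundDown_mem x) ((hV.roundDown_le hx).trans hxy)
  · rw [hV.roundDown_of_neg hx]; exact hV.roundDown_nonneg y

theorem measurable_roundDown (hV : IsGrid V) : Measurable (roundDown V) :=
  hV.roundDown_mono.measurable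

theorem roundDown_self (hV : IsGrid V) {w : ℝ} (hw : w ∈ V) : roundDown V w = w :=
  le_antisymm (hV.roundDown_le (hV.nonneg w hw)) (hV.le_roundDown hw le_rfl)

theorem le_roundDown_iff (hV : IsGrid V) {x w : ℝ} (hx : 0 ≤ x) (hw : w ∈ V) :
    w ≤ roundDown V x ↔ w ≤ x :=
  ⟨fun h => h.trans (hV.roundDown_le hx), hV.le_roundDown hw⟩

end IsGrid

/-- A map that factors through a measurable map with countable range is measurable. -/
theorem measurable_comp_of_countable_range {α β γ : Type*} [MeasurableSpace α] [MeasurableSpace β]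
    [MeasurableSingletonClass β] [MeasurableSpace γ] {r : α → β} (hr : Measurable r)
    (hc : (range r).Countable) (g : β → γ) : Measurable fun a => g (r a) := by
  intro s _
  have : (fun a => g (r a)) ⁻¹' s = ⋃ y ∈ range r ∩ g ⁻¹' s, r ⁻¹' {y} := by
    ext a; simp
  rw [this]
  exact MeasurableSet.biUnion (hc.mono inter_subset_left) fun y _ => hr (measurableSet_singleton y)

/-- Coordinatewise rounding. -/
def roundProfile {ι : Type*} (V : Set ℝ) (v : ι → ℝ) : ι → ℝ := fun i => roundDown V (v i)

theorem measurable_roundProfile {ι : Type*} (hV : IsGrid V) :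
    Measurable (roundProfile V : (ι → ℝ) → ι → ℝ) :=
  measurable_pi_lambda _ fun i => hV.measurable_roundDown.comp (measurable_pi_apply i)

theorem range_roundProfile_countable {ι : Type*} [Finite ι] (hV : IsGrid V) :
    (range (roundProfile V : (ι → ℝ) → ι → ℝ)).Countable := by
  refine Set.Countable.mono (s₂ := Set.pi univ fun _ => V) ?_
    (Set.Finite.countable (Set.Finite.pi' fun _ => hV.finite) |>.mono fun v hv i => hv i trivial)
  rintro _ ⟨v, rfl⟩ i _
  exact hV.roundDown_mem _

variable {n : ℕ} {E : Fin n → Measure ℝ} (τ : Equiv.Perm (Fin n))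

/-- Myerson's auction for `E`, run on the reports rounded down to `V`. -/
def roundedMyerson (V : Set ℝ) (E : Fin n → Measure ℝ) : Mechanism n where
  alloc v := (myerson τ E).alloc (roundProfile V v)
  pay v := (myerson τ E).pay (roundProfile V v)

theorem roundProfile_update (v : Fin n → ℝ) (i : Fin n) (y : ℝ) :
    roundProfile V (Function.update v i y) =
      Function.update (roundProfile V v) i (roundDown V y) := by
  ext j
  by_cases hj : j = i
  · subst hj; simp [roundProfile]
  · simp [roundProfile, hj]

theorem roundedMyerson_pay_nonneg (v : Fin n → ℝ) (i : Fin n) :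
    0 ≤ (roundedMyerson τ V E).pay v i :=
  myerson_pay_nonneg τ (E := E) (roundProfile V v) i

/-- Since the thresholds are grid values, the rounded auction is truthful although the reports are
rounded. -/
theorem roundedMyerson_isAdmissible (hV : IsGrid V) (hE : ∀ i, IsSupportedOn (E i) V) :
    (roundedMyerson τ V E).IsAdmissible := by
  have hr := measurable_roundProfile (ι := Fin n) hV
  have hc := range_roundProfile_countable (ι := Fin n) hV
  refine ⟨⟨measurable_comp_of_countable_range hr hc (myerson τ E).alloc,
    measurable_comp_of_countable_range hr hc (myerson τ E).pay, fun v _ =>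
    ⟨fun i => myerson_alloc_nonneg τ (E := E) (roundProfile V v) i,
      myerson_sum_alloc_le τ (E := E) (roundProfile V v)⟩⟩, ?_, ?_⟩
  · intro v hv i b hb
    have hround : ∀ y, 0 ≤ y →
        (roundedMyerson τ V E).alloc (Function.update v i y) i =
          (myerson τ E).alloc (Function.update (roundProfile V v) i (roundDown V y)) i ∧
        (roundedMyerson τ V E).pay (Function.update v i y) i =
          (myerson τ E).pay (Function.update (roundProfile V v) i (roundDown V y)) i := by
      intro y _
      simp [roundedMyerson, roundProfile_update]
    have hself := hround (v i) (hv i)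
    rw [Function.update_eq_self] at hself
    rw [hself.1, hself.2, (hround b hb).1, (hround b hb).2]
    simp only [myerson, Function.update_idem]
    rcases myerson_threshold τ hE (roundProfile V v) i with h | ⟨θ, hθV, -, -, h⟩
    · simp [h]
    · rw [sInf_winning τ (hV.nonneg θ hθV) h]
      simp only [h, hV.le_roundDown_iff hb hθV, hV.le_roundDown_iff (hv i) hθV]
      split_ifs with h1 h2 h2
      · exact le_rfl
      · linarith
      · linarith
      · exact le_rfl
  · intro v hv i
    have h1 := myerson_pay_le τ (E := E) (v := roundProfile V v) (i := i) (hV.roundDown_nonneg _)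
    have h2 : roundProfile V v i * (myerson τ E).alloc (roundProfile V v) i ≤
        v i * (myerson τ E).alloc (roundProfile V v) i :=
      mul_le_mul_of_nonneg_right (hV.roundDown_le (hv i))
        (myerson_alloc_nonneg τ (E := E) (roundProfile V v) i)
    simp only [roundedMyerson]
    linarith

theorem roundedMyerson_sum_pay_le (hV : IsGrid V) {H : ℝ} (hH : ∀ w ∈ V, w ≤ H)
    (v : Fin n → ℝ) : ∑ i, (roundedMyerson τ V E).pay v i ≤ H := by
  have hH0 : 0 ≤ H := hH 0 hV.zero_mem
  calc ∑ i, (roundedMyerson τ V E).pay v i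
      ≤ ∑ i, H * (myerson τ E).alloc (roundProfile V v) i := by
        refine Finset.sum_le_sum fun i _ => ?_
        refine (myerson_pay_le τ (E := E) (v := roundProfile V v) (i := i)
          (hV.roundDown_nonneg _)).trans ?_
        exact mul_le_mul_of_nonneg_right (hH _ (hV.roundDown_mem _))
          (myerson_alloc_nonneg τ (E := E) (roundProfile V v) i)
    _ ≤ H := by
        rw [← Finset.mul_sum]
        exact mul_le_of_le_one_right hH0 (myerson_sum_alloc_le τ (E := E) (roundProfile V v))

end Round

/-! ### Summation by parts along a grid -/

theorem sum_range_by_parts_sub (M : ℕ) (q P : ℕ → ℝ) :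
    ∑ k ∈ Finset.range (M + 1), (q k - q (k + 1)) * P k =
      q 0 * P 0 + ∑ k ∈ Finset.range M, q (k + 1) * (P (k + 1) - P k) - q (M + 1) * P M := by
  induction M with
  | zero => simp; ring
  | succ M ih => rw [Finset.sum_range_succ, ih, Finset.sum_range_succ]; ring

/-- Payments that grow along the grid at most in proportion to the allocation are bounded, in
expectation, by the increments of a concave envelope `R` of the revenues `g k * q k`. Here `q k` is
the probability of a value of at least `g k`, and `δ` bounds the price paid in the lowest cell. -/
theorem sum_pay_le_virtual {M : ℕ} {q P X R g : ℕ → ℝ} {κ δ : ℝ} (hκ : 0 ≤ κ) (hδ : 0 ≤ δ)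
    (hq : ∀ k, 0 ≤ q k) (hq0 : q 0 ≤ 1) (hqM : q (M + 1) = 0) (hX0 : 0 ≤ X 0)
    (hX : ∀ k < M, X k ≤ X (k + 1)) (hP0 : P 0 ≤ δ * X 0)
    (hP : ∀ k < M, P (k + 1) - P k ≤ κ * g (k + 1) * (X (k + 1) - X k))
    (hR : ∀ k ≤ M, g k * q k ≤ R k) (hR0 : 0 ≤ R 0) (hRM : R (M + 1) = 0) :
    ∑ k ∈ Finset.range (M + 1), (q k - q (k + 1)) * P k ≤
      δ * X 0 + κ * ∑ k ∈ Finset.range (M + 1), (R k - R (k + 1)) * X k := by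
  rw [sum_range_by_parts_sub, sum_range_by_parts_sub, hqM, hRM]
  have h1 : q 0 * P 0 ≤ δ * X 0 := by
    have := mul_le_mul_of_nonneg_left hP0 (hq 0)
    have := mul_le_mul_of_nonneg_right hq0 (mul_nonneg hδ hX0)
    linarith
  have h2 : ∑ k ∈ Finset.range M, q (k + 1) * (P (k + 1) - P k) ≤
      ∑ k ∈ Finset.range M, κ * (R (k + 1) * (X (k + 1) - X k)) := by
    refine Finset.sum_le_sum fun k hk => ?_
    have hk' := Finset.mem_range.1 hk
    have h3 := mul_le_mul_of_nonneg_left (hP k hk') (hq (k + 1))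
    have h4 := mul_le_mul_of_nonneg_right (hR (k + 1) hk')
      (mul_nonneg hκ (sub_nonneg.2 (hX k hk')))
    linarith
  rw [← Finset.mul_sum] at h2
  have h5 : 0 ≤ κ * (R 0 * X 0) := mul_nonneg hκ (mul_nonneg hR0 hX0)
  linarith

/-- An increasing enumeration `0 = g 0 < ... < g M` of a grid. -/
structure IsEnum (V : Set ℝ) (M : ℕ) (g : ℕ → ℝ) : Prop where
  lt : ∀ j k, j < k → k ≤ M → g j < g k
  mem : ∀ k ≤ M, g k ∈ V
  surj : ∀ w ∈ V, ∃ k ≤ M, g k = w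
  zero : g 0 = 0

theorem IsGrid.exists_isEnum {V : Set ℝ} (hV : IsGrid V) : ∃ M g, IsEnum V M g := by
  set F := hV.finite.toFinset with hF
  have hmemF : ∀ w, w ∈ F ↔ w ∈ V := fun w => by simp [hF]
  have h0 : (0 : ℝ) ∈ F := (hmemF 0).2 hV.zero_mem
  obtain ⟨M, hM⟩ : ∃ M, F.card = M + 1 :=
    ⟨F.card - 1, by have := Finset.card_pos.2 ⟨0, h0⟩; omega⟩
  set e := F.orderEmbOfFin hM with he
  set g : ℕ → ℝ := fun k => if h : k < M + 1 then e ⟨k, h⟩ else 0 with hg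
  have hgk : ∀ k (h : k < M + 1), g k = e ⟨k, h⟩ := fun k h => dif_pos h
  have hlt : ∀ j k, j < k → k ≤ M → g j < g k := by
    intro j k hjk hk
    rw [hgk j (by omega), hgk k (by omega)]
    exact e.strictMono hjk
  have hsurj : ∀ w ∈ V, ∃ k ≤ M, g k = w := by
    intro w hw
    have : w ∈ Set.range e := by
      rw [he, Finset.range_orderEmbOfFin]; exact (hmemF w).2 hw
    obtain ⟨k, hk⟩ := this
    exact ⟨k, by omega, by rw [hgk k k.2, ← hk]⟩
  have hmem : ∀ k ≤ M, g k ∈ V := fun k hk => by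
    rw [hgk k (by omega), ← hmemF]
    exact Finset.orderEmbOfFin_mem F hM _
  refine ⟨M, g, hlt, hmem, hsurj, ?_⟩
  obtain ⟨k, hk, hk0⟩ := hsurj 0 hV.zero_mem
  rcases Nat.eq_zero_or_pos k with h | h
  · rw [← hk0, h]
  · have h1 := hlt 0 k h hk
    have h2 := hV.nonneg _ (hmem 0 (by omega))
    linarith

namespace IsEnum

variable {V : Set ℝ} {M : ℕ} {g : ℕ → ℝ}

theorem le (h : IsEnum V M g) {j k : ℕ} (hjk : j ≤ k) (hk : k ≤ M) : g j ≤ g k := by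
  rcases hjk.eq_or_lt with rfl | h1
  · exact le_rfl
  · exact (h.lt j k h1 hk).le

theorem le_iff (h : IsEnum V M g) {j k : ℕ} (hj : j ≤ M) (hk : k ≤ M) : g j ≤ g k ↔ j ≤ k :=
  ⟨fun h1 => by by_contra! h2; exact absurd (h.lt k j h2 hj) (not_lt.2 h1), fun h1 => h.le h1 hk⟩

theorem injOn (h : IsEnum V M g) : Set.InjOn g (Finset.range (M + 1)) := by
  intro j hj k hk hjk
  have hj' := Nat.lt_succ_iff.1 (Finset.mem_range.1 hj)
  have hk' := Nat.lt_succ_iff.1 (Finset.mem_range.1 hk)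
  exact le_antisymm ((h.le_iff hj' hk').1 hjk.le) ((h.le_iff hk' hj').1 hjk.ge)

end IsEnum

/-- The probability of a value of at least the `k`-th grid point, and `0` beyond the grid. -/
def gridSurvival (E : Measure ℝ) (M : ℕ) (g : ℕ → ℝ) (k : ℕ) : ℝ :=
  if k ≤ M then E.real (Ici (g k)) else 0

/-- The ironed virtual value as a real number. -/
def ironedValue (E : Measure ℝ) (v : ℝ) : ℝ := (ironedVirtualValue E v).toReal

namespace IsSupportedOn

variable {E : Measure ℝ} {V : Set ℝ} {M : ℕ} {g : ℕ → ℝ}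

theorem integrable (h : IsSupportedOn E V) {f : ℝ → ℝ} (hf : Measurable f) : Integrable f E := by
  have := h.prob
  obtain ⟨C, hC⟩ := (h.grid.finite.image fun v => ‖f v‖).bddAbove
  refine Integrable.of_bound hf.aestronglyMeasurable C ?_
  filter_upwards [h.ae_mem] with v hv using hC (mem_image_of_mem _ hv)

theorem measurable_ironedValue (h : IsSupportedOn E V) : Measurable (ironedValue E) :=
  h.ironedVirtualValue_mono.measurable.ereal_toReal

theorem coe_ironedValue (h : IsSupportedOn E V) {v : ℝ} (hv : 0 < E.real {v}) :
    ironedVirtualValue E v = (ironedValue E v : EReal) := by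
  rw [ironedValue, h.ironedVirtualValue_eq hv, EReal.toReal_coe]

theorem survival_Ioi (h : IsSupportedOn E V) (hg : IsEnum V M g) {k : ℕ} (hk : k ≤ M) :
    E.real (Ioi (g k)) = gridSurvival E M g (k + 1) := by
  rw [gridSurvival]
  split_ifs with hk1
  · refine h.real_congr fun v hv => ?_
    obtain ⟨j, hj, rfl⟩ := hg.surj v hv
    rw [mem_Ioi, mem_Ici, ← not_le, hg.le_iff hj hk, hg.le_iff hk1 hj]
    omega
  · rw [h.real_congr (B := ∅) fun v hv => ?_]
    · simp
    · obtain ⟨j, hj, rfl⟩ := hg.surj v hv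
      have := hg.le (show j ≤ k by omega) hk
      simp [this]

theorem gridSurvival_sub (h : IsSupportedOn E V) (hg : IsEnum V M g) {k : ℕ} (hk : k ≤ M) :
    gridSurvival E M g k - gridSurvival E M g (k + 1) = E.real {g k} := by
  rw [← h.survival_Ioi hg hk, ← h.survival_sub, gridSurvival, if_pos hk]

/-- The increment of the ironed revenue curve over the quantiles of a grid point. -/
theorem ironedRevenue_sub (h : IsSupportedOn E V) (hg : IsEnum V M g) {k : ℕ} (hk : k ≤ M) :
    ironedRevenue E (gridSurvival E M g k) - ironedRevenue E (gridSurvival E M g (k + 1)) =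
      E.real {g k} * ironedValue E (g k) := by
  have h1 := h.gridSurvival_sub hg hk
  rcases (measureReal_nonneg (μ := E) (s := {g k})).eq_or_lt with h0 | h0
  · rw [← h0] at h1 ⊢
    rw [sub_eq_zero.1 h1]; simp
  · rw [ironedValue, h.ironedVirtualValue_eq h0, EReal.toReal_coe, h.survival_Ioi hg hk,
      show E.real (Ici (g k)) = gridSurvival E M g k by rw [gridSurvival, if_pos hk]]
    field_simp

theorem integral_eq_sum (h : IsSupportedOn E V) (hg : IsEnum V M g) {f : ℝ → ℝ}
    (hf : Measurable f) : ∫ v, f v ∂E = ∑ k ∈ Finset.range (M + 1), E.real {g k} * f (g k) := by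
  have hF : (↑((Finset.range (M + 1)).image g) : Set ℝ) = V := by
    ext w
    simp only [Finset.coe_image, Finset.coe_range, mem_image, mem_Iio, Nat.lt_succ_iff]
    exact ⟨fun ⟨k, hk, hkw⟩ => hkw ▸ hg.mem k hk, hg.surj w⟩
  have h1 : ∫ v, f v ∂E = ∫ v in V, f v ∂E := by
    rw [setIntegral_eq_integral_of_ae_compl_eq_zero]
    filter_upwards [h.ae_mem] with v hv hv' using absurd hv hv'
  rw [h1, ← hF, setIntegral_finset _ (h.integrable hf).integrableOn, Finset.sum_image hg.injOn]
  simp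

theorem ironedRevenue_end (h : IsSupportedOn E V) :
    ironedRevenue E (gridSurvival E M g (M + 1)) = 0 := by
  rw [gridSurvival, if_neg (by omega), h.ironedRevenue_zero]

/-- Expected payments are at most the expected ironed virtual surplus. -/
theorem integral_pay_le (h : IsSupportedOn E V) {x p : ℝ → ℝ} (hxp : SingleAgent x p)
    (hx : Measurable x) (hp : Measurable p) :
    ∫ v, p v ∂E ≤ ∫ v, ironedValue E v * x v ∂E := by
  have := h.prob
  obtain ⟨M, g, hg⟩ := h.grid.exists_isEnum
  have hgnn : ∀ k ≤ M, 0 ≤ g k := fun k hk => h.grid.nonneg _ (hg.mem k hk)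
  rw [h.integral_eq_sum hg hp, h.integral_eq_sum hg (f := fun v => ironedValue E v * x v)
    (h.measurable_ironedValue.mul hx)]
  have hR : ∀ k ≤ M, g k * gridSurvival E M g k ≤ ironedRevenue E (gridSurvival E M g k) := by
    intro k hk
    rw [gridSurvival, if_pos hk]
    exact h.revenue_le_ironedRevenue (hgnn k hk)
  have key := sum_pay_le_virtual (M := M) (q := gridSurvival E M g) (P := fun k => p (g k))
    (X := fun k => x (g k)) (R := fun k => ironedRevenue E (gridSurvival E M g k)) (g := g)
    (κ := 1) (δ := 0) zero_le_one le_rfl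
    (fun k => by rw [gridSurvival]; split_ifs; exacts [measureReal_nonneg, le_rfl])
    (by rw [gridSurvival]; split_ifs; exacts [measureReal_le_one, zero_le_one])
    (by rw [gridSurvival, if_neg (by omega)]) (hxp.nonneg _ (hgnn 0 (by omega)))
    (fun k hk => hxp.mono (hgnn k (by omega)) (hg.le (by omega) (by omega)))
    (by have := hxp.ir (g 0) (hgnn 0 (by omega)); rw [hg.zero] at this ⊢; simpa using this)
    (fun k hk => by
      rw [one_mul]; exact hxp.pay_sub_le (hgnn k (by omega)) (hgnn (k + 1) (by omega)))
    hR (by have := hR 0 (by omega); rw [hg.zero] at this; simpa using this)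
    h.ironedRevenue_end
  simp only [zero_mul, zero_add, one_mul] at key
  refine (Finset.sum_congr rfl fun k hk => ?_).trans_le (key.trans_eq
    (Finset.sum_congr rfl fun k hk => ?_))
  · rw [h.gridSurvival_sub hg (Nat.lt_succ_iff.1 (Finset.mem_range.1 hk))]
  · rw [h.ironedRevenue_sub hg (Nat.lt_succ_iff.1 (Finset.mem_range.1 hk)), mul_assoc]

/-- The ironed virtual surplus above a grid point telescopes to the ironed revenue. -/
theorem integral_ironedValue_Ici (h : IsSupportedOn E V) {θ : ℝ} (hθ : θ ∈ V) :
    ∫ v, ironedValue E v * (if θ ≤ v then 1 else 0) ∂E = ironedRevenue E (E.real (Ici θ)) := by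
  obtain ⟨M, g, hg⟩ := h.grid.exists_isEnum
  obtain ⟨j, hj, rfl⟩ := hg.surj θ hθ
  rw [h.integral_eq_sum hg (f := fun v => ironedValue E v * (if g j ≤ v then 1 else 0))
    (h.measurable_ironedValue.mul
      (Measurable.ite measurableSet_Ici measurable_const measurable_const))]
  have h1 : ∀ k ∈ Finset.range (M + 1),
      E.real {g k} * (ironedValue E (g k) * if g j ≤ g k then 1 else 0) =
        if j ≤ k then ironedRevenue E (gridSurvival E M g k) -
          ironedRevenue E (gridSurvival E M g (k + 1)) else 0 := by
    intro k hk
    have hk' := Nat.lt_succ_iff.1 (Finset.mem_range.1 hk)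
    rw [h.ironedRevenue_sub hg hk']
    simp only [hg.le_iff hj hk']
    split_ifs <;> simp
  rw [Finset.sum_congr rfl h1, ← Finset.sum_filter]
  have h2 : (Finset.range (M + 1)).filter (fun k => j ≤ k) = Finset.Ico j (M + 1) := by
    ext k; simp; omega
  rw [h2, Finset.sum_Ico_eq_sub _ (by omega),
    Finset.sum_range_sub' (fun k => ironedRevenue E (gridSurvival E M g k)),
    Finset.sum_range_sub' (fun k => ironedRevenue E (gridSurvival E M g k)),
    h.ironedRevenue_end]
  rw [show gridSurvival E M g j = E.real (Ici (g j)) by rw [gridSurvival, if_pos hj]]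
  ring

end IsSupportedOn

/-! ### Optimality of Myerson's auction for finitely supported distributions -/

section MyersonOptimal

variable {n : ℕ} {E : Fin n → Measure ℝ} {V : Set ℝ} (τ : Equiv.Perm (Fin n))

theorem ae_pi_mem (hE : ∀ i, IsSupportedOn (E i) V) : ∀ᵐ v ∂Measure.pi E, ∀ i, v i ∈ V := by
  have := fun i => (hE i).prob
  rw [ae_all_iff]
  exact fun i => (measurePreserving_eval E i).quasiMeasurePreserving.ae (hE i).ae_mem

theorem ae_pi_atom (hE : ∀ i, IsSupportedOn (E i) V) :
    ∀ᵐ v ∂Measure.pi E, ∀ i, 0 < (E i).real {v i} := by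
  have := fun i => (hE i).prob
  rw [ae_all_iff]
  intro i
  refine (measurePreserving_eval E i).quasiMeasurePreserving.ae
    (p := fun y => 0 < (E i).real {y}) ?_
  have hnull : E i (V ∩ {y | (E i).real {y} = 0}) = 0 := by
    have hfin : (V ∩ {y | (E i).real {y} = 0}).Finite := (hE i).grid.finite.inter_of_left _
    rw [← hfin.coe_toFinset, ← sum_measure_singleton]
    refine Finset.sum_eq_zero fun w hw => ?_
    rw [Set.Finite.mem_toFinset] at hw
    exact (measureReal_eq_zero_iff (measure_ne_top _ _)).1 hw.2
  filter_upwards [(hE i).ae_mem, measure_eq_zero_iff_ae_notMem.1 hnull] with y hy hy'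
  exact lt_of_le_of_ne measureReal_nonneg fun h0 => hy' ⟨hy, h0.symm⟩

theorem integrable_pi_of_supported (hE : ∀ i, IsSupportedOn (E i) V) {F : (Fin n → ℝ) → ℝ}
    (hF : Measurable F) : Integrable F (Measure.pi E) := by
  have := fun i => (hE i).prob
  by_cases hn : Nonempty (Fin n)
  swap
  · have : Subsingleton (Fin n → ℝ) := by
      rw [not_nonempty_iff] at hn; infer_instance
    refine Integrable.of_bound hF.aestronglyMeasurable ‖F 0‖
      (Filter.Eventually.of_forall fun v => ?_)
    rw [Subsingleton.elim v 0]
  obtain ⟨i₀⟩ := hn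
  have hfin : {v : Fin n → ℝ | ∀ i, v i ∈ V}.Finite := Set.Finite.pi' fun i => (hE i₀).grid.finite
  obtain ⟨C, hC⟩ := (hfin.image fun v => ‖F v‖).bddAbove
  refine Integrable.of_bound hF.aestronglyMeasurable C ?_
  filter_upwards [ae_pi_mem hE] with v hv using hC (mem_image_of_mem _ hv)

/-- The ironed virtual value of the winner of the rounded auction. -/
def virtualSurplus (V : Set ℝ) (E : Fin n → Measure ℝ) (v : Fin n → ℝ) : ℝ :=
  ∑ i, ironedValue (E i) (roundDown V (v i)) * (roundedMyerson τ V E).alloc v i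

/-- Myerson's auction maximizes the ironed virtual surplus pointwise. -/
theorem le_virtualSurplus (hE : ∀ i, IsSupportedOn (E i) V) {v : Fin n → ℝ}
    (hv : ∀ i, 0 < (E i).real {roundDown V (v i)}) {y : Fin n → ℝ} (hy : ∀ i, 0 ≤ y i)
    (hy1 : ∑ i, y i ≤ 1) :
    ∑ i, ironedValue (E i) (roundDown V (v i)) * y i ≤ virtualSurplus τ V E v := by
  classical
  set ψ : Fin n → ℝ := fun i => ironedValue (E i) (roundDown V (v i)) with hψ
  have hcoe : ∀ i, ironedVirtualValue (E i) (roundProfile V v i) = (ψ i : EReal) :=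
    fun i => (hE i).coe_ironedValue (hv i)
  have hwin : ∀ i, MyersonWins τ E (roundProfile V v) i ↔
      0 ≤ ψ i ∧ ∀ j, j ≠ i → ψ j < ψ i ∨ ψ j = ψ i ∧ τ i < τ j := by
    intro i
    simp only [MyersonWins, hcoe, EReal.coe_nonneg, EReal.coe_lt_coe_iff, EReal.coe_eq_coe_iff]
  have hS : virtualSurplus τ V E v =
      ∑ i, ψ i * (if MyersonWins τ E (roundProfile V v) i then 1 else 0) := rfl
  rw [hS]
  by_cases hex : ∃ i, MyersonWins τ E (roundProfile V v) i
  · obtain ⟨i, hi⟩ := hex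
    have hsum : ∑ j, ψ j * (if MyersonWins τ E (roundProfile V v) j then 1 else 0) = ψ i := by
      rw [Finset.sum_eq_single i]
      · rw [if_pos hi, mul_one]
      · intro j _ hj
        rw [if_neg fun hj' => hj (MyersonWins.unique τ hj' hi), mul_zero]
      · simp
    rw [hsum]
    obtain ⟨h0, hmax⟩ := (hwin i).1 hi
    calc ∑ j, ψ j * y j ≤ ∑ j, ψ i * y j := by
            refine Finset.sum_le_sum fun j _ => mul_le_mul_of_nonneg_right ?_ (hy j)
            by_cases hj : j = i
            · rw [hj]
            · rcases hmax j hj with h1 | h1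
              · exact h1.le
              · exact h1.1.le
        _ = ψ i * ∑ j, y j := by rw [Finset.mul_sum]
        _ ≤ ψ i := mul_le_of_le_one_right h0 hy1
  -- if no bidder wins, then all values are negative: otherwise the first bidder in the order `τ`
  -- among those with the highest value would win
  · have hneg : ∀ i, ψ i < 0 := by
      intro i
      by_contra! hi
      obtain ⟨k, -, hk⟩ := Finset.exists_max_image Finset.univ ψ ⟨i, Finset.mem_univ i⟩
      obtain ⟨m, hm, hmin⟩ := Finset.exists_min_image (Finset.univ.filter fun j => ψ j = ψ k) τ
        ⟨k, by simp⟩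
      have hmk : ψ m = ψ k := by simpa using hm
      refine hex ⟨m, (hwin m).2 ⟨?_, fun j hj => ?_⟩⟩
      · rw [hmk]; exact hi.trans (hk i (Finset.mem_univ i))
      · rcases (hk j (Finset.mem_univ j)).lt_or_eq with h1 | h1
        · left; rw [hmk]; exact h1
        · right
          refine ⟨h1.trans hmk.symm, lt_of_le_of_ne (hmin j (by simp [h1])) fun h2 => ?_⟩
          exact hj (τ.injective h2).symm
    push Not at hex
    simp only [hex, if_false, mul_zero, Finset.sum_const_zero]
    exact Finset.sum_nonpos fun i _ => mul_nonpos_of_nonpos_of_nonneg (hneg i).le (hy i)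

theorem roundProfile_of_mem (hV : IsGrid V) {v : Fin n → ℝ} (hv : ∀ i, v i ∈ V) :
    roundProfile V v = v :=
  funext fun i => hV.roundDown_self (hv i)

theorem measurable_virtual_term (hV : IsGrid V) (hE : ∀ i, IsSupportedOn (E i) V)
    {M : Mechanism n} (hM : M.IsFeasible) (i : Fin n) :
    Measurable fun v : Fin n → ℝ => ironedValue (E i) (roundDown V (v i)) * M.alloc v i :=
  (((hE i).measurable_ironedValue.comp hV.measurable_roundDown).comp (measurable_pi_apply i)).mul
    (hM.measurable_alloc i)

/-- The revenue of Myerson's auction is its expected ironed virtual surplus: each bidder faces a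
threshold at which the revenue curve meets its concave majorant. -/
theorem rev_roundedMyerson_eq (hV : IsGrid V) (hE : ∀ i, IsSupportedOn (E i) V) :
    rev (roundedMyerson τ V E) E = ∫ v, virtualSurplus τ V E v ∂Measure.pi E := by
  have := fun i => (hE i).prob
  have hadm := roundedMyerson_isAdmissible τ hV hE
  have hterm := measurable_virtual_term hV hE hadm.1
  unfold rev virtualSurplus
  rw [integral_finsetSum _ fun i _ => integrable_pi_of_supported hE (hadm.1.measurable_pay i),
    integral_finsetSum _ fun i _ => integrable_pi_of_supported hE (hterm i)]
  refine Finset.sum_congr rfl fun i _ => ?_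
  rw [integral_update E i (integrable_pi_of_supported hE (hadm.1.measurable_pay i)),
    integral_update E i (integrable_pi_of_supported hE (hterm i))]
  congr 1
  ext v
  simp only [roundedMyerson, roundProfile_update, Function.update_self]
  have hround : ∀ᵐ y ∂E i, roundDown V y = y := by
    filter_upwards [(hE i).ae_mem] with y hy using hV.roundDown_self hy
  simp only [myerson, Function.update_idem]
  rcases myerson_threshold τ hE (roundProfile V v) i with h | ⟨θ, hθV, -, htouch, h⟩
  · simp [h]
  · rw [sInf_winning τ (hV.nonneg θ hθV) h]
    simp only [h]
    have h1 : ∫ y, (if θ ≤ roundDown V y then θ else 0) ∂E i = θ * (E i).real (Ici θ) := by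
      rw [integral_congr_ae (g := (Ici θ).indicator fun _ => θ)]
      · rw [integral_indicator measurableSet_Ici, setIntegral_const, smul_eq_mul, mul_comm]
      · filter_upwards [hround] with y hy
        simp [hy, indicator]
    rw [h1, ← htouch, ← (hE i).integral_ironedValue_Ici hθV]
    refine integral_congr_ae ?_
    filter_upwards [hround] with y hy
    rw [hy]

/-- Myerson's auction is optimal for finitely supported distributions. -/
theorem rev_le_rev_roundedMyerson (hV : IsGrid V) (hE : ∀ i, IsSupportedOn (E i) V)
    {M : Mechanism n} (hM : M.IsAdmissible) :
    rev M E ≤ rev (roundedMyerson τ V E) E := by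
  have := fun i => (hE i).prob
  have hterm := measurable_virtual_term hV hE hM.1
  rw [rev_roundedMyerson_eq τ hV hE]
  calc rev M E ≤ ∫ v, ∑ i, ironedValue (E i) (roundDown V (v i)) * M.alloc v i ∂Measure.pi E := by
        unfold rev
        rw [integral_finsetSum _ fun i _ => integrable_pi_of_supported hE (hM.1.measurable_pay i),
          integral_finsetSum _ fun i _ => integrable_pi_of_supported hE (hterm i)]
        refine Finset.sum_le_sum fun i _ => ?_
        have hI1 := integrable_pi_of_supported hE (hM.1.measurable_pay i)
        have hI2 := integrable_pi_of_supported hE (hterm i)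
        rw [integral_update E i hI1, integral_update E i hI2]
        refine integral_mono_ae (integrable_update_prod E i hI1).integral_prod_left
          (integrable_update_prod E i hI2).integral_prod_left ?_
        filter_upwards [ae_pi_mem hE] with v hv
        have hv0 : 0 ≤ v := fun j => hV.nonneg _ (hv j)
        refine ((hE i).integral_pay_le (hM.singleAgent hv0 i)
          ((hM.1.measurable_alloc i).comp (measurable_update v))
          ((hM.1.measurable_pay i).comp (measurable_update v))).trans_eq ?_
        refine integral_congr_ae ?_
        filter_upwards [(hE i).ae_mem] with y hy
        simp [hV.roundDown_self hy]
    _ ≤ _ := by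
        refine integral_mono_ae (integrable_pi_of_supported hE
          (Finset.measurable_sum _ fun i _ => hterm i)) (integrable_pi_of_supported hE
          (Finset.measurable_sum _ fun i _ => measurable_virtual_term hV hE
            (roundedMyerson_isAdmissible τ hV hE).1 i)) ?_
        filter_upwards [ae_pi_mem hE, ae_pi_atom hE] with v hv hv'
        obtain ⟨h1, h2⟩ := hM.1.2.2 v fun j => hV.nonneg _ (hv j)
        exact le_virtualSurplus τ hE (fun i => by rw [hV.roundDown_self (hv i)]; exact hv' i) h1 h2

end MyersonOptimal

/-! ### Rounding the values of a regular distribution to a grid -/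

/-- If the payment minus `c` times the allocation decreases from the support of `ν'` to the support
of `ν`, then so do the averages. -/
theorem integral_sub_le_of_pairwise {ν ν' : Measure ℝ} [IsProbabilityMeasure ν]
    [IsProbabilityMeasure ν'] {p x : ℝ → ℝ} {c : ℝ} (hp : Integrable p ν) (hp' : Integrable p ν')
    (hx : Integrable x ν) (hx' : Integrable x ν')
    (h : ∀ᵐ y ∂ν, ∀ᵐ u ∂ν', p y - p u ≤ c * (x y - x u)) :
    ∫ y, p y ∂ν - ∫ u, p u ∂ν' ≤ c * (∫ y, x y ∂ν - ∫ u, x u ∂ν') := by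
  have h1 : ∀ᵐ y ∂ν, p y - c * x y ≤ ∫ u, (p u - c * x u) ∂ν' := by
    filter_upwards [h] with y hy
    have h2 : ∫ _u, (p y - c * x y) ∂ν' ≤ ∫ u, (p u - c * x u) ∂ν' := by
      refine integral_mono_ae (integrable_const _) (hp'.sub (hx'.const_mul c)) ?_
      filter_upwards [hy] with u hu
      change p y - c * x y ≤ p u - c * x u
      linarith
    simpa using h2
  have h3 : ∫ y, (p y - c * x y) ∂ν ≤ ∫ _y, (∫ u, (p u - c * x u) ∂ν') ∂ν :=
    integral_mono_ae (hp.sub (hx.const_mul c)) (integrable_const _) h1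
  rw [integral_const, integral_sub hp (hx.const_mul c), integral_sub hp' (hx'.const_mul c),
    integral_const_mul, integral_const_mul] at h3
  simp only [probReal_univ, smul_eq_mul, one_mul] at h3
  linarith

/-- The distribution of the values that are rounded down to `w`; the point mass at `w` if there are
none. -/
def cellMeasure (D : Measure ℝ) (V : Set ℝ) (w : ℝ) : Measure ℝ :=
  if D (roundDown V ⁻¹' {w}) = 0 then Measure.dirac w
  else ProbabilityTheory.cond D (roundDown V ⁻¹' {w})

section Cell

variable {D : Measure ℝ} {V : Set ℝ}

theorem isProbabilityMeasure_cellMeasure [IsProbabilityMeasure D] (w : ℝ) :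
    IsProbabilityMeasure (cellMeasure D V w) := by
  rw [cellMeasure]
  split_ifs with h
  · infer_instance
  · exact ProbabilityTheory.cond_isProbabilityMeasure h

theorem ae_cellMeasure (hD : HasRegularTail D) (hV : IsGrid V) {w : ℝ} (hw : w ∈ V) :
    ∀ᵐ y ∂cellMeasure D V w, 0 ≤ y ∧ roundDown V y = w := by
  have hm : MeasurableSet (roundDown V ⁻¹' {w}) :=
    hV.measurable_roundDown (measurableSet_singleton w)
  rw [cellMeasure]
  split_ifs with h
  · rw [ae_dirac_eq]
    exact ⟨hV.nonneg w hw, hV.roundDown_self hw⟩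
  · have h1 : ∀ᵐ y ∂D.restrict (roundDown V ⁻¹' {w}), 0 ≤ y ∧ roundDown V y = w := by
      filter_upwards [ae_restrict_of_ae hD.ae_nonneg, ae_restrict_mem hm] with y h1 h2
      exact ⟨h1, h2⟩
    exact Measure.ae_smul_measure h1 _

theorem integrable_cellMeasure {f : ℝ → ℝ} (hf : Integrable f D) (hfm : Measurable f) (w : ℝ) :
    Integrable f (cellMeasure D V w) := by
  rw [cellMeasure]
  split_ifs with h
  · exact integrable_dirac' hfm.stronglyMeasurable (by simp)
  · exact (hf.restrict).smul_measure (ENNReal.inv_ne_top.2 h)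

theorem mul_integral_cellMeasure [IsProbabilityMeasure D] {f : ℝ → ℝ} (w : ℝ) :
    D.real (roundDown V ⁻¹' {w}) * ∫ y, f y ∂cellMeasure D V w =
      ∫ y in roundDown V ⁻¹' {w}, f y ∂D := by
  rw [cellMeasure]
  split_ifs with h
  · rw [measureReal_def, h, Measure.restrict_eq_zero.2 h]; simp
  · have h0 : D.real (roundDown V ⁻¹' {w}) ≠ 0 := by
      rw [measureReal_def]; exact ENNReal.toReal_ne_zero.2 ⟨h, measure_ne_top _ _⟩
    rw [ProbabilityTheory.cond, integral_smul_measure, ENNReal.toReal_inv, ← measureReal_def,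
      smul_eq_mul, mul_inv_cancel_left₀ h0]

theorem integral_eq_sum_cells [IsProbabilityMeasure D] (hV : IsGrid V) {M : ℕ} {g : ℕ → ℝ}
    (hg : IsEnum V M g) {f : ℝ → ℝ} (hf : Integrable f D) :
    ∫ y, f y ∂D = ∑ k ∈ Finset.range (M + 1),
      D.real (roundDown V ⁻¹' {g k}) * ∫ y, f y ∂cellMeasure D V (g k) := by
  simp_rw [mul_integral_cellMeasure]
  have hU : (⋃ k ∈ Finset.range (M + 1), roundDown V ⁻¹' {g k}) = univ := by
    ext y
    simp only [mem_iUnion, mem_univ, iff_true, exists_prop, mem_preimage, mem_singleton_iff,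
      Finset.mem_range, Nat.lt_succ_iff]
    obtain ⟨k, hk, h⟩ := hg.surj _ (hV.roundDown_mem y)
    exact ⟨k, hk, h.symm⟩
  rw [← setIntegral_univ, ← hU, integral_biUnion_finset]
  · exact fun k _ => hV.measurable_roundDown (measurableSet_singleton _)
  · intro j hj k hk hjk
    refine Set.disjoint_left.2 fun y hy hy' => hjk (hg.injOn hj hk ?_)
    rw [← mem_singleton_iff.1 hy, ← mem_singleton_iff.1 hy']
  · exact fun k _ => hf.integrableOn

theorem isSupportedOn_map (hD : HasRegularTail D) (hV : IsGrid V) :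
    IsSupportedOn (D.map (roundDown V)) V where
  prob := by
    have := hD.prob
    exact Measure.isProbabilityMeasure_map hV.measurable_roundDown.aemeasurable
  grid := hV
  compl := by
    rw [Measure.map_apply hV.measurable_roundDown hV.finite.measurableSet.compl]
    have : roundDown V ⁻¹' Vᶜ = ∅ := by
      ext y; simpa using hV.roundDown_mem y
    rw [this, measure_empty]

end Cell

/-- A grid with largest value `H` that is fine up to the factor `κ` between its positive values, and
whose smallest positive value is at most `δ`. -/
structure IsFineGrid (V : Set ℝ) (H κ δ : ℝ) : Prop where
  grid : IsGrid V
  top_mem : H ∈ V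
  le_top : ∀ w ∈ V, w ≤ H
  pos : 0 < H
  one_le : 1 ≤ κ
  ratio : ∀ y, 0 ≤ y → y < H → roundDown V y ≠ 0 → y ≤ κ * roundDown V y
  small : ∀ y, 0 ≤ y → roundDown V y = 0 → y ≤ δ
  nonneg : 0 ≤ δ

/-- The expected payment of a single bidder is bounded by the ironed virtual surplus of the rounded
distribution, if the allocation to values of at least `H` is raised to `1`. Averaging the incentive
constraints over pairs of adjacent cells shows that the average payments of the cells satisfy the
incentive constraints of the rounded values up to the factor `κ`; in the top cell, the tail bound
of regular distributions replaces this argument. -/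
theorem SingleAgent.integral_pay_le_rounded {x p : ℝ → ℝ} (h : SingleAgent x p) {D : Measure ℝ}
    (hD : HasRegularTail D) {V : Set ℝ} {H κ δ : ℝ} (hV : IsFineGrid V H κ δ)
    (hκ : 1 ≤ κ * (1 - D.real (Ici H))) (hx : Measurable x) (hp : Measurable p)
    (hpint : Integrable p D) :
    ∫ y, p y ∂D ≤
      κ * ∫ y, ironedValue (D.map (roundDown V)) (roundDown V y) * (if H ≤ y then 1 else x y) ∂D +
        δ * ∫ y, x y ∂D := by
  have hprob := hD.prob
  set E := D.map (roundDown V) with hE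
  have hEs : IsSupportedOn E V := isSupportedOn_map hD hV.grid
  have hrm := hV.grid.measurable_roundDown
  have hκ0 : 0 ≤ κ := zero_le_one.trans hV.one_le
  have hprob' := fun w => isProbabilityMeasure_cellMeasure (D := D) (V := V) w
  obtain ⟨M, g, hg⟩ := hV.grid.exists_isEnum
  have hgnn : ∀ k ≤ M, 0 ≤ g k := fun k hk => hV.grid.nonneg _ (hg.mem k hk)
  have hgM : g M = H := by
    obtain ⟨k, hk, hkH⟩ := hg.surj H hV.top_mem
    exact le_antisymm (hV.le_top _ (hg.mem M le_rfl)) (hkH ▸ hg.le hk le_rfl)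
  have hM : 0 < M := by
    by_contra! h0
    have : M = 0 := by omega
    rw [this, hg.zero] at hgM
    exact hV.pos.ne hgM
  have hxint : Integrable x D := by
    refine Integrable.of_bound hx.aestronglyMeasurable 1 ?_
    filter_upwards [hD.ae_nonneg] with y hy
    rw [Real.norm_eq_abs, abs_of_nonneg (h.nonneg y hy)]; exact h.le_one y hy
  have hmass : ∀ k, E.real {g k} = D.real (roundDown V ⁻¹' {g k}) := fun k => by
    rw [measureReal_def, hE, Measure.map_apply hrm (measurableSet_singleton _), measureReal_def]
  -- averages over the cells
  set ν : ℕ → Measure ℝ := fun k => cellMeasure D V (g k) with hν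
  set P : ℕ → ℝ := fun k => ∫ y, p y ∂ν k with hP
  set X' : ℕ → ℝ := fun k => ∫ y, x y ∂ν k with hX'
  set X : ℕ → ℝ := fun k => if k = M then 1 else X' k with hX
  have hpν : ∀ k, Integrable p (ν k) := fun k => integrable_cellMeasure hpint hp _
  have hxν : ∀ k, Integrable x (ν k) := fun k => integrable_cellMeasure hxint hx _
  have hae : ∀ k ≤ M, ∀ᵐ y ∂ν k, 0 ≤ y ∧ roundDown V y = g k := fun k hk =>
    ae_cellMeasure hD hV.grid (hg.mem k hk)
  have hord : ∀ {j k : ℕ} {u y : ℝ}, j < k → k ≤ M → roundDown V u = g j → roundDown V y = g k →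
      u ≤ y := by
    intro j k u y hjk hk hu hy
    by_contra! hcon
    have := hV.grid.roundDown_mono hcon.le
    rw [hu, hy] at this
    exact absurd (hg.lt j k hjk hk) (not_lt.2 this)
  have hltH : ∀ {k : ℕ} {y : ℝ}, k < M → roundDown V y = g k → y < H := by
    intro k y hk hy
    by_contra! hcon
    have := hV.grid.le_roundDown hV.top_mem hcon
    rw [hy, ← hgM] at this
    exact absurd (hg.lt k M hk le_rfl) (not_lt.2 this)
  have hX'0 : ∀ k ≤ M, 0 ≤ X' k := fun k hk => integral_nonneg_of_ae (by
    filter_upwards [hae k hk] with y hy using h.nonneg y hy.1)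
  have hX'1 : ∀ k ≤ M, X' k ≤ 1 := fun k hk => by
    have : ∫ y, x y ∂ν k ≤ ∫ _y, (1 : ℝ) ∂ν k := integral_mono_ae (hxν k) (integrable_const _) (by
      filter_upwards [hae k hk] with y hy using h.le_one y hy.1)
    simpa using this
  have hX'mono : ∀ j k, j < k → k ≤ M → X' j ≤ X' k := by
    intro j k hjk hk
    have := integral_sub_le_of_pairwise (ν := ν k) (ν' := ν j) (p := fun _ => 0) (x := x) (c := 1)
      (integrable_const _) (integrable_const _) (hxν k) (hxν j) (by
        filter_upwards [hae k hk] with y hy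
        filter_upwards [hae j (by omega)] with u hu
        have := h.mono hu.1 (hord hjk hk hu.2 hy.2)
        linarith)
    simp only [integral_zero] at this
    linarith
  -- the top cell
  have htop : P M ≤ p H + κ * H * (1 - x H) := by
    have hpH : ∀ y, H ≤ y → 0 ≤ p y - p H := fun y hy => sub_nonneg.2 (h.pay_mono hV.pos.le hy)
    have hcell : roundDown V ⁻¹' {H} = Ici H := by
      ext y
      simp only [mem_preimage, mem_singleton_iff, mem_Ici]
      constructor
      · intro hy
        rcases le_or_gt 0 y with h0 | h0
        · rw [← hy]; exact hV.grid.roundDown_le h0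
        · rw [hV.grid.roundDown_of_neg h0] at hy; exact absurd hy hV.pos.ne
      · exact fun hy => le_antisymm (hV.le_top _ (hV.grid.roundDown_mem y))
          (hV.grid.le_roundDown hV.top_mem hy)
    have hx1 : 0 ≤ κ * H * (1 - x H) :=
      mul_nonneg (mul_nonneg hκ0 hV.pos.le) (sub_nonneg.2 (h.le_one H hV.pos.le))
    rcases (measureReal_nonneg (μ := D) (s := Ici H)).eq_or_lt with h0 | h0
    · have hν' : ν M = Measure.dirac H := by
        simp only [hν, cellMeasure, hgM, hcell]
        rw [if_pos ((measureReal_eq_zero_iff (measure_ne_top _ _)).1 h0.symm)]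
      have : P M = p H := by
        simp only [hP, hν']
        exact integral_dirac' _ _ hp.stronglyMeasurable
      linarith
    · have h1 := mul_integral_cellMeasure (D := D) (V := V) (f := p) H
      rw [hcell] at h1
      have hPM : P M = ∫ y, p y ∂cellMeasure D V H := by simp only [hP, hν, hgM]
      rw [← hPM] at h1
      -- by regularity, no price above `H` raises the revenue from a single bidder by more
      -- than the factor `κ`
      have hS : ∀ t, H ≤ t → t * D.real (Ici t) ≤ κ * (H * D.real (Ici H)) := by
        intro t ht
        have h2 := hD.tail H t hV.pos.le ht
        have ht0 : 0 ≤ t := hV.pos.le.trans ht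
        have h3 : 0 ≤ t * D.real (Ici t) := mul_nonneg ht0 measureReal_nonneg
        have h4 : H * D.real (Ici H) * (1 - D.real (Ici t)) ≤ H * D.real (Ici H) :=
          mul_le_of_le_one_right (mul_nonneg hV.pos.le h0.le)
            (by linarith [measureReal_nonneg (μ := D) (s := Ici t)])
        have h5 := mul_le_mul_of_nonneg_left (h2.trans h4) hκ0
        have h6 := mul_le_mul_of_nonneg_left hκ h3
        linarith
      have h2 := h.lintegral_pay_tail hV.pos hS
      have hint : IntegrableOn (fun y => p y - p H) (Ici H) D :=
        (hpint.sub (integrable_const _)).integrableOn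
      rw [← ofReal_integral_eq_lintegral_ofReal hint (by
        filter_upwards [ae_restrict_mem measurableSet_Ici] with y hy using hpH y hy),
        ENNReal.ofReal_le_ofReal_iff (mul_nonneg (sub_nonneg.2 (h.le_one H hV.pos.le))
          (mul_nonneg hκ0 (mul_nonneg hV.pos.le h0.le))),
        integral_sub hpint.integrableOn (integrable_const _), ← h1, setIntegral_const,
        smul_eq_mul] at h2
      refine le_of_mul_le_mul_left ?_ h0
      linarith
  -- the incentive constraint of a value in cell `k + 1` against a report in cell `k`, averaged over
  -- both; the value is at most `κ * g (k + 1)`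
  have hstep : ∀ k < M, P (k + 1) - P k ≤ κ * g (k + 1) * (X (k + 1) - X k) := by
    intro k hk
    have hXk : X k = X' k := if_neg hk.ne
    rw [hXk]
    rcases Nat.lt_or_ge (k + 1) M with hk1 | hk1
    · have hXk1 : X (k + 1) = X' (k + 1) := if_neg hk1.ne
      rw [hXk1]
      refine integral_sub_le_of_pairwise (hpν _) (hpν _) (hxν _) (hxν _) ?_
      filter_upwards [hae (k + 1) hk1.le] with y hy
      filter_upwards [hae k hk.le] with u hu
      have hxx := h.mono hu.1 (hord (Nat.lt_succ_self k) hk1.le hu.2 hy.2)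
      have hne : roundDown V y ≠ 0 := by
        rw [hy.2, ← hg.zero]; exact (hg.lt 0 (k + 1) (by omega) hk1.le).ne'
      have hyκ := hV.ratio y hy.1 (hltH hk1 hy.2) hne
      rw [hy.2] at hyκ
      exact (h.pay_sub_le hu.1 hy.1).trans
        (mul_le_mul_of_nonneg_right hyκ (sub_nonneg.2 hxx))
    · have hk1' : k + 1 = M := by omega
      have hXk1 : X (k + 1) = 1 := if_pos hk1'
      rw [hXk1, hk1', hgM]
      have := integral_sub_le_of_pairwise (ν := Measure.dirac H) (ν' := ν k)
        (p := p) (x := x) (c := κ * H) (integrable_dirac' hp.stronglyMeasurable (by simp)) (hpν k)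
        (integrable_dirac' hx.stronglyMeasurable (by simp)) (hxν k) (by
          rw [ae_dirac_eq, Filter.eventually_pure]
          filter_upwards [hae k hk.le] with u hu
          have hxx := h.mono hu.1 (hltH hk hu.2).le
          exact (h.pay_sub_le hu.1 hV.pos.le).trans
            (mul_le_mul_of_nonneg_right (le_mul_of_one_le_left hV.pos.le hV.one_le)
              (sub_nonneg.2 hxx)))
      rw [integral_dirac' _ _ hp.stronglyMeasurable,
        integral_dirac' _ _ hx.stronglyMeasurable] at this
      have hPk : P k = ∫ y, p y ∂ν k := rfl
      have hXk' : X' k = ∫ y, x y ∂ν k := rfl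
      rw [← hPk, ← hXk'] at this
      linarith
  have hP0 : P 0 ≤ δ * X 0 := by
    have hX0 : X 0 = X' 0 := if_neg hM.ne
    rw [hX0, hX', hP]
    simp only
    rw [← integral_const_mul]
    refine integral_mono_ae (hpν 0) ((hxν 0).const_mul δ) ?_
    filter_upwards [hae 0 (by omega)] with u hu
    exact (h.ir u hu.1).trans (mul_le_mul_of_nonneg_right
      (hV.small u hu.1 (by rw [hu.2, hg.zero])) (h.nonneg u hu.1))
  have hR : ∀ k ≤ M, g k * gridSurvival E M g k ≤ ironedRevenue E (gridSurvival E M g k) := by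
    intro k hk
    rw [gridSurvival, if_pos hk]
    exact hEs.revenue_le_ironedRevenue (hgnn k hk)
  have hEprob := hEs.prob
  have key := sum_pay_le_virtual (M := M) (q := gridSurvival E M g) (P := P)
    (X := X) (R := fun k => ironedRevenue E (gridSurvival E M g k)) (g := g)
    (κ := κ) (δ := δ) hκ0 hV.nonneg
    (fun k => by rw [gridSurvival]; split_ifs; exacts [measureReal_nonneg, le_rfl])
    (by rw [gridSurvival]; split_ifs; exacts [measureReal_le_one, zero_le_one])
    (by rw [gridSurvival, if_neg (by omega)])
    (by rw [show X 0 = X' 0 from if_neg hM.ne]; exact hX'0 0 (by omega))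
    (fun k hk => by
      rw [show X k = X' k from if_neg hk.ne]
      by_cases hk1 : k + 1 = M
      · rw [show X (k + 1) = 1 from if_pos hk1]; exact hX'1 k hk.le
      · rw [show X (k + 1) = X' (k + 1) from if_neg hk1]
        exact hX'mono k (k + 1) (by omega) (by omega))
    hP0 hstep hR (by have := hR 0 (by omega); rw [hg.zero] at this; simpa using this)
    hEs.ironedRevenue_end
  have hsumP : ∫ y, p y ∂D =
      ∑ k ∈ Finset.range (M + 1), (gridSurvival E M g k - gridSurvival E M g (k + 1)) * P k := by
    rw [integral_eq_sum_cells hV.grid hg hpint]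
    refine Finset.sum_congr rfl fun k hk => ?_
    rw [hEs.gridSurvival_sub hg (Nat.lt_succ_iff.1 (Finset.mem_range.1 hk)), hmass]
  have hxo : Measurable fun y => if H ≤ y then (1 : ℝ) else x y :=
    Measurable.ite measurableSet_Ici measurable_const hx
  have hψm : Measurable fun y => ironedValue E (roundDown V y) :=
    hEs.measurable_ironedValue.comp hrm
  have hψint :
      Integrable (fun y => ironedValue E (roundDown V y) * if H ≤ y then 1 else x y) D := by
    have h1 : Integrable (fun y => ironedValue E (roundDown V y)) D :=
      (hEs.integrable hEs.measurable_ironedValue).comp_measurable hrm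
    refine h1.mul_bdd (c := 1) hxo.aestronglyMeasurable ?_
    filter_upwards [hD.ae_nonneg] with y hy
    split_ifs
    · simp
    · rw [Real.norm_eq_abs, abs_of_nonneg (h.nonneg y hy)]; exact h.le_one y hy
  have hsumX : ∫ y, ironedValue E (roundDown V y) * (if H ≤ y then 1 else x y) ∂D =
      ∑ k ∈ Finset.range (M + 1), (ironedRevenue E (gridSurvival E M g k) -
        ironedRevenue E (gridSurvival E M g (k + 1))) * X k := by
    rw [integral_eq_sum_cells hV.grid hg hψint]
    refine Finset.sum_congr rfl fun k hk => ?_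
    have hk' := Nat.lt_succ_iff.1 (Finset.mem_range.1 hk)
    rw [hEs.ironedRevenue_sub hg hk', ← hmass, mul_assoc]
    congr 1
    have h1 : ∫ y, ironedValue E (roundDown V y) * (if H ≤ y then 1 else x y) ∂ν k =
        ∫ y, ironedValue E (g k) * (if k = M then 1 else x y) ∂ν k := by
      refine integral_congr_ae ?_
      filter_upwards [hae k hk'] with y hy
      rw [hy.2]
      congr 1
      by_cases hkM : k = M
      · rw [if_pos hkM, if_pos]
        have h2 := hV.grid.roundDown_le hy.1
        rw [hy.2, hkM, hgM] at h2
        exact h2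
      · rw [if_neg hkM, if_neg (not_le.2 (hltH (by omega) hy.2))]
    rw [h1, integral_const_mul]
    congr 1
    by_cases hkM : k = M
    · simp only [hkM, if_true, hX, integral_const, probReal_univ, smul_eq_mul, mul_one]
    · simp only [hkM, if_false, hX, hX']
  have hX0le : X 0 ≤ ∫ y, x y ∂D := by
    rw [show X 0 = X' 0 from if_neg hM.ne, integral_eq_sum_cells hV.grid hg hxint]
    have h1 : ∑ k ∈ Finset.range (M + 1), D.real (roundDown V ⁻¹' {g k}) = 1 := by
      have := integral_eq_sum_cells (D := D) hV.grid hg (integrable_const (1 : ℝ))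
      simp only [integral_const, probReal_univ, smul_eq_mul, mul_one] at this
      exact this.symm
    calc X' 0 = ∑ k ∈ Finset.range (M + 1), D.real (roundDown V ⁻¹' {g k}) * X' 0 := by
          rw [← Finset.sum_mul, h1, one_mul]
      _ ≤ _ := Finset.sum_le_sum fun k hk => mul_le_mul_of_nonneg_left (by
          rcases Nat.eq_zero_or_pos k with rfl | h0
          · exact le_rfl
          · exact hX'mono 0 k h0 (Nat.lt_succ_iff.1 (Finset.mem_range.1 hk))) measureReal_nonneg
  rw [hsumP, hsumX]
  have := mul_le_mul_of_nonneg_left hX0le hV.nonneg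
  linarith

/-! ### The loss from rounding and truncation -/

section Discretize

variable {n : ℕ} {D : Fin n → Measure ℝ} {V : Set ℝ} (τ : Equiv.Perm (Fin n))

/-- The mechanism for the bidders other than `j` that arises when the report of `j` is fixed. -/
def Mechanism.fixReport (M : Mechanism n) (j : Fin n) (y : ℝ) : Mechanism n where
  alloc v i := if i = j then 0 else M.alloc (Function.update v j y) i
  pay v i := if i = j then 0 else M.pay (Function.update v j y) i

theorem Mechanism.IsAdmissible.fixReport {M : Mechanism n} (hM : M.IsAdmissible) (j : Fin n) {y : ℝ}
    (hy : 0 ≤ y) : (M.fixReport j y).IsAdmissible := by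
  have hfeas := hM.1.2.2
  have hupd : ∀ v : Fin n → ℝ, 0 ≤ v → 0 ≤ Function.update v j y :=
    fun v hv => update_nonneg hv j hy
  refine ⟨⟨?_, ?_, fun v hv => ⟨fun i => ?_, ?_⟩⟩, ?_, ?_⟩
  · refine measurable_pi_lambda _ fun i => ?_
    by_cases hi : i = j
    · simp [Mechanism.fixReport, hi]
    · simp only [Mechanism.fixReport, hi, if_false]
      exact (hM.1.measurable_alloc i).comp measurable_update_left
  · refine measurable_pi_lambda _ fun i => ?_
    by_cases hi : i = j
    · simp [Mechanism.fixReport, hi]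
    · simp only [Mechanism.fixReport, hi, if_false]
      exact (hM.1.measurable_pay i).comp measurable_update_left
  · simp only [Mechanism.fixReport]
    split_ifs
    · exact le_rfl
    · exact (hfeas _ (hupd v hv)).1 i
  · refine le_trans (Finset.sum_le_sum fun i _ => ?_) (hfeas _ (hupd v hv)).2
    simp only [Mechanism.fixReport]
    split_ifs
    · exact (hfeas _ (hupd v hv)).1 i
    · exact le_rfl
  · intro v hv i b hb
    simp only [Mechanism.fixReport]
    split_ifs with hi
    · simp
    · have := hM.2.1 _ (hupd v hv) i b hb
      rwa [Function.update_of_ne hi, Function.update_comm (Ne.symm hi)] at this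
  · intro v hv i
    simp only [Mechanism.fixReport]
    split_ifs with hi
    · simp
    · have := hM.2.2 _ (hupd v hv) i
      rwa [Function.update_of_ne hi] at this

variable {M : Mechanism n} {T : ℝ}

/-- The revenue collected from the other bidders when bidder `j` has a value of at least `H`. -/
theorem integral_pay_others_le (hD : ∀ i, HasRegularTail (D i)) (hT : IsMedianMax D T)
    (hM : M.IsAdmissible) (hpos : ∀ v, 0 ≤ v → ∀ i, 0 ≤ M.pay v i) (j : Fin n) (H : ℝ) :
    ∫ v, (if H ≤ v j then ∑ i, (if i = j then 0 else M.pay v i) else 0) ∂Measure.pi D ≤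
      (D j).real (Ici H) * opt D := by
  have := fun i => (hD i).prob
  have hq := hT.survival_le_half hD
  have hpay := integrable_pay hD hM hpos hT.pos hq
  have hm : Measurable fun v : Fin n → ℝ => ∑ i, (if i = j then 0 else M.pay v i) :=
    Finset.measurable_sum _ fun i _ => by
      split_ifs
      · exact measurable_const
      · exact hM.1.measurable_pay i
  have hsum : Integrable (fun v : Fin n → ℝ => ∑ i, (if i = j then 0 else M.pay v i))
      (Measure.pi D) := integrable_finsetSum _ fun i _ => by
    by_cases hi : i = j
    · simp [hi]
    · simp only [hi, if_false]; exact hpay i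
  have hset : MeasurableSet {v : Fin n → ℝ | H ≤ v j} :=
    measurableSet_le measurable_const (measurable_pi_apply j)
  have hint : Integrable (fun v : Fin n → ℝ =>
      if H ≤ v j then ∑ i, (if i = j then 0 else M.pay v i) else 0) (Measure.pi D) :=
    hsum.indicator hset
  have hprod := integrable_update_prod D j hint
  have h1 : ∫ v, (if H ≤ v j then ∑ i, (if i = j then 0 else M.pay v i) else 0) ∂Measure.pi D =
      ∫ z : (Fin n → ℝ) × ℝ, (fun v : Fin n → ℝ =>
        if H ≤ v j then ∑ i, (if i = j then 0 else M.pay v i) else 0)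
          (Function.update z.1 j z.2) ∂(Measure.pi D).prod (D j) := by
    rw [integral_update D j hint, integral_prod _ hprod]
  rw [h1, integral_prod_symm _ hprod]
  have h2 : ∫ y, (Ici H).indicator (fun _ => opt D) y ∂D j = (D j).real (Ici H) * opt D := by
    rw [integral_indicator measurableSet_Ici, setIntegral_const, smul_eq_mul]
  rw [← h2]
  refine integral_mono_ae hprod.integral_prod_right
    ((integrable_const _).indicator measurableSet_Ici) ?_
  filter_upwards [(hD j).ae_nonneg] with y hy
  simp only [Function.update_self]
  by_cases hyH : H ≤ y
  · rw [indicator_of_mem (show y ∈ Ici H from hyH)]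
    simp only [hyH, if_true]
    have hadm := hM.fixReport j hy
    have hpos' : ∀ v, 0 ≤ v → ∀ i, 0 ≤ (M.fixReport j y).pay v i := fun v hv i => by
      simp only [Mechanism.fixReport]
      split_ifs
      · exact le_rfl
      · exact hpos _ (update_nonneg hv j hy) i
    exact rev_le_opt hD hT hadm (integrable_finsetSum _ fun i _ =>
      integrable_pay hD hadm hpos' hT.pos hq i)
  · rw [indicator_of_notMem (show y ∉ Ici H from hyH)]
    simp [hyH]

theorem pi_map_roundDown (hD : ∀ i, HasRegularTail (D i)) (hV : IsGrid V) :
    Measure.pi (fun i => (D i).map (roundDown V)) = (Measure.pi D).map (roundProfile V) := by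
  have := fun i => (isSupportedOn_map (hD i) hV).prob
  exact (Measure.pi_map_pi fun i => hV.measurable_roundDown.aemeasurable).symm

/-- A rounded auction has the same revenue on the values and on the rounded values. -/
theorem rev_map_roundDown (hD : ∀ i, HasRegularTail (D i)) (hV : IsGrid V)
    (E : Fin n → Measure ℝ) :
    rev (roundedMyerson τ V E) (fun i => (D i).map (roundDown V)) =
      rev (roundedMyerson τ V E) D := by
  have hr := measurable_roundProfile (ι := Fin n) hV
  unfold rev
  rw [pi_map_roundDown hD hV, integral_map hr.aemeasurable]
  · congr 1
    ext v
    have : roundProfile V (roundProfile V v) = roundProfile V v :=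
      roundProfile_of_mem hV fun i => hV.roundDown_mem _
    simp only [roundedMyerson, this]
  · exact (measurable_comp_of_countable_range hr (range_roundProfile_countable hV)
      (fun w => ∑ i, (myerson τ E).pay w i)).aestronglyMeasurable

theorem integrable_roundedMyerson (hD : ∀ i, IsProbabilityMeasure (D i)) (hV : IsGrid V)
    (E : Fin n → Measure ℝ) :
    Integrable (fun v => ∑ i, (roundedMyerson τ V E).pay v i) (Measure.pi D) := by
  obtain ⟨H, hH⟩ := hV.finite.bddAbove
  refine Integrable.of_bound (C := H) (measurable_comp_of_countable_range
    (measurable_roundProfile (ι := Fin n) hV) (range_roundProfile_countable hV)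
    (fun w => ∑ i, (myerson τ E).pay w i)).aestronglyMeasurable
    (Filter.Eventually.of_forall fun v => ?_)
  rw [Real.norm_eq_abs,
    abs_of_nonneg (Finset.sum_nonneg fun i _ => roundedMyerson_pay_nonneg τ v i)]
  exact roundedMyerson_sum_pay_le τ hV (fun w hw => hH hw) v

theorem rev_roundedMyerson_eq_surplus (hD : ∀ i, HasRegularTail (D i)) (hV : IsGrid V) :
    rev (roundedMyerson τ V fun i => (D i).map (roundDown V)) D =
      ∫ v, virtualSurplus τ V (fun i => (D i).map (roundDown V)) v ∂Measure.pi D := by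
  have hr := measurable_roundProfile (ι := Fin n) hV
  have hE := fun i => isSupportedOn_map (hD i) hV
  rw [← rev_map_roundDown τ hD hV, rev_roundedMyerson_eq τ hV hE, pi_map_roundDown hD hV,
    integral_map hr.aemeasurable]
  · congr 1
    ext v
    have h1 : roundProfile V (roundProfile V v) = roundProfile V v :=
      roundProfile_of_mem hV fun i => hV.roundDown_mem _
    have h2 : ∀ i, roundDown V (roundProfile V v i) = roundDown V (v i) := fun i => congrFun h1 i
    simp only [virtualSurplus, roundedMyerson, h1, h2]
  · exact (Finset.measurable_sum _ fun i _ => measurable_virtual_term hV hE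
      (roundedMyerson_isAdmissible τ hV hE).1 i).aestronglyMeasurable

/-- The revenue of any mechanism, compared with Myerson's auction for the rounded distributions.
When no other bidder has a value of at least `H`, the payments of a bidder are bounded by her
rounded virtual surplus; this bound allocates to a value of at least `H` with certainty, which is
feasible as no other bidder has such a value. The remaining revenue is that of the bidders who
compete with a value of at least `H`. -/
theorem rev_le_rounded (hD : ∀ i, HasRegularTail (D i)) (hT : IsMedianMax D T)
    (hM : M.IsAdmissible) (hpos : ∀ v, 0 ≤ v → ∀ i, 0 ≤ M.pay v i) {H κ δ : ℝ}
    (hV : IsFineGrid V H κ δ) (hκ : ∀ i, 1 ≤ κ * (1 - (D i).real (Ici H))) :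
    rev M D ≤ κ * rev (roundedMyerson τ V fun i => (D i).map (roundDown V)) D + δ +
      (∑ j, (D j).real (Ici H)) * opt D := by
  classical
  have := fun i => (hD i).prob
  have hκ0 : 0 ≤ κ := zero_le_one.trans hV.one_le
  have hq := hT.survival_le_half hD
  have hpay := integrable_pay hD hM hpos hT.pos hq
  have hE := fun i => isSupportedOn_map (hD i) hV.grid
  set E : Fin n → Measure ℝ := fun i => (D i).map (roundDown V) with hEdef
  -- the event that all competitors of `i` have values below `H`
  set B : Fin n → Set (Fin n → ℝ) := fun i => {v | ∀ j, j ≠ i → v j < H} with hB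
  have hBm : ∀ i, MeasurableSet (B i) := fun i => by
    have : B i = ⋂ j, ⋂ (_ : j ≠ i), {v | v j < H} := by ext v; simp [hB]
    rw [this]
    exact MeasurableSet.iInter fun j => MeasurableSet.iInter fun _ =>
      measurableSet_lt (measurable_pi_apply j) measurable_const
  have hBupd : ∀ i v y, Function.update v i y ∈ B i ↔ v ∈ B i := fun i v y => by
    simp only [hB, mem_ofPred_eq]
    refine forall₂_congr fun j hj => ?_
    rw [Function.update_of_ne hj]
  set xo : Fin n → (Fin n → ℝ) → ℝ := fun i v => if H ≤ v i then 1 else M.alloc v i with hxo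
  have hxom : ∀ i, Measurable (xo i) := fun i =>
    Measurable.ite (measurableSet_le measurable_const (measurable_pi_apply i)) measurable_const
      (hM.1.measurable_alloc i)
  set ψ : Fin n → (Fin n → ℝ) → ℝ := fun i v => ironedValue (E i) (roundDown V (v i)) with hψ
  have hψint : ∀ i, Integrable (ψ i) (Measure.pi D) := fun i => by
    have h1 : Integrable (fun y => ironedValue (E i) (roundDown V y)) (D i) :=
      ((hE i).integrable (hE i).measurable_ironedValue).comp_measurable
        hV.grid.measurable_roundDown
    exact (measurePreserving_eval D i).integrable_comp_of_integrable h1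
  have hxo01 : ∀ i v, 0 ≤ v → 0 ≤ xo i v ∧ xo i v ≤ 1 := fun i v hv => by
    simp only [hxo]
    split_ifs
    · exact ⟨zero_le_one, le_rfl⟩
    · exact ⟨(hM.1.2.2 v hv).1 i, hM.alloc_le_one hv i⟩
  have hallocint : ∀ i, Integrable (fun v => M.alloc v i) (Measure.pi D) := fun i => by
    refine Integrable.of_bound (hM.1.measurable_alloc i).aestronglyMeasurable 1 ?_
    filter_upwards [ae_pi_nonneg hD] with v hv
    rw [Real.norm_eq_abs, abs_of_nonneg ((hM.1.2.2 v hv).1 i)]; exact hM.alloc_le_one hv i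
  have hψxint : ∀ i, Integrable (fun v => ψ i v * xo i v) (Measure.pi D) := fun i => by
    refine (hψint i).mul_bdd (c := 1) (hxom i).aestronglyMeasurable ?_
    filter_upwards [ae_pi_nonneg hD] with v hv
    rw [Real.norm_eq_abs, abs_of_nonneg (hxo01 i v hv).1]; exact (hxo01 i v hv).2
  -- one bidder, when no competitor has a value of at least `H`
  have hown : ∀ i, ∫ v, (B i).indicator (fun v => M.pay v i) v ∂Measure.pi D ≤
      ∫ v, (B i).indicator (fun v => κ * (ψ i v * xo i v) + δ * M.alloc v i) v ∂Measure.pi D := by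
    intro i
    have hI1 := (hpay i).indicator (hBm i)
    have hI2 : Integrable (fun v => κ * (ψ i v * xo i v) + δ * M.alloc v i) (Measure.pi D) :=
      ((hψxint i).const_mul κ).add ((hallocint i).const_mul δ)
    rw [integral_update D i hI1, integral_update D i (hI2.indicator (hBm i))]
    refine integral_mono_ae (integrable_update_prod D i hI1).integral_prod_left
      (integrable_update_prod D i (hI2.indicator (hBm i))).integral_prod_left ?_
    filter_upwards [ae_pi_nonneg hD, (integrable_update_prod D i (hpay i)).prod_right_ae,
      (integrable_update_prod D i (hψxint i)).prod_right_ae,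
      (integrable_update_prod D i (hallocint i)).prod_right_ae] with v hv hs1 hs2 hs3
    by_cases hvB : v ∈ B i
    · simp only [indicator, hBupd, hvB, if_true]
      have key := (hM.singleAgent hv i).integral_pay_le_rounded (hD i) hV (hκ i)
        ((hM.1.measurable_alloc i).comp (measurable_update v))
        ((hM.1.measurable_pay i).comp (measurable_update v)) hs1
      rw [integral_add (hs2.const_mul κ) (hs3.const_mul δ), integral_const_mul, integral_const_mul]
      refine key.trans_eq ?_
      congr 1
      congr 1
      refine integral_congr_ae (Filter.Eventually.of_forall fun y => ?_)
      simp only [hψ, hxo, Function.update_self, hEdef]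
    · simp only [indicator, hBupd, hvB, if_false]
      exact le_rfl
  -- all bidders, when no competitor has a value of at least `H`
  have hsurplus : ∑ i, ∫ v, (B i).indicator (fun v => M.pay v i) v ∂Measure.pi D ≤
      κ * rev (roundedMyerson τ V E) D + δ := by
    have hI2 : ∀ i, Integrable ((B i).indicator fun v => κ * (ψ i v * xo i v) + δ * M.alloc v i)
        (Measure.pi D) := fun i =>
      (((hψxint i).const_mul κ).add ((hallocint i).const_mul δ)).indicator (hBm i)
    have hSint : Integrable (virtualSurplus τ V E) (Measure.pi D) := by
      have hadm := roundedMyerson_isAdmissible τ hV.grid hE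
      refine integrable_finsetSum _ fun i _ => (hψint i).mul_bdd (c := 1)
        (hadm.1.measurable_alloc i).aestronglyMeasurable ?_
      filter_upwards [ae_pi_nonneg hD] with v hv
      rw [Real.norm_eq_abs, abs_of_nonneg ((hadm.1.2.2 v hv).1 i)]
      exact hadm.alloc_le_one hv i
    refine (Finset.sum_le_sum fun i _ => hown i).trans ?_
    rw [← integral_finsetSum _ fun i _ => hI2 i, rev_roundedMyerson_eq_surplus τ hD hV.grid]
    have h1 : ∫ v, (κ * virtualSurplus τ V E v + δ) ∂Measure.pi D =
        κ * ∫ v, virtualSurplus τ V E v ∂Measure.pi D + δ := by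
      rw [integral_add (hSint.const_mul κ) (integrable_const δ), integral_const_mul]; simp
    rw [← h1]
    refine integral_mono_ae (integrable_finsetSum _ fun i _ => hI2 i)
      ((hSint.const_mul κ).add (integrable_const δ)) ?_
    have hatom : ∀ᵐ v ∂Measure.pi D, ∀ i, 0 < (E i).real {roundProfile V v i} := by
      have h2 := ae_pi_atom hE
      rw [pi_map_roundDown hD hV.grid] at h2
      exact ae_of_ae_map (measurable_roundProfile hV.grid).aemeasurable h2
    filter_upwards [ae_pi_nonneg hD, hatom] with v hv hva
    have hx := hM.1.2.2 v hv
    set y : Fin n → ℝ := fun i => (B i).indicator (xo i) v with hy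
    have hy0 : ∀ i, 0 ≤ y i := fun i => by
      simp only [hy, indicator]
      split_ifs
      exacts [(hxo01 i v hv).1, le_rfl]
    have hy1 : ∑ i, y i ≤ 1 := by
      by_cases hex : ∃ i, H ≤ v i
      · obtain ⟨i, hi⟩ := hex
        rw [Finset.sum_eq_single i]
        · simp only [hy, indicator]
          split_ifs
          · exact (hxo01 i v hv).2
          · exact zero_le_one
        · intro j _ hj
          simp only [hy, indicator]
          rw [if_neg]
          intro hcon
          exact absurd hi (not_le.2 (hcon i (Ne.symm hj)))
        · simp
      · push Not at hex
        refine (Finset.sum_le_sum fun i _ => ?_).trans hx.2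
        simp only [hy, indicator, hxo, not_le.2 (hex i), if_false]
        split_ifs
        · exact le_rfl
        · exact hx.1 i
    have h2 := le_virtualSurplus τ hE (v := v) hva hy0 hy1
    calc ∑ i, (B i).indicator (fun v => κ * (ψ i v * xo i v) + δ * M.alloc v i) v
        ≤ ∑ i, (κ * (ψ i v * y i) + δ * M.alloc v i) := by
          refine Finset.sum_le_sum fun i _ => ?_
          simp only [hy, indicator]
          split_ifs
          · exact le_rfl
          · simpa using mul_nonneg hV.nonneg (hx.1 i)
      _ = κ * ∑ i, ψ i v * y i + δ * ∑ i, M.alloc v i := by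
          rw [Finset.sum_add_distrib, Finset.mul_sum, Finset.mul_sum]
      _ ≤ κ * virtualSurplus τ V E v + δ :=
          add_le_add (mul_le_mul_of_nonneg_left h2 hκ0) (mul_le_of_le_one_right hV.nonneg hx.2)
  -- the revenue in the presence of a competitor with a value of at least `H`
  set G : Fin n → (Fin n → ℝ) → ℝ := fun j v =>
    if H ≤ v j then ∑ i, (if i = j then 0 else M.pay v i) else 0 with hG
  have hGint : ∀ j, Integrable (G j) (Measure.pi D) := fun j => by
    have h1 : Integrable (fun v => ∑ i, (if i = j then 0 else M.pay v i)) (Measure.pi D) :=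
      integrable_finsetSum _ fun i _ => by
        by_cases hi : i = j
        · simp [hi]
        · simp only [hi, if_false]; exact hpay i
    exact h1.indicator (measurableSet_le measurable_const (measurable_pi_apply j))
  have hsplit : rev M D ≤ ∑ i, ∫ v, (B i).indicator (fun v => M.pay v i) v ∂Measure.pi D +
      ∑ j, ∫ v, G j v ∂Measure.pi D := by
    rw [← integral_finsetSum _ fun i _ => (hpay i).indicator (hBm i),
      ← integral_finsetSum _ fun j _ => hGint j, ← integral_add
      (integrable_finsetSum _ fun i _ => (hpay i).indicator (hBm i))
      (integrable_finsetSum _ fun j _ => hGint j)]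
    refine integral_mono_ae (integrable_finsetSum _ fun i _ => hpay i)
      ((integrable_finsetSum _ fun i _ => (hpay i).indicator (hBm i)).add
      (integrable_finsetSum _ fun j _ => hGint j)) ?_
    filter_upwards [ae_pi_nonneg hD] with v hv
    have hp := hpos v hv
    have hG' : ∑ j, G j v =
        ∑ i, ∑ j, (if H ≤ v j then (if i = j then 0 else M.pay v i) else 0) := by
      rw [Finset.sum_comm]
      refine Finset.sum_congr rfl fun j _ => ?_
      simp only [hG]
      split_ifs
      · rfl
      · simp
    change ∑ i, M.pay v i ≤ ∑ i, (B i).indicator (fun v => M.pay v i) v + ∑ j, G j v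
    rw [hG', ← Finset.sum_add_distrib]
    refine Finset.sum_le_sum fun i _ => ?_
    have hnn : ∀ j ∈ Finset.univ, 0 ≤ (if H ≤ v j then (if i = j then 0 else M.pay v i) else 0) :=
      fun j _ => by
        split_ifs
        · exact le_rfl
        · exact hp i
        · exact le_rfl
    by_cases hvB : v ∈ B i
    · rw [indicator_of_mem hvB]
      linarith [Finset.sum_nonneg hnn]
    · rw [indicator_of_notMem hvB, zero_add]
      simp only [hB, mem_ofPred_eq, not_forall, not_lt] at hvB
      obtain ⟨j, hj, hjH⟩ := hvB
      refine le_trans ?_ (Finset.single_le_sum hnn (Finset.mem_univ j))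
      rw [if_pos hjH, if_neg (Ne.symm hj)]
  have hothers : ∑ j, ∫ v, G j v ∂Measure.pi D ≤ (∑ j, (D j).real (Ici H)) * opt D := by
    rw [Finset.sum_mul]
    exact Finset.sum_le_sum fun j _ => integral_pay_others_le hD hT hM hpos j H
  linarith

/-- The optimal revenue, compared with Myerson's auction for the rounded distributions. -/
theorem opt_le_rounded (hD : ∀ i, HasRegularTail (D i)) (hT : IsMedianMax D T) {H κ δ : ℝ}
    (hV : IsFineGrid V H κ δ) (hκ : ∀ i, 1 ≤ κ * (1 - (D i).real (Ici H))) :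
    opt D ≤ κ * rev (roundedMyerson τ V fun i => (D i).map (roundDown V)) D + δ +
      (∑ j, (D j).real (Ici H)) * opt D := by
  refine csSup_le ⟨_, postedPrice_mem_achievable hD T⟩ ?_
  rintro r ⟨M, hM, hint, rfl⟩
  exact (rev_le_rev_normalize hD hM hint hT.pos (hT.survival_le_half hD)).trans
    (rev_le_rounded τ hD hT hM.normalize (fun v hv i => hM.normalize_pay_nonneg hv i) hV hκ)

end Discretize

/-! ### Chernoff bounds -/

section Chernoff

/-- A variable with values in `[0, 1]` has a moment generating function that is nearly that of a
Poisson variable with the same mean; this gives deviation bounds relative to the mean. -/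
theorem integral_exp_mul_le {Ω : Type*} [MeasurableSpace Ω] {μ : Measure Ω} [IsProbabilityMeasure μ]
    {f : Ω → ℝ} (hf : Measurable f) (hf0 : ∀ x, 0 ≤ f x) (hf1 : ∀ x, f x ≤ 1) {l : ℝ}
    (hl : |l| ≤ 1) :
    ∫ x, Real.exp (l * f x) ∂μ ≤ Real.exp ((l + l ^ 2) * ∫ x, f x ∂μ) := by
  have hint : Integrable f μ := Integrable.of_bound (C := 1) hf.aestronglyMeasurable
    (Filter.Eventually.of_forall fun x => by
      rw [Real.norm_eq_abs, abs_of_nonneg (hf0 x)]; exact hf1 x)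
  have h1 : ∫ x, Real.exp (l * f x) ∂μ ≤ ∫ x, (1 + (l + l ^ 2) * f x) ∂μ := by
    refine integral_mono_of_nonneg (Filter.Eventually.of_forall fun x => (Real.exp_pos _).le)
      ((integrable_const _).add (hint.const_mul _)) (Filter.Eventually.of_forall fun x => ?_)
    have hx : |l * f x| ≤ 1 := by
      rw [abs_mul, abs_of_nonneg (hf0 x)]
      exact mul_le_one₀ hl (hf0 x) (hf1 x)
    have h2 := (abs_le.1 (Real.abs_exp_sub_one_sub_id_le hx)).2
    have h3 : (l * f x) ^ 2 ≤ l ^ 2 * f x := by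
      nlinarith [mul_nonneg (sq_nonneg l) (mul_nonneg (hf0 x) (sub_nonneg.2 (hf1 x)))]
    change Real.exp (l * f x) ≤ 1 + (l + l ^ 2) * f x
    linarith
  refine h1.trans ?_
  rw [integral_add (integrable_const _) (hint.const_mul _), integral_const_mul]
  simp only [integral_const, probReal_univ, one_smul]
  linarith [Real.add_one_le_exp ((l + l ^ 2) * ∫ x, f x ∂μ)]

theorem integral_exp_sum_le {Ω : Type*} [MeasurableSpace Ω] {μ : Measure Ω} [IsProbabilityMeasure μ]
    {κ : Type*} [Fintype κ]
    {f : Ω → ℝ} (hf : Measurable f) (hf0 : ∀ x, 0 ≤ f x) (hf1 : ∀ x, f x ≤ 1) {l : ℝ}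
    (hl : |l| ≤ 1) :
    ∫ x : κ → Ω, Real.exp (l * ∑ k, f (x k)) ∂Measure.pi (fun _ => μ) ≤
      Real.exp (Fintype.card κ * ((l + l ^ 2) * ∫ x, f x ∂μ)) := by
  simp_rw [Finset.mul_sum, Real.exp_sum]
  rw [integral_fintype_prod_eq_pow (fun x => Real.exp (l * f x)), Real.exp_nat_mul]
  exact pow_le_pow_left₀ (integral_nonneg fun x => (Real.exp_pos _).le)
    (integral_exp_mul_le hf hf0 hf1 hl) _

theorem integrable_exp_of_bound {Ω : Type*} [MeasurableSpace Ω] {μ : Measure Ω}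
    [IsProbabilityMeasure μ] {g : Ω → ℝ} (hg : Measurable g) {B : ℝ} (hB : ∀ x, g x ≤ B) :
    Integrable (fun x => Real.exp (g x)) μ :=
  Integrable.of_bound (C := Real.exp B) (Real.measurable_exp.comp hg).aestronglyMeasurable
    (Filter.Eventually.of_forall fun x => by
      rw [Real.norm_eq_abs, abs_of_pos (Real.exp_pos _)]; exact Real.exp_le_exp.2 (hB x))

theorem measureReal_ge_le_exp {Ω : Type*} [MeasurableSpace Ω] {μ : Measure Ω}
    [IsProbabilityMeasure μ] {g : Ω → ℝ} (hg : Integrable (fun x => Real.exp (g x)) μ) {a b : ℝ}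
    (h : ∫ x, Real.exp (g x) ∂μ ≤ Real.exp b) :
    μ.real {x | a ≤ g x} ≤ Real.exp (b - a) := by
  have h1 := mul_meas_ge_le_integral_of_nonneg
    (Filter.Eventually.of_forall fun x => (Real.exp_pos (g x)).le) hg (Real.exp a)
  simp only [Real.exp_le_exp] at h1
  rw [Real.exp_sub, le_div_iff₀ (Real.exp_pos a), mul_comm]
  exact h1.trans h

/-- The Chernoff bound for a sum of independent copies of a variable with values in `[0, 1]`. -/
theorem chernoff {Ω : Type*} [MeasurableSpace Ω] {μ : Measure Ω} [IsProbabilityMeasure μ]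
    {κ : Type*} [Fintype κ]
    {f : Ω → ℝ} (hf : Measurable f) (hf0 : ∀ x, 0 ≤ f x) (hf1 : ∀ x, f x ≤ 1) {l : ℝ}
    (hl : |l| ≤ 1) (a : ℝ) :
    (Measure.pi fun _ : κ => μ).real {x | a ≤ l * ∑ k, f (x k)} ≤
      Real.exp (Fintype.card κ * ((l + l ^ 2) * ∫ x, f x ∂μ) - a) := by
  refine measureReal_ge_le_exp (integrable_exp_of_bound (B := Fintype.card κ) ?_ fun x => ?_)
    (integral_exp_sum_le hf hf0 hf1 hl)
  · exact (Finset.measurable_sum _ fun k _ => hf.comp (measurable_pi_apply k)).const_mul l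
  · have h0 : 0 ≤ ∑ k, f (x k) := Finset.sum_nonneg fun k _ => hf0 _
    have h1 : ∑ k, f (x k) ≤ Fintype.card κ := by
      refine (Finset.sum_le_sum fun k _ => hf1 (x k)).trans ?_
      simp
    nlinarith [abs_le.1 hl]

end Chernoff

/-! ### The product of the empirical distributions -/

section Empirical

theorem measurePreserving_curry {κ ι : Type*} [Fintype κ] [Fintype ι] {X : Type*}
    [MeasurableSpace X] (μ : ι → Measure X) [∀ i, IsProbabilityMeasure (μ i)] :
    MeasurePreserving (MeasurableEquiv.curry κ ι X) (Measure.pi fun p : κ × ι => μ p.2)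
      (Measure.pi fun _ : κ => Measure.pi μ) := by
  refine ⟨(MeasurableEquiv.curry κ ι X).measurable, ?_⟩
  have := Measure.infinitePi_map_curry (fun (_ : κ) (i : ι) => μ i)
  rwa [Measure.infinitePi_eq_pi, Measure.infinitePi_eq_pi, Measure.infinitePi_eq_pi] at this

/-- Independent coordinates can be permuted separately. -/
theorem measurePreserving_shuffle {κ ι : Type*} [Fintype κ] [Fintype ι] (D : ι → Measure ℝ)
    [∀ i, IsProbabilityMeasure (D i)] (σ : ι → Equiv.Perm κ) :
    MeasurePreserving (fun (S : κ → ι → ℝ) k i => S (σ i k) i)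
      (Measure.pi fun _ => Measure.pi D) (Measure.pi fun _ => Measure.pi D) := by
  have hcurry := (measurePreserving_curry (κ := κ) D).map_eq
  let e : κ × ι → κ × ι := fun p => (σ p.2 p.1, p.2)
  let e' : κ × ι → κ × ι := fun p => ((σ p.2).symm p.1, p.2)
  have hm : Measurable fun (f : κ × ι → ℝ) p => f (e p) := by fun_prop
  have hflat : (Measure.pi fun p : κ × ι => D p.2).map (fun f p => f (e p)) =
      Measure.pi fun p : κ × ι => D p.2 := by
    symm
    refine Measure.pi_eq fun s hs => ?_
    rw [Measure.map_apply hm (MeasurableSet.univ_pi hs)]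
    have : (fun (f : κ × ι → ℝ) p => f (e p)) ⁻¹' univ.pi s = univ.pi fun p => s (e' p) := by
      ext f
      simp only [mem_preimage, mem_pi, mem_univ, forall_true_left]
      constructor
      · intro h p
        have := h (e' p)
        simpa [e, e'] using this
      · intro h p
        have := h (e p)
        simpa [e, e'] using this
    rw [this, Measure.pi_pi]
    let E : κ × ι ≃ κ × ι := ⟨e', e, fun p => by simp [e, e'], fun p => by simp [e, e']⟩
    exact Equiv.prod_comp E fun p => D p.2 (s p)
  refine ⟨by fun_prop, ?_⟩
  rw [← hcurry, Measure.map_map (by fun_prop) (MeasurableEquiv.curry κ ι ℝ).measurable]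
  conv_rhs => rw [← hflat]
  rw [Measure.map_map (MeasurableEquiv.curry κ ι ℝ).measurable hm]
  rfl

variable {n m : ℕ}

theorem isProbabilityMeasure_empirical (hm : m ≠ 0) (s : Fin m → ℝ) :
    IsProbabilityMeasure (empirical s) := by
  refine ⟨?_⟩
  simp only [empirical, Measure.smul_apply, Measure.finsetSum_apply, measure_univ, smul_eq_mul,
    Finset.sum_const, Finset.card_univ, Fintype.card_fin, nsmul_eq_mul, mul_one]
  exact ENNReal.inv_mul_cancel (by simpa using hm) (ENNReal.natCast_ne_top m)

/-- The product of the empirical distributions is the uniform distribution over all ways to combine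
samples of the different bidders. -/
theorem pi_empirical (hm : m ≠ 0) (s : Fin n → Fin m → ℝ) :
    Measure.pi (fun i => empirical (s i)) =
      ((m : ℝ≥0∞)⁻¹ ^ n) • ∑ k : Fin n → Fin m, Measure.dirac fun i => s i (k i) := by
  have := fun i => isProbabilityMeasure_empirical hm (s i)
  refine Measure.pi_eq fun B hB => ?_
  simp only [empirical, Measure.smul_apply, Measure.finsetSum_apply, smul_eq_mul]
  rw [Finset.prod_mul_distrib, Finset.prod_const, Finset.card_univ, Fintype.card_fin,
    Finset.prod_univ_sum]
  congr 1
  rw [Fintype.piFinset_univ]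
  refine Finset.sum_congr rfl fun k _ => ?_
  rw [Measure.dirac_apply' _ (MeasurableSet.univ_pi hB)]
  simp_rw [Measure.dirac_apply' _ (hB _)]
  by_cases h : (fun i => s i (k i)) ∈ univ.pi B
  · rw [indicator_of_mem h]
    refine (Finset.prod_eq_one fun i _ => ?_).symm
    rw [indicator_of_mem (h i (mem_univ i))]; rfl
  · rw [indicator_of_notMem h]
    simp only [mem_pi, mem_univ, forall_true_left, not_forall] at h
    obtain ⟨i, hi⟩ := h
    exact (Finset.prod_eq_zero (Finset.mem_univ i) (indicator_of_notMem hi _)).symm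

theorem integral_pi_empirical (hm : m ≠ 0) (s : Fin n → Fin m → ℝ) (F : (Fin n → ℝ) → ℝ) :
    ∫ v, F v ∂Measure.pi (fun i => empirical (s i)) =
      ((m : ℝ)⁻¹ ^ n) * ∑ k : Fin n → Fin m, F fun i => s i (k i) := by
  rw [pi_empirical hm, integral_smul_measure, integral_finsetSum_measure]
  · simp only [integral_dirac, smul_eq_mul]
    simp
  · intro k _
    exact integrable_dirac (by simp)

/-- Grouping the combinations of samples into blocks of `m` independent profiles each. -/
theorem mul_integral_pi_empirical [NeZero m] (S : Fin m → Fin n → ℝ) (F : (Fin n → ℝ) → ℝ) :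
    m * ∫ v, F v ∂Measure.pi (fun i => empirical fun j => S j i) =
      ∑ k : Fin n → Fin m, ((m : ℝ)⁻¹ ^ n) * ∑ j : Fin m, F fun i => S (j + k i) i := by
  rw [integral_pi_empirical (NeZero.ne m), ← Finset.mul_sum, Finset.sum_comm]
  have : ∀ j : Fin m, ∑ k : Fin n → Fin m, F (fun i => S (j + k i) i) =
      ∑ k : Fin n → Fin m, F fun i => S (k i) i := fun j =>
    Equiv.sum_comp (Equiv.addLeft (fun _ : Fin n => j)) fun k : Fin n → Fin m =>
      F fun i => S (k i) i
  simp only [this, Finset.sum_const, Finset.card_univ, Fintype.card_fin, nsmul_eq_mul]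
  ring

/-- The expectation under the product of the empirical distributions is an average of averages of
`m` independent terms, so by Jensen's inequality its moment generating function is no larger than
that of one such average. -/
theorem integral_exp_mul_integral_empirical_le [NeZero m] (D : Fin n → Measure ℝ)
    [∀ i, IsProbabilityMeasure (D i)] {F : (Fin n → ℝ) → ℝ} (hF : Measurable F)
    (hF0 : ∀ v, 0 ≤ F v) (hF1 : ∀ v, F v ≤ 1) {l : ℝ} (hl : |l| ≤ 1) :
    Integrable (fun S : Fin m → Fin n → ℝ => Real.exp (l * (m *
      ∫ v, F v ∂Measure.pi (fun i => empirical fun j => S j i))))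
      (Measure.pi fun _ => Measure.pi D) ∧
    ∫ S : Fin m → Fin n → ℝ, Real.exp (l * (m *
      ∫ v, F v ∂Measure.pi (fun i => empirical fun j => S j i)))
        ∂(Measure.pi fun _ => Measure.pi D) ≤
      Real.exp (m * ((l + l ^ 2) * ∫ v, F v ∂Measure.pi D)) := by
  have hmpos : (0 : ℝ) < m := Nat.cast_pos.2 (NeZero.pos m)
  set w : ℝ := (m : ℝ)⁻¹ ^ n with hw
  have hw0 : 0 ≤ w := by positivity
  have hw1 : ∑ _k : Fin n → Fin m, w = 1 := by
    rw [Finset.sum_const, Finset.card_univ, Fintype.card_fun, Fintype.card_fin, Fintype.card_fin,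
      nsmul_eq_mul, Nat.cast_pow, hw, ← mul_pow, mul_inv_cancel₀ hmpos.ne', one_pow]
  simp_rw [mul_integral_pi_empirical]
  let G : (Fin m → Fin n → ℝ) → ℝ := fun S => l * ∑ j : Fin m, F (S j)
  let sh : (Fin n → Fin m) → (Fin m → Fin n → ℝ) → (Fin m → Fin n → ℝ) :=
    fun k S j i => S (j + k i) i
  have hsh : ∀ k, MeasurePreserving (sh k) (Measure.pi fun _ => Measure.pi D)
      (Measure.pi fun _ => Measure.pi D) := fun k =>
    measurePreserving_shuffle D fun i => Equiv.addRight (k i)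
  have hGm : Measurable G :=
    (Finset.measurable_sum _ fun j _ => hF.comp (measurable_pi_apply j)).const_mul l
  have hGb : ∀ S, G S ≤ m := fun S => by
    have h0 : 0 ≤ ∑ j : Fin m, F (S j) := Finset.sum_nonneg fun k _ => hF0 _
    have h1 : ∑ j : Fin m, F (S j) ≤ m := by
      refine (Finset.sum_le_sum fun k _ => hF1 (S k)).trans ?_
      simp
    change l * _ ≤ _
    nlinarith [abs_le.1 hl]
  have hGint : Integrable (fun S => Real.exp (G S))
      (Measure.pi fun _ : Fin m => Measure.pi D) := integrable_exp_of_bound hGm hGb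
  have hGshint : ∀ k, Integrable (fun S => Real.exp (G (sh k S)))
      (Measure.pi fun _ : Fin m => Measure.pi D) :=
    fun k => (hsh k).integrable_comp_of_integrable hGint
  have key : ∀ S : Fin m → Fin n → ℝ,
      Real.exp (l * ∑ k : Fin n → Fin m, w * ∑ j : Fin m, F fun i => S (j + k i) i) ≤
        ∑ k : Fin n → Fin m, w * Real.exp (G (sh k S)) := fun S => by
    have := convexOn_exp.map_sum_le (t := Finset.univ) (w := fun _ : Fin n → Fin m => w)
      (p := fun k => G (sh k S)) (fun _ _ => hw0) hw1 (fun _ _ => mem_univ _)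
    simp only [smul_eq_mul] at this
    refine le_trans (le_of_eq ?_) this
    rw [Finset.mul_sum]
    congr 1
    refine Finset.sum_congr rfl fun k _ => ?_
    simp only [G, sh]; ring
  have hdom : Integrable (fun S : Fin m → Fin n → ℝ =>
      ∑ k : Fin n → Fin m, w * Real.exp (G (sh k S))) (Measure.pi fun _ => Measure.pi D) :=
    integrable_finsetSum _ fun k _ => (hGshint k).const_mul w
  constructor
  · refine Integrable.mono' hdom ?_ (Filter.Eventually.of_forall fun S => ?_)
    · refine Measurable.aestronglyMeasurable (Real.measurable_exp.comp (Measurable.const_mul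
        (Finset.measurable_sum _ fun k _ => Measurable.const_mul
          (Finset.measurable_sum _ fun j _ => hF.comp ?_) _) _))
      fun_prop
    · rw [Real.norm_eq_abs, abs_of_pos (Real.exp_pos _)]
      exact key S
  · refine (integral_mono_of_nonneg (Filter.Eventually.of_forall fun S => (Real.exp_pos _).le)
      hdom (Filter.Eventually.of_forall key)).trans ?_
    rw [integral_finsetSum _ fun k _ => (hGshint k).const_mul w]
    simp_rw [integral_const_mul]
    have : ∀ k, ∫ S, Real.exp (G (sh k S)) ∂(Measure.pi fun _ : Fin m => Measure.pi D) =
        ∫ S, Real.exp (G S) ∂(Measure.pi fun _ : Fin m => Measure.pi D) := fun k => by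
      conv_rhs => rw [← (hsh k).map_eq]
      exact (integral_map (f := fun S => Real.exp (G S)) (hsh k).measurable.aemeasurable
        (Real.measurable_exp.comp hGm).aestronglyMeasurable).symm
    simp_rw [this, ← Finset.sum_mul, hw1, one_mul]
    have := integral_exp_sum_le (κ := Fin m) (μ := Measure.pi D) hF hF0 hF1 hl
    rwa [Fintype.card_fin] at this

/-- Deviation of the expectation under the product of the empirical distributions, in either
direction according to the sign `σ`. -/
theorem empirical_deviation [NeZero m] (D : Fin n → Measure ℝ) [∀ i, IsProbabilityMeasure (D i)]
    {F : (Fin n → ℝ) → ℝ} (hF : Measurable F) {H : ℝ} (hH : 0 < H)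
    (hF0 : ∀ v, 0 ≤ F v) (hF1 : ∀ v, F v ≤ H) {l : ℝ} (hl0 : 0 ≤ l) (hl1 : l ≤ 1) {σ : ℝ}
    (hσ : σ = 1 ∨ σ = -1) (d : ℝ) :
    (Measure.pi fun _ : Fin m => Measure.pi D).real {S | d ≤ σ *
      (∫ v, F v ∂Measure.pi (fun i => empirical fun j => S j i) - ∫ v, F v ∂Measure.pi D)} ≤
      Real.exp (m * (l ^ 2 * (∫ v, F v ∂Measure.pi D) - l * d) / H) := by
  have hmpos : (0 : ℝ) < m := Nat.cast_pos.2 (NeZero.pos m)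
  have hσ2 : σ ^ 2 = 1 := by rcases hσ with h | h <;> rw [h] <;> norm_num
  have habs : |σ * l| ≤ 1 := by
    rw [abs_mul, abs_of_nonneg hl0]
    rcases hσ with h | h <;> rw [h] <;> simpa using hl1
  obtain ⟨hint, hle⟩ := integral_exp_mul_integral_empirical_le (m := m) D (F := fun v => F v / H)
    (hF.div_const H) (fun v => div_nonneg (hF0 v) hH.le) (fun v => (div_le_one hH).2 (hF1 v)) habs
  simp_rw [integral_div] at hint hle
  rcases hl0.eq_or_lt with h0 | hlpos
  · rw [← h0]; simp
  have h := measureReal_ge_le_exp (a := l * m * (d + σ * ∫ v, F v ∂Measure.pi D) / H) hint hle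
  refine le_trans (le_of_eq ?_) (h.trans (le_of_eq ?_))
  · congr 1
    ext S
    simp only [mem_ofPred_eq]
    have hc : 0 < l * m / H := by positivity
    rw [← mul_le_mul_iff_right₀ hc]
    set a := ∫ v, F v ∂Measure.pi (fun i => empirical fun j => S j i)
    set b := ∫ v, F v ∂Measure.pi D
    rw [← sub_nonneg, ← sub_nonneg (b := l * m * (d + σ * b) / H)]
    have : l * m / H * (σ * (a - b)) - l * m / H * d =
        σ * l * (m * (a / H)) - l * m * (d + σ * b) / H := by field_simp; ring
    rw [this]
  · congr 1
    have : (σ * l) ^ 2 = l ^ 2 := by rw [mul_pow, hσ2, one_mul]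
    rw [this]
    field_simp
    ring

/-- A distribution of `m` samples that are values of `V` is determined by the number of samples of
each value. -/
def histogram (V : Finset ℝ) (m : ℕ) (c : V → Fin (m + 1)) : Measure ℝ :=
  (m : ℝ≥0∞)⁻¹ • ∑ w : V, (c w : ℕ) • Measure.dirac (w : ℝ)

theorem exists_histogram (V : Finset ℝ) (s : Fin m → ℝ) (hs : ∀ k, s k ∈ V) :
    ∃ c : V → Fin (m + 1), empirical s = histogram V m c := by
  classical
  refine ⟨fun w => ⟨(Finset.univ.filter fun k => s k = w).card, Nat.lt_succ_of_le ?_⟩, ?_⟩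
  · simpa using Finset.card_filter_le (Finset.univ : Finset (Fin m)) fun k => s k = w
  · simp only [empirical, histogram]
    congr 1
    rw [← Finset.sum_fiberwise_of_maps_to (s := Finset.univ) (t := (Finset.univ : Finset V))
      (g := fun k => (⟨s k, hs k⟩ : V)) (fun _ _ => Finset.mem_univ _)]
    refine Finset.sum_congr rfl fun w _ => ?_
    rw [Finset.sum_congr rfl (g := fun _ => Measure.dirac (w : ℝ)), Finset.sum_const]
    · congr 2
      ext k
      simp [Subtype.ext_iff]
    · intro k hk
      simp only [Finset.mem_filter, Finset.mem_univ, true_and] at hk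
      rw [← hk]

/-- With high probability, the revenue of all auctions of a finite family is nearly the same under
the samples as under the true distributions. -/
theorem uniform_deviation [NeZero m] (D : Fin n → Measure ℝ) [∀ i, IsProbabilityMeasure (D i)]
    (τ : Equiv.Perm (Fin n)) {V : Set ℝ} (hV : IsGrid V) {H : ℝ} (hH : 0 < H)
    (hVH : ∀ w ∈ V, w ≤ H) {ι : Type*} [Fintype ι] (E : ι → Fin n → Measure ℝ) {R : ℝ}
    (hR : ∀ c, rev (roundedMyerson τ V (E c)) D ≤ R) {l : ℝ} (hl0 : 0 ≤ l) (hl1 : l ≤ 1) (d : ℝ) :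
    (Measure.pi fun _ : Fin m => Measure.pi D).real {S | ∃ c,
      d ≤ |rev (roundedMyerson τ V (E c)) (fun i => empirical fun j => S j i) -
        rev (roundedMyerson τ V (E c)) D|} ≤
      Fintype.card ι * (2 * Real.exp (m * (l ^ 2 * R - l * d) / H)) := by
  set P := Measure.pi fun _ : Fin m => Measure.pi D
  set dev : ι → (Fin m → Fin n → ℝ) → ℝ := fun c S =>
    rev (roundedMyerson τ V (E c)) (fun i => empirical fun j => S j i) -
        rev (roundedMyerson τ V (E c)) D with hdev
  have hbd : ∀ c (σ : ℝ), σ = 1 ∨ σ = -1 → P.real {S | d ≤ σ * dev c S} ≤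
      Real.exp (m * (l ^ 2 * R - l * d) / H) := fun c σ hσ => by
    refine (empirical_deviation D (F := fun v => ∑ i, (roundedMyerson τ V (E c)).pay v i)
      (measurable_comp_of_countable_range
        (measurable_roundProfile (ι := Fin n) hV) (range_roundProfile_countable hV)
        (fun w => ∑ i, (myerson τ (E c)).pay w i)) hH
      (fun v => Finset.sum_nonneg fun i _ => roundedMyerson_pay_nonneg τ v i)
      (roundedMyerson_sum_pay_le τ hV hVH) hl0 hl1 hσ d).trans ?_
    refine Real.exp_le_exp.2 ?_
    have : l ^ 2 * rev (roundedMyerson τ V (E c)) D ≤ l ^ 2 * R :=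
      mul_le_mul_of_nonneg_left (hR c) (sq_nonneg l)
    unfold rev at this
    gcongr
  calc P.real {S | ∃ c, d ≤ |dev c S|}
      ≤ P.real (⋃ c, ({S | d ≤ 1 * dev c S} ∪ {S | d ≤ -1 * dev c S})) := by
        refine measureReal_mono fun S hS => ?_
        obtain ⟨c, hc⟩ := hS
        refine mem_iUnion.2 ⟨c, ?_⟩
        rcases le_abs.1 hc with h | h
        · left; simpa using h
        · right; simpa using h
    _ ≤ ∑ c, P.real ({S | d ≤ 1 * dev c S} ∪ {S | d ≤ -1 * dev c S}) :=
        measureReal_iUnion_fintype_le _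
    _ ≤ ∑ _c : ι, 2 * Real.exp (m * (l ^ 2 * R - l * d) / H) := by
        refine Finset.sum_le_sum fun c _ => (measureReal_union_le _ _).trans ?_
        linarith [hbd c 1 (Or.inl rfl), hbd c (-1) (Or.inr rfl)]
    _ = _ := by simp

end Empirical

/-! ### The grid of the algorithm -/

section Grid

variable {ε A : ℝ}

theorem le_of_le_pow_grid (hε : 0 < ε) (hε1 : ε < 1) {k : ℕ}
    (h : ε / 8 ≤ 8 / ε * (1 - ε) ^ k) : (k : ℝ) ≤ Real.log (64 / ε ^ 2) / ε := by
  have h1 : (1 - ε) ^ k ≤ Real.exp (-(ε * k)) := by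
    have : 1 - ε ≤ Real.exp (-ε) := by linarith [Real.add_one_le_exp (-ε)]
    refine (pow_le_pow_left₀ (by linarith) this k).trans (le_of_eq ?_)
    rw [← Real.exp_nat_mul]; congr 1; ring
  have h2 : Real.exp (ε * k) ≤ 64 / ε ^ 2 := by
    have h3 : ε / 8 ≤ 8 / ε * Real.exp (-(ε * k)) := h.trans (by gcongr)
    rw [Real.exp_neg, div_mul_eq_mul_div, le_div_iff₀ hε] at h3
    rw [le_div_iff₀ (by positivity)]
    rw [← div_eq_mul_inv, le_div_iff₀ (Real.exp_pos _)] at h3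
    nlinarith
  rw [le_div_iff₀ hε, Real.le_log_iff_exp_le (by positivity), mul_comm]
  exact h2

theorem valueGrid_subset (hε : 0 < ε) (hε1 : ε < 1) : valueGrid ε A ⊆
    ((fun k : ℕ => 8 / ε * (1 - ε) ^ k * A) '' (Finset.range (⌊Real.log (64 / ε ^ 2) / ε⌋₊ + 1))) ∪
      {ε / 8 * A, 0} := by
  refine union_subset_union_left _ ?_
  rintro w ⟨k, hk, rfl⟩
  refine ⟨k, ?_, rfl⟩
  rw [Finset.mem_coe, Finset.mem_range, Nat.lt_succ_iff]
  exact Nat.le_floor (le_of_le_pow_grid hε hε1 hk)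

theorem isGrid_valueGrid (hε : 0 < ε) (hε1 : ε < 1) (hA : 0 ≤ A) : IsGrid (valueGrid ε A) where
  finite := (((Finset.finite_toSet _).image _).union (by simp)).subset (valueGrid_subset hε hε1)
  zero_mem := by simp [valueGrid]
  nonneg := by
    have h1 : 0 ≤ 1 - ε := by linarith
    rintro w (⟨k, -, rfl⟩ | rfl | rfl)
    · positivity
    · positivity
    · exact le_rfl

theorem le_of_mem_valueGrid (hε : 0 < ε) (hε1 : ε < 1) (hA : 0 ≤ A) {w : ℝ}
    (hw : w ∈ valueGrid ε A) : w ≤ 8 / ε * A := by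
  rcases hw with ⟨k, -, rfl⟩ | rfl | rfl
  · have h1 : (1 - ε) ^ k ≤ 1 := pow_le_one₀ (by linarith) (by linarith)
    have h2 : 8 / ε * (1 - ε) ^ k ≤ 8 / ε * 1 := by gcongr
    nlinarith
  · refine mul_le_mul_of_nonneg_right ?_ hA
    rw [div_le_div_iff₀ (by norm_num) hε]
    nlinarith
  · positivity

theorem ncard_valueGrid_le (hε : 0 < ε) (hε0 : ε ≤ 1 / 20000) :
    ((valueGrid ε A).ncard : ℝ) ≤ 3 * (Real.log (1 / ε) / ε) := by
  have hε1 : ε < 1 := by linarith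
  have h1 : (valueGrid ε A).ncard ≤ (⌊Real.log (64 / ε ^ 2) / ε⌋₊ + 1) + 2 := by
    refine (ncard_le_ncard (valueGrid_subset hε hε1)
      (((Finset.finite_toSet _).image _).union (by simp))).trans ((ncard_union_le _ _).trans ?_)
    refine add_le_add ((ncard_image_le (Finset.finite_toSet _)).trans ?_)
      ((ncard_insert_le _ _).trans (by simp))
    rw [ncard_coe_finset, Finset.card_range]
  set l := Real.log (1 / ε) with hl
  have hinv : 20000 ≤ 1 / ε := by rw [le_div_iff₀ hε]; linarith
  have h64 : Real.log 64 ≤ l / 2 := by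
    have : Real.log (64 ^ 2) ≤ l := Real.log_le_log (by norm_num) (by linarith)
    rw [Real.log_pow] at this; push_cast at this; linarith
  have hlog : Real.log (64 / ε ^ 2) = Real.log 64 + 2 * l := by
    rw [Real.log_div (by norm_num) (by positivity), Real.log_pow, hl,
      Real.log_div one_ne_zero hε.ne', Real.log_one]; push_cast; ring
  have hl1 : 1 ≤ l := by
    rw [hl, Real.le_log_iff_exp_le (by positivity)]
    linarith [Real.exp_one_lt_d9]
  have h2 : (⌊Real.log (64 / ε ^ 2) / ε⌋₊ : ℝ) ≤ 5 / 2 * (l / ε) := by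
    refine (Nat.floor_le (div_nonneg (by rw [hlog]; positivity) hε.le)).trans ?_
    rw [← mul_div_assoc, hlog]
    gcongr; linarith
  have h3 : 6 ≤ l / ε := by
    rw [le_div_iff₀ hε]; nlinarith
  have h4 : ((valueGrid ε A).ncard : ℝ) ≤ (⌊Real.log (64 / ε ^ 2) / ε⌋₊ + 1) + 2 := by
    exact_mod_cast h1
  linarith

/-- Consecutive positive values of the grid have a ratio of at least `1 - ε`, and the smallest one
is `ε / 8 * A`. -/
theorem isFineGrid_valueGrid (hε : 0 < ε) (hε1 : ε < 1) (hA : 0 < A) :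
    IsFineGrid (valueGrid ε A) (8 / ε * A) (1 / (1 - ε)) (ε / 8 * A) := by
  have hg := isGrid_valueGrid hε hε1 hA.le
  have h1ε : 0 < 1 - ε := by linarith
  have hlow : ε / 8 * A ∈ valueGrid ε A := Or.inr (Or.inl rfl)
  refine ⟨hg, ?_, fun w hw => le_of_mem_valueGrid hε hε1 hA.le hw, by positivity, ?_, ?_, ?_,
    by positivity⟩
  · refine Or.inl ⟨0, ?_, by simp⟩
    rw [pow_zero, mul_one, div_le_div_iff₀ (by norm_num) hε]
    nlinarith
  · rw [le_div_iff₀ h1ε]; linarith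
  · intro y hy hyH hne
    have hr : ε / 8 * A ≤ y := by
      by_contra! hlt
      have h2 := hg.roundDown_mem y
      have h3 := (hg.roundDown_le hy).trans_lt hlt
      rcases h2 with ⟨k, hk, hw⟩ | hw | hw
      · rw [hw] at h3
        exact absurd (mul_le_mul_of_nonneg_right hk hA.le) (not_le.2 h3)
      · exact absurd hw.symm.le (not_le.2 h3)
      · exact hne hw
    have hypos : 0 < y := lt_of_lt_of_le (by positivity) hr
    -- the first power that does not exceed `y`
    have hex : ∃ k : ℕ, 8 / ε * (1 - ε) ^ k * A ≤ y := by
      obtain ⟨k, hk⟩ := exists_pow_lt_of_lt_one (show 0 < y / (8 / ε * A) by positivity)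
        (show 1 - ε < 1 by linarith)
      refine ⟨k, ?_⟩
      rw [lt_div_iff₀ (by positivity)] at hk
      nlinarith
    classical
    set k := Nat.find hex with hkdef
    have hk := Nat.find_spec hex
    have hk0 : k ≠ 0 := by
      intro h0
      have := hk
      rw [← hkdef, h0, pow_zero, mul_one] at this
      linarith
    obtain ⟨j, hj⟩ := Nat.exists_eq_succ_of_ne_zero hk0
    have hjlt := Nat.find_min hex (m := j) (by omega)
    push Not at hjlt
    rw [← hkdef, hj, pow_succ] at hk
    have hyr : (1 - ε) * y ≤ roundDown (valueGrid ε A) y := by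
      by_cases hkv : ε / 8 ≤ 8 / ε * (1 - ε) ^ (j + 1)
      · have := hg.le_roundDown (x := y) (w := 8 / ε * (1 - ε) ^ (j + 1) * A)
          (Or.inl ⟨_, hkv, rfl⟩) (by rw [pow_succ]; exact hk)
        rw [pow_succ] at this
        nlinarith
      · push Not at hkv
        have := hg.le_roundDown hlow hr
        rw [pow_succ] at hkv
        have h4 := mul_lt_mul_of_pos_right hkv hA
        nlinarith
    rw [div_mul_eq_mul_div, one_mul, le_div_iff₀ h1ε]
    linarith
  · intro y hy h0
    by_contra! hlt
    have := hg.le_roundDown hlow hlt.le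
    rw [h0] at this
    nlinarith [mul_pos hε hA]

end Grid

/-! ### The revenue of the auction for the empirical distributions -/

section Core

variable {n m : ℕ} {D : Fin n → Measure ℝ} {T : ℝ} (τ : Equiv.Perm (Fin n))

theorem isSupportedOn_empirical {V : Set ℝ} (hV : IsGrid V) (hm : m ≠ 0) {s : Fin m → ℝ}
    (hs : ∀ k, s k ∈ V) : IsSupportedOn (empirical s) V where
  prob := isProbabilityMeasure_empirical hm s
  grid := hV
  compl := by
    simp only [empirical, Measure.smul_apply, Measure.finsetSum_apply, smul_eq_mul]
    rw [Finset.sum_eq_zero, mul_zero]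
    intro k _
    rw [Measure.dirac_apply' _ hV.finite.measurableSet.compl]
    simp [hs k]

theorem sum_survival_le (hD : ∀ i, HasRegularTail (D i)) (hT : IsMedianMax D T) {H : ℝ}
    (hTH : T ≤ H) : H * ∑ j, (D j).real (Ici H) ≤ 2 * T := by
  have h1 : H * ∑ j, (D j).real (Ici H) ≤ 2 * T * ∑ j, (D j).real (Ici T) := by
    rw [Finset.mul_sum, Finset.mul_sum]
    exact Finset.sum_le_sum fun j _ =>
      (hD j).mul_survival_le hT.pos.le hTH (hT.survival_le_half hD j)
  nlinarith [hT.sum_survival_le_one hD, hT.pos]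

/-- The optimal auction for the rounded distributions is nearly optimal. -/
theorem opt_le_rev_rounded (hD : ∀ i, HasRegularTail (D i)) (hT : IsMedianMax D T) {ε A : ℝ}
    (hε : 0 < ε) (hε0 : ε ≤ 1 / 20000) (hA1 : T / 8 ≤ A) (hA2 : A ≤ 132 * T) :
    (1 - 36 * ε) * opt D ≤ rev (roundedMyerson τ (valueGrid ε A)
      fun i => (D i).map (roundDown (valueGrid ε A))) D := by
  have hTpos := hT.pos
  have hA : 0 < A := by linarith
  have hε1 : ε < 1 := by linarith
  have h1ε : 0 < 1 - ε := by linarith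
  have hTH : T / ε ≤ 8 / ε * A := by
    rw [div_mul_eq_mul_div]; gcongr; linarith
  have hTH' : T ≤ 8 / ε * A := by
    refine le_trans ?_ hTH
    rw [le_div_iff₀ hε]; nlinarith
  have hsum : ∑ j, (D j).real (Ici (8 / ε * A)) ≤ 2 * ε := by
    have h1 := sum_survival_le hD hT hTH'
    have h0 : 0 ≤ ∑ j, (D j).real (Ici (8 / ε * A)) :=
      Finset.sum_nonneg fun _ _ => measureReal_nonneg
    have h2 := (mul_le_mul_of_nonneg_right hTH h0).trans h1
    rw [div_mul_eq_mul_div, div_le_iff₀ hε] at h2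
    nlinarith
  have hκ : ∀ i, 1 ≤ 1 / (1 - ε) * (1 - (D i).real (Ici (8 / ε * A))) := fun i => by
    rw [div_mul_eq_mul_div, one_mul, le_div_iff₀ h1ε]
    have h1 := (hD i).mul_survival_le hTpos.le hTH' (hT.survival_le_half hD i)
    have h2 := hT.survival_le_half hD i
    have h3 : T / ε * (D i).real (Ici (8 / ε * A)) ≤ T :=
      (mul_le_mul_of_nonneg_right hTH measureReal_nonneg).trans (h1.trans (by nlinarith))
    rw [div_mul_eq_mul_div, div_le_iff₀ hε] at h3
    nlinarith
  have hmain := opt_le_rounded τ hD hT (isFineGrid_valueGrid hε hε1 hA) hκ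
  set R := rev (roundedMyerson τ (valueGrid ε A)
      fun i => (D i).map (roundDown (valueGrid ε A))) D
  have hopt := half_le_opt hD hT
  have hopt0 : 0 ≤ opt D := by linarith
  -- the loss is at most `ε / 8 * A ≤ 33 * ε * opt D` from the values that are rounded to zero, and
  -- `2 * ε * opt D` from the values above the grid, apart from the ratio of adjacent grid values
  have h1 : (1 - 35 * ε) * opt D ≤ 1 / (1 - ε) * R := by
    have h2 := mul_le_mul_of_nonneg_right hsum hopt0
    have h3 : ε / 8 * A ≤ 33 * ε * opt D := by nlinarith
    linarith
  rw [div_mul_eq_mul_div, one_mul, le_div_iff₀ h1ε] at h1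
  nlinarith [mul_nonneg (sq_nonneg ε) hopt0]

/-- The sample size makes the failure probability of the union bound over all histograms small. -/
theorem union_bound_le {ε γ a N : ℝ} (hn : 1 ≤ n) (hε : 0 < ε) (hε0 : ε ≤ 1 / 20000)
    (hγ : 0 < γ) (hγ1 : γ < 1) (ha : a ≤ 3 * (n * (Real.log (1 / ε) / ε)))
    (hm : 20 * (1 / ε ^ 3 * (n / ε * Real.log (1 / ε) * Real.log (n / ε) + Real.log (1 / γ))) ≤ N) :
    4 * Real.exp (a * Real.log (N + 1)) * Real.exp (-(2 * (N * ε ^ 3))) ≤ γ := by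
  have hn' : (1 : ℝ) ≤ n := by exact_mod_cast hn
  set l := Real.log (1 / ε) with hl
  set L := Real.log (n / ε) with hL
  set G := Real.log (1 / γ) with hG
  have hG0 : 0 ≤ G := Real.log_nonneg (by rw [le_div_iff₀ hγ]; linarith)
  have hinv : 20000 ≤ 1 / ε := by rw [le_div_iff₀ hε]; linarith
  have hl1 : 1 ≤ l := by
    rw [hl, Real.le_log_iff_exp_le (by positivity)]
    linarith [Real.exp_one_lt_d9]
  have hle : 1 / ε ≤ n / ε := by gcongr
  have hLl : l ≤ L := Real.log_le_log (by positivity) hle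
  have hlε : l ≤ 1 / ε := by
    rw [hl]
    exact (Real.log_le_sub_one_of_pos (by positivity)).trans (by linarith)
  set X := n / ε * l * L with hX
  have hnε : 1 ≤ n / ε := by linarith
  have hX1 : 2 ≤ X := by
    have h1 : 2 ≤ n / ε * l := by nlinarith
    nlinarith
  have hε3 : 0 < ε ^ 3 := by positivity
  have hN : 20 * (X + G) ≤ N * ε ^ 3 := by
    have h1 := mul_le_mul_of_nonneg_right hm hε3.le
    have h2 : 20 * (1 / ε ^ 3 * (X + G)) * ε ^ 3 = 20 * (X + G) := by field_simp
    linarith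
  have hNpos : 0 < N := by
    have : 0 < N * ε ^ 3 := by linarith
    exact pos_of_mul_pos_left this hε3.le
  -- the logarithm is bounded by its tangent at the point `b`
  set b := 3 * (n * (l / ε)) / ε ^ 3 with hb
  have hbpos : 0 < b := by positivity
  have hlogN : Real.log (N + 1) ≤ Real.log b + (N + 1) / b := by
    have h1 := Real.log_le_sub_one_of_pos (show 0 < (N + 1) / b by positivity)
    rw [Real.log_div (by positivity) hbpos.ne'] at h1
    linarith
  have hlogb : Real.log b ≤ 6 * L := by
    have h1 : b ≤ (n / ε) ^ 6 := by
      have h2 : b = n / ε * (1 / ε) ^ 3 * (3 * l) := by rw [hb]; field_simp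
      have h3 : 3 * l ≤ (n / ε) ^ 2 := by nlinarith
      have h4 : (1 / ε) ^ 3 ≤ (n / ε) ^ 3 := by gcongr
      calc b = n / ε * (1 / ε) ^ 3 * (3 * l) := h2
        _ ≤ n / ε * (n / ε) ^ 3 * (n / ε) ^ 2 := by gcongr
        _ = _ := by ring
    have h5 := Real.log_le_log hbpos h1
    rwa [Real.log_pow, Nat.cast_ofNat] at h5
  have hlogN0 : 0 ≤ Real.log (N + 1) := Real.log_nonneg (by linarith)
  have h1 : a * Real.log (N + 1) ≤ 18 * X + ε ^ 3 * (N + 1) := by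
    have hb' : 3 * (n * (l / ε)) = b * ε ^ 3 := by rw [hb]; field_simp
    calc a * Real.log (N + 1) ≤ 3 * (n * (l / ε)) * Real.log (N + 1) := by gcongr
      _ ≤ 3 * (n * (l / ε)) * (Real.log b + (N + 1) / b) := by gcongr
      _ = 3 * (n * (l / ε)) * Real.log b + ε ^ 3 * (N + 1) := by
          rw [mul_add]; congr 1; rw [hb']; field_simp
      _ ≤ 3 * (n * (l / ε)) * (6 * L) + ε ^ 3 * (N + 1) := by gcongr
      _ = 18 * X + ε ^ 3 * (N + 1) := by rw [hX]; ring
  have h4 : (4 : ℝ) ≤ Real.exp 2 := by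
    have h := Real.exp_one_gt_d9
    have : Real.exp 2 = Real.exp 1 * Real.exp 1 := by rw [← Real.exp_add]; norm_num
    rw [this]; nlinarith
  have hγe : γ = Real.exp (-G) := by
    rw [hG, one_div, Real.log_inv, neg_neg, Real.exp_log hγ]
  have hε31 : ε ^ 3 ≤ 1 := pow_le_one₀ hε.le (by linarith)
  calc 4 * Real.exp (a * Real.log (N + 1)) * Real.exp (-(2 * (N * ε ^ 3)))
      ≤ Real.exp 2 * Real.exp (18 * X + ε ^ 3 * (N + 1)) * Real.exp (-(2 * (N * ε ^ 3))) := by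
        gcongr
    _ = Real.exp (2 + (18 * X + ε ^ 3 * (N + 1)) + -(2 * (N * ε ^ 3))) := by
        rw [← Real.exp_add, ← Real.exp_add]
    _ ≤ Real.exp (-G) := Real.exp_le_exp.2 (by nlinarith)
    _ = γ := hγe.symm

/-- A rounded auction earns the same on the samples and on the rounded samples. -/
theorem rev_empirical_round {V : Set ℝ} (hV : IsGrid V) (hm : m ≠ 0) (E : Fin n → Measure ℝ)
    (S : Fin m → Fin n → ℝ) :
    rev (roundedMyerson τ V E) (fun i => empirical fun k => roundDown V (S k i)) =
      rev (roundedMyerson τ V E) (fun i => empirical fun k => S k i) := by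
  unfold rev
  rw [integral_pi_empirical hm, integral_pi_empirical hm]
  congr 1
  refine Finset.sum_congr rfl fun k _ => ?_
  have : roundProfile V (fun i => roundDown V (S (k i) i)) = roundProfile V fun i => S (k i) i :=
    roundProfile_of_mem hV fun i => hV.roundDown_mem _
  simp only [roundedMyerson, this]

/-- If the scale `A` of the grid is of the order of the optimal revenue, then the auction for the
empirical distributions is nearly optimal with high probability. -/
theorem rev_empirical_ge (hn : 1 ≤ n) (hD : ∀ i, HasRegularTail (D i)) (hT : IsMedianMax D T)
    {ε γ A : ℝ} (hε : 0 < ε) (hε0 : ε ≤ 1 / 20000) (hγ : 0 < γ) (hγ1 : γ < 1)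
    (hA1 : T / 8 ≤ A) (hA2 : A ≤ 132 * T) (hm0 : m ≠ 0)
    (hm : 20 * (1 / ε ^ 3 * (n / ε * Real.log (1 / ε) * Real.log (n / ε) + Real.log (1 / γ))) ≤
      (m : ℝ)) :
    (Measure.pi fun _ : Fin m => Measure.pi D).real {S |
      rev (roundedMyerson τ (valueGrid ε A)
        fun i => empirical fun k => roundDown (valueGrid ε A) (S k i)) D <
          (1 - 8500 * ε) * opt D} ≤ γ := by
  classical
  have hprob := fun i => (hD i).prob
  have : NeZero m := ⟨hm0⟩
  have hTpos := hT.pos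
  have hA : 0 < A := by linarith
  have hε1 : ε < 1 := by linarith
  set V := valueGrid ε A with hVdef
  set H := 8 / ε * A with hH
  have hV : IsGrid V := isGrid_valueGrid hε hε1 hA.le
  have hVH : ∀ w ∈ V, w ≤ H := fun w hw => le_of_mem_valueGrid hε hε1 hA.le hw
  have hHpos : 0 < H := by positivity
  have hHle : H ≤ 1056 * T / ε := by
    rw [hH, div_mul_eq_mul_div]; exact div_le_div_of_nonneg_right (by linarith) hε.le
  set W : Finset ℝ := hV.finite.toFinset with hW
  have hWmem : ∀ w, w ∈ W ↔ w ∈ V := fun w => hV.finite.mem_toFinset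
  -- the auctions for all possible histograms, and the optimal one for the rounded distributions
  let Hist := {c : Fin n → W → Fin (m + 1) // ∀ i, IsSupportedOn (histogram W m (c i)) V}
  let E : Option Hist → Fin n → Measure ℝ := fun o => match o with
    | none => fun i => (D i).map (roundDown V)
    | some c => fun i => histogram W m (c.1 i)
  have hE : ∀ o i, IsSupportedOn (E o i) V := fun o i => match o with
    | none => isSupportedOn_map (hD i) hV
    | some c => c.2 i
  have hR : ∀ o, rev (roundedMyerson τ V (E o)) D ≤ 3 * T := fun o =>
    (rev_le_opt hD hT (roundedMyerson_isAdmissible τ hV (hE o))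
      (integrable_roundedMyerson τ hprob hV _)).trans (opt_le hD hT)
  -- payments are at most `1056 * T / ε`, so that this deviation makes the Chernoff exponent at most
  -- `-(2 * m * ε ^ 3)`
  set d := 2115 * ε * T with hd
  have hdev := uniform_deviation (m := m) D τ hV hHpos hVH E hR hε.le hε1.le d
  refine (measureReal_mono ?_).trans (hdev.trans ?_)
  · intro S hS
    by_contra hcon
    simp only [mem_ofPred_eq, not_exists, not_le] at hcon hS
    set Emp : Fin n → Measure ℝ := fun i => empirical fun k => roundDown V (S k i) with hEmp
    have hEmpS : ∀ i, IsSupportedOn (Emp i) V := fun i =>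
      isSupportedOn_empirical hV hm0 fun k => hV.roundDown_mem _
    have hex : ∀ i, ∃ c : W → Fin (m + 1), Emp i = histogram W m c := fun i =>
      exists_histogram W _ fun k => (hWmem _).2 (hV.roundDown_mem _)
    choose c hc using hex
    let cc : Hist := ⟨c, fun i => hc i ▸ hEmpS i⟩
    have hEcc : E (some cc) = Emp := funext fun i => (hc i).symm
    have h1 := (abs_lt.1 (hcon (some cc))).2
    have h2 := (abs_lt.1 (hcon none)).1
    rw [hEcc, ← rev_empirical_round τ hV hm0] at h1
    rw [← rev_empirical_round τ hV hm0] at h2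
    have h3 : rev (roundedMyerson τ V (E none)) Emp ≤ rev (roundedMyerson τ V Emp) Emp :=
      rev_le_rev_roundedMyerson τ hV hEmpS (roundedMyerson_isAdmissible τ hV (hE none))
    have h4 : (1 - 36 * ε) * opt D ≤ rev (roundedMyerson τ V (E none)) D :=
      opt_le_rev_rounded τ hD hT hε hε0 hA1 hA2
    have hopt := half_le_opt hD hT
    have h5 : d ≤ 4230 * ε * opt D := by rw [hd]; nlinarith
    nlinarith [mul_nonneg hε.le (show 0 ≤ opt D by linarith)]
  · have hcardW : (W.card : ℝ) ≤ 3 * (Real.log (1 / ε) / ε) := by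
      rw [hW, ← ncard_eq_toFinset_card V hV.finite]
      exact ncard_valueGrid_le hε hε0
    set a : ℝ := n * W.card with ha
    have hcard : (Fintype.card (Option Hist) : ℝ) ≤ 2 * Real.exp (a * Real.log (m + 1)) := by
      have h1 : Fintype.card Hist ≤ ((m + 1) ^ W.card) ^ n := by
        refine (Fintype.card_subtype_le _).trans (le_of_eq ?_)
        simp
      have h2 : Real.exp (a * Real.log (m + 1)) = (((m + 1) ^ W.card) ^ n : ℕ) := by
        rw [mul_comm, Real.exp_mul, Real.exp_log (by positivity), ha]
        push_cast
        rw [← pow_mul, ← Real.rpow_natCast]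
        push_cast
        rw [mul_comm (n : ℝ)]
      have h3 : 1 ≤ ((m + 1) ^ W.card) ^ n := Nat.one_le_pow _ _ (by positivity)
      rw [h2, Fintype.card_option]
      norm_cast
      omega
    have hexp : m * (ε ^ 2 * (3 * T) - ε * d) / H ≤ -(2 * (m * ε ^ 3)) := by
      rw [div_le_iff₀ hHpos, hd]
      have h1 : 2 * (m * ε ^ 3) * H ≤ 2 * (m * ε ^ 3) * (1056 * T / ε) := by gcongr
      have h2 : 2 * (m * ε ^ 3) * (1056 * T / ε) = 2112 * m * ε ^ 2 * T := by field_simp; ring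
      nlinarith
    refine le_trans ?_ (union_bound_le hn hε hε0 hγ hγ1 (a := a) (N := m) ?_ hm)
    · calc (Fintype.card (Option Hist) : ℝ) * (2 * Real.exp (m * (ε ^ 2 * (3 * T) - ε * d) / H))
          ≤ 2 * Real.exp (a * Real.log (m + 1)) * (2 * Real.exp (-(2 * (m * ε ^ 3)))) := by gcongr
        _ = _ := by ring
    · rw [ha]
      have := mul_le_mul_of_nonneg_left hcardW (Nat.cast_nonneg (α := ℝ) n)
      linarith

end Core

/-! ### The single-bidder estimates -/

section SingleRevenue

variable {m : ℕ}

theorem empirical_real (s : Fin m → ℝ) {B : Set ℝ} (hB : MeasurableSet B) :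
    (empirical s).real B = (∑ k, B.indicator (fun _ => (1 : ℝ)) (s k)) / m := by
  simp only [empirical, measureReal_def, Measure.smul_apply, Measure.finsetSum_apply, smul_eq_mul,
    ENNReal.toReal_mul, ENNReal.toReal_inv, ENNReal.toReal_natCast]
  rw [ENNReal.toReal_sum fun k _ => measure_ne_top _ _, inv_mul_eq_div]
  congr 1
  refine Finset.sum_congr rfl fun k _ => ?_
  rw [Measure.dirac_apply' _ hB]
  by_cases h : s k ∈ B <;> simp [h]

theorem empirical_real_Ici_antitone (s : Fin m → ℝ) :
    Antitone fun p => (empirical s).real (Ici p) := by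
  intro p p' h
  simp only [empirical_real s measurableSet_Ici]
  refine div_le_div_of_nonneg_right (Finset.sum_le_sum fun k _ => ?_) (Nat.cast_nonneg m)
  exact indicator_le_indicator_of_subset (Ici_subset_Ici.2 h) (fun _ => zero_le_one) _

theorem empirical_real_Ici_le_one (s : Fin m → ℝ) (p : ℝ) : (empirical s).real (Ici p) ≤ 1 := by
  rcases eq_or_ne m 0 with rfl | hm
  · rw [empirical_real s measurableSet_Ici]; simp
  · have := isProbabilityMeasure_empirical hm s
    exact measureReal_le_one

/-- A positive empirical survival probability is attained at the least sample above the price. -/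
theorem exists_sample_ge (s : Fin m → ℝ) {p : ℝ} (hp : 0 < (empirical s).real (Ici p)) :
    ∃ k, p ≤ s k ∧ (empirical s).real (Ici (s k)) = (empirical s).real (Ici p) := by
  have hne : (Finset.univ.filter fun k => p ≤ s k).Nonempty := by
    by_contra hcon
    rw [Finset.not_nonempty_iff_eq_empty, Finset.filter_eq_empty_iff] at hcon
    rw [empirical_real s measurableSet_Ici, Finset.sum_eq_zero] at hp
    · simp at hp
    · intro k _
      exact indicator_of_notMem (show s k ∉ Ici p from hcon (Finset.mem_univ k)) _
  obtain ⟨k, hk, hmin⟩ := Finset.exists_min_image _ s hne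
  rw [Finset.mem_filter] at hk
  refine ⟨k, hk.2, ?_⟩
  rw [empirical_real s measurableSet_Ici, empirical_real s measurableSet_Ici]
  congr 1
  refine Finset.sum_congr rfl fun j _ => ?_
  by_cases hj : p ≤ s j
  · rw [indicator_of_mem (show s j ∈ Ici p from hj), indicator_of_mem]
    exact hmin j (Finset.mem_filter.2 ⟨Finset.mem_univ _, hj⟩)
  · rw [indicator_of_notMem (show s j ∉ Ici p from hj), indicator_of_notMem]
    exact fun h => hj (hk.2.trans h)

open Classical in
/-- The best empirical revenue is attained at a sample, or is zero. -/
theorem singleRevenue_eq (s : Fin m → ℝ) : singleRevenue s = 3 / 2 * ⨆ k,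
    if 0 ≤ s k ∧ 1 / 4 ≤ (empirical s).real (Ici (s k)) then
      s k * (empirical s).real (Ici (s k)) else 0 := by
  unfold singleRevenue
  congr 1
  have hbdd : BddAbove (range fun k => if 0 ≤ s k ∧ 1 / 4 ≤ (empirical s).real (Ici (s k)) then
      s k * (empirical s).real (Ici (s k)) else 0) := (finite_range _).bddAbove
  have hnonneg : 0 ≤ ⨆ k, if 0 ≤ s k ∧ 1 / 4 ≤ (empirical s).real (Ici (s k)) then
      s k * (empirical s).real (Ici (s k)) else 0 := Real.iSup_nonneg fun k => by
    split_ifs with h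
    · exact mul_nonneg h.1 measureReal_nonneg
    · exact le_rfl
  have hle : ∀ r ∈ {r | ∃ p : ℝ, 0 ≤ p ∧ 1 / 4 ≤ (empirical s).real (Ici p) ∧
      r = p * (empirical s).real (Ici p)}, r ≤ ⨆ k,
        if 0 ≤ s k ∧ 1 / 4 ≤ (empirical s).real (Ici (s k)) then
          s k * (empirical s).real (Ici (s k)) else 0 := by
    rintro r ⟨p, hp, hq, rfl⟩
    obtain ⟨k, hk, hkq⟩ := exists_sample_ge s (p := p) (by linarith)
    refine le_trans ?_ (le_ciSup hbdd k)
    rw [if_pos ⟨hp.trans hk, by rwa [hkq]⟩, hkq]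
    gcongr
  refine le_antisymm (Real.sSup_le hle hnonneg) (Real.iSup_le (fun k => ?_) (Real.sSup_nonneg ?_))
  · split_ifs with h
    · exact le_csSup ⟨_, hle⟩ ⟨s k, h.1, h.2, rfl⟩
    · refine Real.sSup_nonneg ?_
      rintro r ⟨p, hp, -, rfl⟩
      exact mul_nonneg hp measureReal_nonneg
  · rintro r ⟨p, hp, -, rfl⟩
    exact mul_nonneg hp measureReal_nonneg

theorem singleRevenue_nonneg (s : Fin m → ℝ) : 0 ≤ singleRevenue s := by
  refine mul_nonneg (by norm_num) (Real.sSup_nonneg ?_)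
  rintro r ⟨p, hp, -, rfl⟩
  exact mul_nonneg hp measureReal_nonneg

theorem le_singleRevenue (s : Fin m → ℝ) {p : ℝ} (hp : 0 ≤ p)
    (hq : 1 / 4 ≤ (empirical s).real (Ici p)) : 3 / 8 * p ≤ singleRevenue s := by
  classical
  obtain ⟨k, hk, hkq⟩ := exists_sample_ge s (p := p) (by linarith)
  rw [singleRevenue_eq]
  have h1 := le_ciSup (f := fun k => if 0 ≤ s k ∧ 1 / 4 ≤ (empirical s).real (Ici (s k)) then
      s k * (empirical s).real (Ici (s k)) else 0) (finite_range _).bddAbove k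
  simp only [hp.trans hk, hkq, hq, true_and, if_true] at h1
  nlinarith [mul_le_mul hk hq (by norm_num) (hp.trans hk)]

theorem singleRevenue_le (s : Fin m → ℝ) {p : ℝ} (hp : 0 ≤ p)
    (hq : (empirical s).real (Ici p) < 1 / 4) : singleRevenue s ≤ 3 / 2 * p := by
  refine mul_le_mul_of_nonneg_left (Real.sSup_le ?_ hp) (by norm_num)
  rintro r ⟨p', hp', hq', rfl⟩
  have hlt : p' < p := by
    by_contra! h
    exact absurd (hq'.trans (empirical_real_Ici_antitone s h)) (not_le.2 hq)
  calc p' * (empirical s).real (Ici p') ≤ p' * 1 := by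
        gcongr; exact empirical_real_Ici_le_one s p'
    _ ≤ p := by linarith

theorem measurable_singleRevenue : Measurable (singleRevenue : (Fin m → ℝ) → ℝ) := by
  classical
  have hq : ∀ k, Measurable fun s : Fin m → ℝ => (empirical s).real (Ici (s k)) := fun k => by
    simp_rw [empirical_real _ measurableSet_Ici]
    refine (Finset.measurable_sum _ fun j _ => ?_).div_const _
    exact Measurable.ite (measurableSet_le (measurable_pi_apply k) (measurable_pi_apply j))
      measurable_const measurable_const
  have : (singleRevenue : (Fin m → ℝ) → ℝ) = fun s => 3 / 2 * ⨆ k,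
    if 0 ≤ s k ∧ 1 / 4 ≤ (empirical s).real (Ici (s k)) then
      s k * (empirical s).real (Ici (s k)) else 0 := funext singleRevenue_eq
  rw [this]
  refine (Measurable.iSup fun k => Measurable.ite ?_ ((measurable_pi_apply k).mul (hq k))
    measurable_const).const_mul _
  exact (measurableSet_le measurable_const (measurable_pi_apply k)).inter
    (measurableSet_le measurable_const (hq k))

end SingleRevenue

/-! ### The revenue of VCG -/

section VCG

variable {ι : Type}

theorem vcgRevenue_mono [Finite ι] {w w' : ι → ℝ} (h : w ≤ w') : vcgRevenue w ≤ vcgRevenue w' := by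
  unfold vcgRevenue
  rcases isEmpty_or_nonempty {p : ι × ι // p.1 ≠ p.2} with he | hne
  · simp [Real.iSup_of_isEmpty]
  · exact ciSup_mono (finite_range _).bddAbove fun p => min_le_min (h _) (h _)

theorem vcgRevenue_nonneg {w : ι → ℝ} (h : 0 ≤ w) : 0 ≤ vcgRevenue w :=
  Real.iSup_nonneg fun _ => le_min (h _) (h _)

theorem vcgRevenue_le {w : ι → ℝ} {c : ℝ} (hc : 0 ≤ c) (h : ∀ b, w b ≤ c) : vcgRevenue w ≤ c :=
  Real.iSup_le (fun _ => (min_le_left _ _).trans (h _)) hc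

theorem le_vcgRevenue [Finite ι] {w : ι → ℝ} {t : ℝ} {b b' : ι} (hb : b ≠ b') (h : t ≤ w b)
    (h' : t ≤ w b') : t ≤ vcgRevenue w :=
  (le_min h h').trans (le_ciSup (f := fun p : {p : ι × ι // p.1 ≠ p.2} =>
    min (w p.1.1) (w p.1.2)) (finite_range _).bddAbove ⟨(b, b'), hb⟩)

theorem exists_of_le_vcgRevenue [Finite ι] {w : ι → ℝ} {t : ℝ} (ht : 0 < t) (h : t ≤ vcgRevenue w) :
    ∃ b b', b ≠ b' ∧ t ≤ w b ∧ t ≤ w b' := by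
  unfold vcgRevenue at h
  rcases isEmpty_or_nonempty {p : ι × ι // p.1 ≠ p.2} with he | hne
  · rw [Real.iSup_of_isEmpty] at h; linarith
  · obtain ⟨p, hp⟩ := exists_eq_ciSup_of_finite
      (f := fun p : {p : ι × ι // p.1 ≠ p.2} => min (w p.1.1) (w p.1.2))
    rw [← hp] at h
    exact ⟨p.1.1, p.1.2, p.2, h.trans (min_le_left _ _), h.trans (min_le_right _ _)⟩

theorem measurable_vcgRevenue [Finite ι] : Measurable (vcgRevenue : (ι → ℝ) → ℝ) := by
  have : Countable {p : ι × ι // p.1 ≠ p.2} := Finite.to_countable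
  exact Measurable.iSup fun p => (measurable_pi_apply _).min (measurable_pi_apply _)

end VCG

/-! ### The estimate of the optimal revenue -/

section Apx

variable {n : ℕ} {D : Fin n → Measure ℝ} {T : ℝ}

/-- The revenue of VCG with two copies of each bidder, the values being capped at `cap`. -/
def vcgRun (cap : ℝ) (S : Fin 2 → Fin n → ℝ) : ℝ :=
  vcgRevenue fun b : Fin n × Fin 2 => min (S b.2 b.1) cap

theorem vcgRun_mono_cap {cap cap' : ℝ} (h : cap ≤ cap') (S : Fin 2 → Fin n → ℝ) :
    vcgRun cap S ≤ vcgRun cap' S := vcgRevenue_mono fun _ => min_le_min le_rfl h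

theorem vcgRun_nonneg {cap : ℝ} (h : 0 ≤ cap) {S : Fin 2 → Fin n → ℝ} (hS : 0 ≤ S) :
    0 ≤ vcgRun cap S := vcgRevenue_nonneg fun b => le_min (hS b.2 b.1) h

theorem vcgRun_le {cap : ℝ} (h : 0 ≤ cap) (S : Fin 2 → Fin n → ℝ) : vcgRun cap S ≤ cap :=
  vcgRevenue_le h fun _ => min_le_right _ _

theorem measurable_vcgRun : Measurable fun p : ℝ × (Fin 2 → Fin n → ℝ) => vcgRun p.1 p.2 :=
  measurable_vcgRevenue.comp (measurable_pi_lambda _ fun b =>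
    Measurable.min ((measurable_pi_apply b.1).comp ((measurable_pi_apply b.2).comp measurable_snd))
      measurable_fst)

/-- The values of two different copies are independent. -/
theorem measureReal_two_ge (hD : ∀ i, IsProbabilityMeasure (D i)) (t : ℝ) {b b' : Fin 2 × Fin n}
    (hb : b ≠ b') :
    (Measure.pi fun _ : Fin 2 => Measure.pi D).real {S | t ≤ S b.1 b.2 ∧ t ≤ S b'.1 b'.2} =
      (D b.2).real (Ici t) * (D b'.2).real (Ici t) := by
  classical
  have hms : MeasurableSet {S : Fin 2 → Fin n → ℝ | t ≤ S b.1 b.2 ∧ t ≤ S b'.1 b'.2} :=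
    (measurableSet_le (f := fun _ => t) (g := fun S : Fin 2 → Fin n → ℝ => S b.1 b.2)
      measurable_const (by fun_prop)).inter
    (measurableSet_le (f := fun _ => t) (g := fun S : Fin 2 → Fin n → ℝ => S b'.1 b'.2)
      measurable_const (by fun_prop))
  rw [measureReal_def, ← (measurePreserving_curry (κ := Fin 2) D).measure_preimage
    hms.nullMeasurableSet]
  have : (MeasurableEquiv.curry (Fin 2) (Fin n) ℝ) ⁻¹'
      {S : Fin 2 → Fin n → ℝ | t ≤ S b.1 b.2 ∧ t ≤ S b'.1 b'.2} =
      univ.pi fun c => if c = b ∨ c = b' then Ici t else univ := by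
    ext f
    simp only [mem_preimage, mem_ofPred_eq, mem_pi, mem_univ, forall_true_left]
    constructor
    · rintro ⟨h, h'⟩ c
      split_ifs with hc
      · rcases hc with rfl | rfl
        exacts [h, h']
      · trivial
    · intro h
      refine ⟨?_, ?_⟩
      · simpa using h b
      · simpa using h b'
  rw [this, Measure.pi_pi]
  have h2 : ∀ c : Fin 2 × Fin n, D c.2 (if c = b ∨ c = b' then Ici t else univ) =
      if c ∈ ({b, b'} : Finset (Fin 2 × Fin n)) then D c.2 (Ici t) else 1 := fun c => by
    have := hD c.2
    simp only [Finset.mem_insert, Finset.mem_singleton]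
    split_ifs <;> simp
  simp_rw [h2]
  rw [Finset.prod_ite_mem, Finset.univ_inter, Finset.prod_pair hb, ENNReal.toReal_mul]
  rfl

/-- VCG earns at least `t` only if two of the `2 * n` independent values are at least `t`. -/
theorem measureReal_vcgRun_ge_le (hD : ∀ i, IsProbabilityMeasure (D i)) {t cap : ℝ} (ht : 0 < t) :
    (Measure.pi fun _ : Fin 2 => Measure.pi D).real {S | t ≤ vcgRun cap S} ≤
      (2 * ∑ i, (D i).real (Ici t)) ^ 2 := by
  classical
  have hsub : {S : Fin 2 → Fin n → ℝ | t ≤ vcgRun cap S} ⊆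
      ⋃ p : (Fin 2 × Fin n) × (Fin 2 × Fin n),
        {S | p.1 ≠ p.2 ∧ t ≤ S p.1.1 p.1.2 ∧ t ≤ S p.2.1 p.2.2} := by
    intro S hS
    obtain ⟨b, b', hne, h, h'⟩ := exists_of_le_vcgRevenue ht hS
    refine mem_iUnion.2 ⟨((b.2, b.1), (b'.2, b'.1)), ?_, h.trans (min_le_left _ _),
      h'.trans (min_le_left _ _)⟩
    intro heq
    simp only [Prod.mk.injEq] at heq
    exact hne (Prod.ext heq.2 heq.1)
  calc _ ≤ ∑ p : (Fin 2 × Fin n) × (Fin 2 × Fin n),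
        (D p.1.2).real (Ici t) * (D p.2.2).real (Ici t) := by
        refine ((measureReal_mono hsub).trans (measureReal_iUnion_fintype_le _)).trans
          (Finset.sum_le_sum fun p _ => ?_)
        by_cases hp : p.1 = p.2
        · simp only [hp, ne_eq, not_true_eq_false, false_and, ofPred_false, measureReal_empty]
          positivity
        · rw [← measureReal_two_ge hD t hp]
          exact measureReal_mono fun S hS => hS.2
    _ = _ := by
        rw [Fintype.sum_prod_type, sq, two_mul]
        have : ∑ b : Fin 2 × Fin n, (D b.2).real (Ici t) =
            ∑ i, (D i).real (Ici t) + ∑ i, (D i).real (Ici t) := by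
          rw [Fintype.sum_prod_type, Fin.sum_univ_two]
        rw [← this, Finset.sum_mul_sum]

theorem min_le_dyadic (z : ℝ) (J : ℕ) : min z (2 ^ (J + 1) * T) ≤ 2 * T +
    ∑ j ∈ Finset.range J, (Ici (2 ^ (j + 1) * T)).indicator (fun _ => 2 ^ (j + 1) * T) z := by
  induction J with
  | zero => simp
  | succ J ih =>
    rw [Finset.sum_range_succ, ← add_assoc]
    by_cases h : 2 ^ (J + 1) * T ≤ z
    · rw [indicator_of_mem (show z ∈ Ici _ from h)]
      rw [min_eq_right h] at ih
      have := min_le_right z (2 ^ (J + 1 + 1) * T)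
      have h2 : (2 : ℝ) ^ (J + 1 + 1) = 2 ^ (J + 1) * 2 := pow_succ _ _
      rw [h2] at this ⊢
      linarith
    · rw [indicator_of_notMem (show z ∉ Ici _ from h)]
      rw [min_eq_left (not_le.1 h).le] at ih
      have := min_le_left z (2 ^ (J + 1 + 1) * T)
      linarith

/-- The probability that VCG earns at least `t ≥ T` is of the order `(T / t) ^ 2`, so the
contributions of the dyadic levels form a geometric series, whatever the cap is. -/
theorem integral_vcgRun_le (hD : ∀ i, HasRegularTail (D i)) (hT : IsMedianMax D T) {cap : ℝ}
    (hcap : 0 ≤ cap) :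
    ∫ S, vcgRun cap S ∂(Measure.pi fun _ : Fin 2 => Measure.pi D) ≤ 18 * T := by
  have hprob := fun i => (hD i).prob
  have hTpos := hT.pos
  have hmeas : Measurable (vcgRun cap : (Fin 2 → Fin n → ℝ) → ℝ) :=
    measurable_vcgRun.comp (measurable_const.prodMk measurable_id)
  set P := Measure.pi fun _ : Fin 2 => Measure.pi D
  obtain ⟨J, hJ⟩ : ∃ J : ℕ, cap ≤ 2 ^ (J + 1) * T := by
    obtain ⟨J, hJ⟩ := pow_unbounded_of_one_lt (cap / T) (one_lt_two)
    refine ⟨J, ?_⟩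
    rw [div_lt_iff₀ hTpos] at hJ
    rw [pow_succ]
    nlinarith
  have hset : ∀ j : ℕ, MeasurableSet {S : Fin 2 → Fin n → ℝ | 2 ^ (j + 1) * T ≤ vcgRun cap S} :=
    fun j => measurableSet_le measurable_const hmeas
  have hint : ∀ j : ℕ, Integrable (fun S => (Ici (2 ^ (j + 1) * T)).indicator
      (fun _ => 2 ^ (j + 1) * T) (vcgRun cap S)) P := fun j =>
    (integrable_const (2 ^ (j + 1) * T)).indicator (hset j)
  have hterm : ∀ j : ℕ, ∫ S, (Ici (2 ^ (j + 1) * T)).indicator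
      (fun _ => 2 ^ (j + 1) * T) (vcgRun cap S) ∂P ≤ 8 * T * (1 / 2) ^ j := fun j => by
    set t := 2 ^ (j + 1) * T with ht
    have htpos : 0 < t := by positivity
    have hTt : T ≤ t := by
      have : (1 : ℝ) ≤ 2 ^ (j + 1) := one_le_pow₀ one_le_two
      nlinarith
    have h1 : ∫ S, (Ici t).indicator (fun _ => t) (vcgRun cap S) ∂P =
        P.real {S | t ≤ vcgRun cap S} * t := by
      have := integral_indicator_const (μ := P) t (hset j)
      rw [smul_eq_mul] at this
      rw [← this]; rfl
    have h2 := sum_survival_le hD hT hTt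
    have h0 : 0 ≤ ∑ j, (D j).real (Ici t) := Finset.sum_nonneg fun _ _ => measureReal_nonneg
    have h3 : t * (P.real {S | t ≤ vcgRun cap S} * t) ≤ 16 * T ^ 2 := by
      have h4 := mul_le_mul_of_nonneg_right (measureReal_vcgRun_ge_le (cap := cap) hprob htpos)
        (sq_nonneg t)
      have h5 : (t * ∑ j, (D j).real (Ici t)) ^ 2 ≤ (2 * T) ^ 2 := by gcongr
      nlinarith
    rw [h1]
    have h6 : t * (8 * T * (1 / 2) ^ j) = 16 * T ^ 2 := by
      rw [ht, pow_succ, one_div, inv_pow]; field_simp; ring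
    exact le_of_mul_le_mul_left (h3.trans h6.ge) htpos
  calc ∫ S, vcgRun cap S ∂P ≤ ∫ S, (2 * T + ∑ j ∈ Finset.range J,
        (Ici (2 ^ (j + 1) * T)).indicator (fun _ => 2 ^ (j + 1) * T) (vcgRun cap S)) ∂P := by
        by_cases hi : Integrable (vcgRun cap) P
        · refine integral_mono hi ((integrable_const _).add
            (integrable_finsetSum _ fun j _ => hint j)) fun S => ?_
          refine le_trans ?_ (min_le_dyadic (vcgRun cap S) J)
          rw [min_eq_left ((vcgRun_le hcap S).trans hJ)]
        · rw [integral_undef hi]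
          refine integral_nonneg fun S => ?_
          refine add_nonneg (by positivity) (Finset.sum_nonneg fun j _ => ?_)
          exact indicator_nonneg (fun _ _ => by positivity) _
    _ = 2 * T + ∑ j ∈ Finset.range J, ∫ S, (Ici (2 ^ (j + 1) * T)).indicator
          (fun _ => 2 ^ (j + 1) * T) (vcgRun cap S) ∂P := by
        rw [integral_add (integrable_const _) (integrable_finsetSum _ fun j _ => hint j),
          integral_finsetSum _ fun j _ => hint j]
        simp
    _ ≤ 2 * T + ∑ j ∈ Finset.range J, 8 * T * (1 / 2) ^ j := by
        gcongr with j _; exact hterm j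
    _ ≤ 2 * T + 8 * T * 2 := by
        rw [← Finset.mul_sum]
        gcongr
        have := Summable.sum_le_tsum (Finset.range J) (fun i _ => by positivity)
          (summable_geometric_two)
        rwa [tsum_geometric_two] at this
    _ = 18 * T := by ring

end Apx

/-! ### Accuracy of the estimates -/

section Accuracy

variable {n m : ℕ} {D : Fin n → Measure ℝ} {T : ℝ}

theorem measureReal_preimage_le {α β : Type*} [MeasurableSpace α] [MeasurableSpace β]
    {μ : Measure α} {ν : Measure β} [IsFiniteMeasure ν] {f : α → β} (hf : MeasurePreserving f μ ν)
    (s : Set β) : μ.real (f ⁻¹' s) ≤ ν.real s := by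
  rw [measureReal_def, measureReal_def]
  refine ENNReal.toReal_mono (measure_ne_top _ _) ?_
  conv_rhs => rw [← hf.map_eq]
  exact Measure.le_map_apply hf.measurable.aemeasurable s

/-- The sum of the single-bidder estimates. -/
def crudeRevenue (S : Fin m → Fin n → ℝ) : ℝ := ∑ i, singleRevenue fun k => S k i

theorem integral_indicator_eval (hD : ∀ i, IsProbabilityMeasure (D i)) (i : Fin n) (t : ℝ) :
    ∫ v, (Ici t).indicator (fun _ => (1 : ℝ)) (v i) ∂Measure.pi D = (D i).real (Ici t) := by
  have h := integral_map (μ := Measure.pi D) (φ := fun v : Fin n → ℝ => v i)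
    (f := (Ici t).indicator fun _ => (1 : ℝ)) (measurable_pi_apply i).aemeasurable
    (measurable_const.indicator measurableSet_Ici).aestronglyMeasurable
  rw [← h, (measurePreserving_eval D i).map_eq, integral_indicator_const _ measurableSet_Ici,
    smul_eq_mul, mul_one]

/-- The Chernoff bound for the fraction of the samples that accept a price. -/
theorem chernoff_empirical (hD : ∀ i, IsProbabilityMeasure (D i)) (i : Fin n) (t : ℝ) {l : ℝ}
    (hl : |l| ≤ 1) (a : ℝ) (hm : m ≠ 0) :
    (Measure.pi fun _ : Fin m => Measure.pi D).real
      {S | a ≤ l * (empirical fun k => S k i).real (Ici t)} ≤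
      Real.exp (m * ((l + l ^ 2) * (D i).real (Ici t) - a)) := by
  have hmpos : (0 : ℝ) < m := by positivity
  have h := chernoff (μ := Measure.pi D) (κ := Fin m)
    (f := fun v => (Ici t).indicator (fun _ => (1 : ℝ)) (v i))
    ((measurable_const.indicator measurableSet_Ici).comp (measurable_pi_apply i))
    (fun v => indicator_nonneg (fun _ _ => zero_le_one) _)
    (fun v => indicator_le_self' (fun _ _ => zero_le_one) _) hl (m * a)
  rw [integral_indicator_eval hD, Fintype.card_fin, ← mul_sub] at h
  refine le_trans (measureReal_mono fun S hS => ?_) h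
  simp only [mem_ofPred_eq] at hS ⊢
  rw [empirical_real _ measurableSet_Ici, ← mul_div_assoc, le_div_iff₀ hmpos] at hS
  linarith

/-- The median of a single value is at least the revenue from a price `T` above it: raising the
price from the median `s` to `T` at most doubles the revenue `s / 2`. -/
theorem exists_median {E : Measure ℝ} (hE : HasRegularTail E) (hT : 0 ≤ T)
    (hq : E.real (Ici T) ≤ 1 / 2) :
    ∃ s, 0 ≤ s ∧ E.real (Ici s) = 1 / 2 ∧ T * E.real (Ici T) ≤ s := by
  obtain ⟨s, ⟨hs0, hsT⟩, hs⟩ := intermediate_value_Icc' hT hE.continuous_survival.continuousOn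
    (show (1 / 2 : ℝ) ∈ Icc (E.real (Ici T)) (E.real (Ici 0)) from
      ⟨hq, by rw [hE.survival_zero]; norm_num⟩)
  have hs' : E.real (Ici s) = 1 / 2 := hs
  refine ⟨s, hs0, hs', ?_⟩
  have := hE.mul_survival_le hs0 hsT hs'.le
  rw [hs'] at this
  linarith

theorem IsMedianMax.half_le_sum (hT : IsMedianMax D T) (hD : ∀ i, HasRegularTail (D i)) :
    1 / 2 ≤ ∑ i, (D i).real (Ici T) := by
  have := fun i => (hD i).prob
  have h1 := measureReal_exists_ge hD T
  rw [hT.prod_eq] at h1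
  calc (1 / 2 : ℝ) = (Measure.pi D).real (⋃ i, {v | T ≤ v i}) := by
        rw [show (⋃ i, {v : Fin n → ℝ | T ≤ v i}) = {v | ∃ i, T ≤ v i} by ext; simp, h1]; norm_num
    _ ≤ ∑ i, (Measure.pi D).real {v | T ≤ v i} := measureReal_iUnion_fintype_le _
    _ = ∑ i, (D i).real (Ici T) := Finset.sum_congr rfl fun i _ => by
        rw [measureReal_def, measureReal_def, ← (measurePreserving_eval D i).measure_preimage
          measurableSet_Ici.nullMeasurableSet]
        rfl

/-- The crude estimate is between `3 / 16 * T` and `48 * n * T` with high probability: at least a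
quarter of the samples accepts the median, and at most a quarter accepts `32 * T`. -/
theorem crudeRevenue_bad_le (hD : ∀ i, HasRegularTail (D i)) (hT : IsMedianMax D T) (hm : m ≠ 0) :
    (Measure.pi fun _ : Fin m => Measure.pi D).real
      {S | ¬(3 / 16 * T ≤ crudeRevenue S ∧ crudeRevenue S ≤ 48 * n * T)} ≤
      2 * n * Real.exp (-(m / 32)) := by
  have hprob := fun i => (hD i).prob
  have hTpos := hT.pos
  choose s hs0 hs hsT using fun i => exists_median (hD i) hTpos.le (hT.survival_le_half hD i)
  set P := Measure.pi fun _ : Fin m => Measure.pi D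
  have hsum : T / 2 ≤ ∑ i, s i := by
    have h1 : T * ∑ i, (D i).real (Ici T) ≤ ∑ i, s i := by
      rw [Finset.mul_sum]; exact Finset.sum_le_sum fun i _ => hsT i
    nlinarith [hT.half_le_sum hD]
  have hlow : ∀ i, P.real {S | (empirical fun k => S k i).real (Ici (s i)) < 1 / 4} ≤
      Real.exp (-(m / 32)) := fun i => by
    have h := chernoff_empirical (m := m) hprob i (s i) (l := -1 / 4)
      (by rw [abs_le]; constructor <;> norm_num) (-1 / 16) hm
    rw [hs i] at h
    refine (measureReal_mono fun S hS => ?_).trans (h.trans (Real.exp_le_exp.2 ?_))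
    · simp only [mem_ofPred_eq] at hS ⊢; linarith
    · norm_num; linarith
  have hhigh : ∀ i, P.real {S | 1 / 4 ≤ (empirical fun k => S k i).real (Ici (32 * T))} ≤
      Real.exp (-(m / 32)) := fun i => by
    have h := chernoff_empirical (m := m) hprob i (32 * T) (l := 1) (by simp) (1 / 4) hm
    have hq : (D i).real (Ici (32 * T)) ≤ 1 / 32 := by
      have h1 := (hD i).mul_survival_le hTpos.le (by linarith : T ≤ 32 * T)
        (hT.survival_le_half hD i)
      have h2 := hT.survival_le_half hD i
      nlinarith
    refine (measureReal_mono fun S hS => ?_).trans (h.trans (Real.exp_le_exp.2 ?_))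
    · simp only [mem_ofPred_eq] at hS ⊢; linarith
    · have hm0 : (0 : ℝ) ≤ m := Nat.cast_nonneg m
      nlinarith
  calc _ ≤ P.real (⋃ i, ({S | (empirical fun k => S k i).real (Ici (s i)) < 1 / 4} ∪
        {S | 1 / 4 ≤ (empirical fun k => S k i).real (Ici (32 * T))})) := by
        refine measureReal_mono fun S hS => ?_
        by_contra hcon
        simp only [mem_iUnion, mem_union, mem_ofPred_eq, not_exists, not_or, not_lt, not_le] at hcon
        refine hS ⟨?_, ?_⟩
        · calc 3 / 16 * T ≤ ∑ i, 3 / 8 * s i := by rw [← Finset.mul_sum]; linarith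
            _ ≤ crudeRevenue S := Finset.sum_le_sum fun i _ => le_singleRevenue _ (hs0 i) (hcon i).1
        · calc crudeRevenue S ≤ ∑ _i : Fin n, 3 / 2 * (32 * T) :=
                Finset.sum_le_sum fun i _ => singleRevenue_le _ (by linarith) (hcon i).2
            _ = 48 * n * T := by simp; ring
    _ ≤ ∑ _i : Fin n, (Real.exp (-(m / 32)) + Real.exp (-(m / 32))) :=
        (measureReal_iUnion_fintype_le _).trans (Finset.sum_le_sum fun i _ =>
          (measureReal_union_le _ _).trans (add_le_add (hlow i) (hhigh i)))
    _ = _ := by simp; ring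

/-- The average revenue of `m` runs of VCG with two copies of each bidder. -/
def averageVCG (cap : ℝ) (S : Fin m × Fin 2 → Fin n → ℝ) : ℝ :=
  (∑ k, vcgRun cap fun c => S (k, c)) / m

theorem averageVCG_mono_cap {cap cap' : ℝ} (h : cap ≤ cap') (S : Fin m × Fin 2 → Fin n → ℝ) :
    averageVCG cap S ≤ averageVCG cap' S :=
  div_le_div_of_nonneg_right (Finset.sum_le_sum fun _ _ => vcgRun_mono_cap h _) (Nat.cast_nonneg m)

theorem averageVCG_nonneg {cap : ℝ} (h : 0 ≤ cap) {S : Fin m × Fin 2 → Fin n → ℝ} (hS : 0 ≤ S) :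
    0 ≤ averageVCG cap S :=
  div_nonneg (Finset.sum_nonneg fun _ _ => vcgRun_nonneg h fun _ _ => hS _ _) (Nat.cast_nonneg m)

/-- With probability `1 / 4`, a bidder of either copy has a value of at least `T`; then VCG earns
at least `T`. -/
theorem averageVCG_lt_le (hD : ∀ i, HasRegularTail (D i)) (hT : IsMedianMax D T) (hm : m ≠ 0) :
    (Measure.pi fun _ : Fin m × Fin 2 => Measure.pi D).real
      {S | 0 ≤ S ∧ averageVCG T S < T / 8} ≤ Real.exp (-(m / 64)) := by
  have hprob := fun i => (hD i).prob
  have hTpos := hT.pos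
  have hmpos : (0 : ℝ) < m := by positivity
  set B : Set (Fin n → ℝ) := {v | ∃ i, T ≤ v i} with hB
  have hBm : MeasurableSet B := by
    have : B = ⋃ i, {v | T ≤ v i} := by ext; simp [hB]
    rw [this]
    exact MeasurableSet.iUnion fun i => measurableSet_le measurable_const (measurable_pi_apply i)
  have hindm : Measurable (B.indicator fun _ => (1 : ℝ)) := measurable_const.indicator hBm
  set f : (Fin 2 → Fin n → ℝ) → ℝ := fun S => ∏ c, B.indicator (fun _ => (1 : ℝ)) (S c) with hf
  have hind0 : ∀ v, 0 ≤ B.indicator (fun _ => (1 : ℝ)) v := fun v =>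
    indicator_nonneg (fun _ _ => zero_le_one) _
  have hind1 : ∀ v, B.indicator (fun _ => (1 : ℝ)) v ≤ 1 := fun v =>
    indicator_le_self' (fun _ _ => zero_le_one) _
  have hmean : ∫ S, f S ∂(Measure.pi fun _ : Fin 2 => Measure.pi D) = 1 / 4 := by
    rw [hf, integral_fintype_prod_eq_pow (B.indicator fun _ => (1 : ℝ)),
      integral_indicator_const _ hBm, hB, measureReal_exists_ge hD T, hT.prod_eq]
    simp; norm_num
  have h := chernoff (μ := Measure.pi fun _ : Fin 2 => Measure.pi D) (κ := Fin m) (f := f)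
    (Finset.measurable_prod _ fun c _ => hindm.comp (measurable_pi_apply c))
    (fun S => Finset.prod_nonneg fun c _ => hind0 _)
    (fun S => Finset.prod_le_one (fun c _ => hind0 _) fun c _ => hind1 _) (l := -1 / 4)
    (by rw [abs_le]; constructor <;> norm_num) (-(m / 32))
  rw [hmean, Fintype.card_fin] at h
  refine le_trans (measureReal_mono fun S hS => ?_) ((measureReal_preimage_le
    (measurePreserving_curry (κ := Fin m) fun _ : Fin 2 => Measure.pi D) _).trans (h.trans
      (Real.exp_le_exp.2 (by linarith))))
  obtain ⟨hS0, hS⟩ := hS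
  simp only [mem_preimage, mem_ofPred_eq]
  have hge : ∀ k, T * f (fun c => S (k, c)) ≤ vcgRun T fun c => S (k, c) := fun k => by
    by_cases hin : S (k, 0) ∈ B ∧ S (k, 1) ∈ B
    · obtain ⟨⟨i, hi⟩, ⟨i', hi'⟩⟩ := hin
      have h1 : f (fun c => S (k, c)) ≤ 1 :=
        Finset.prod_le_one (fun c _ => hind0 _) fun c _ => hind1 _
      refine le_trans (by nlinarith) (le_vcgRevenue (t := T) (b := (i, 0)) (b' := (i', 1)) (by simp)
        (le_min hi le_rfl) (le_min hi' le_rfl))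
    · have h1 : f (fun c => S (k, c)) = 0 := by
        simp only [hf, Fin.prod_univ_two]
        rw [not_and_or] at hin
        rcases hin with hin | hin
        · rw [indicator_of_notMem hin, zero_mul]
        · rw [indicator_of_notMem hin, mul_zero]
      rw [h1, mul_zero]
      exact vcgRun_nonneg hTpos.le fun c i => hS0 (k, c) i
  have h2 : T * ∑ k, f (fun c => S (k, c)) < T * (m / 8) := by
    rw [Finset.mul_sum]
    unfold averageVCG at hS
    rw [div_lt_iff₀ hmpos] at hS
    linarith [Finset.sum_le_sum fun k (_ : k ∈ Finset.univ) => hge k]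
  have h3 := lt_of_mul_lt_mul_left h2 hTpos.le
  change -((m : ℝ) / 32) ≤ -1 / 4 * ∑ k, f (fun c => S (k, c))
  linarith

/-- The revenue of a run is at most `cap`, and at most `18 * T` on average; the Chernoff bound then
holds with the number of runs scaled by `T / cap`. -/
theorem lt_averageVCG_le (hD : ∀ i, HasRegularTail (D i)) (hT : IsMedianMax D T) (hm : m ≠ 0)
    {cap : ℝ} (hcap : 0 < cap) :
    (Measure.pi fun _ : Fin m × Fin 2 => Measure.pi D).real
      {S | 0 ≤ S ∧ 132 * T < averageVCG cap S} ≤ Real.exp (-(96 * m * T / cap)) := by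
  have hprob := fun i => (hD i).prob
  have hmpos : (0 : ℝ) < m := by positivity
  -- negative values, which have probability zero, are replaced by zero
  set g : (Fin 2 → Fin n → ℝ) → ℝ := fun S => max (vcgRun cap S / cap) 0 with hg
  have hmeas : Measurable (vcgRun cap : (Fin 2 → Fin n → ℝ) → ℝ) :=
    measurable_vcgRun.comp (measurable_const.prodMk measurable_id)
  have hg1 : ∀ S, g S ≤ 1 := fun S =>
    max_le ((div_le_one hcap).2 (vcgRun_le hcap.le S)) zero_le_one
  have hmean : ∫ S, g S ∂(Measure.pi fun _ : Fin 2 => Measure.pi D) ≤ 18 * T / cap := by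
    have h1 : g =ᵐ[Measure.pi fun _ : Fin 2 => Measure.pi D] fun S => vcgRun cap S / cap := by
      have : ∀ c : Fin 2, ∀ᵐ S ∂(Measure.pi fun _ : Fin 2 => Measure.pi D), 0 ≤ S c := fun c =>
        (measurePreserving_eval (fun _ : Fin 2 => Measure.pi D) c).quasiMeasurePreserving.ae
          (ae_pi_nonneg hD)
      filter_upwards [ae_all_iff.2 this] with S hS
      exact max_eq_left (div_nonneg (vcgRun_nonneg hcap.le hS) hcap.le)
    rw [integral_congr_ae h1, integral_div]
    exact div_le_div_of_nonneg_right (integral_vcgRun_le hD hT hcap.le) hcap.le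
  have h := chernoff (μ := Measure.pi fun _ : Fin 2 => Measure.pi D) (κ := Fin m) (f := g)
    ((hmeas.div_const _).max measurable_const) (fun S => le_max_right _ _) hg1 (l := 1)
    (by simp) (132 * m * T / cap)
  rw [Fintype.card_fin] at h
  refine le_trans (measureReal_mono fun S hS => ?_) ((measureReal_preimage_le
    (measurePreserving_curry (κ := Fin m) fun _ : Fin 2 => Measure.pi D) _).trans (h.trans
      (Real.exp_le_exp.2 ?_)))
  · obtain ⟨-, hS⟩ := hS
    simp only [mem_preimage, mem_ofPred_eq]
    change _ ≤ 1 * ∑ k, g (fun c => S (k, c))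
    unfold averageVCG at hS
    rw [lt_div_iff₀ hmpos] at hS
    calc 132 * m * T / cap ≤ (∑ k, vcgRun cap fun c => S (k, c)) / cap :=
          div_le_div_of_nonneg_right (by linarith) hcap.le
      _ = ∑ k, (vcgRun cap fun c => S (k, c)) / cap := Finset.sum_div _ _ _
      _ ≤ 1 * ∑ k, g (fun c => S (k, c)) := by
          rw [one_mul]; exact Finset.sum_le_sum fun k _ => le_max_left _ _
  · have h1 : m * ((1 + 1 ^ 2) * ∫ S, g S ∂(Measure.pi fun _ : Fin 2 => Measure.pi D)) ≤
        m * ((1 + 1 ^ 2) * (18 * T / cap)) := by gcongr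
    have h2 : m * ((1 + 1 ^ 2) * (18 * T / cap)) - 132 * m * T / cap = -(96 * m * T / cap) := by
      ring
    linarith

/-- If the crude estimate is correct up to the factor `n`, then the second estimate is correct up to
a constant factor. -/
theorem apx_bounds_of {ε : ℝ} {m₀ m₁ : ℕ} (hε : 0 < ε) (hε0 : ε ≤ 3 / 16)
    {S₀ : Fin m₀ → Fin n → ℝ} {S₁ : Fin m₁ × Fin 2 → Fin n → ℝ} (hTpos : 0 < T)
    (h0 : 3 / 16 * T ≤ crudeRevenue S₀ ∧ crudeRevenue S₀ ≤ 48 * n * T)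
    (h1 : T / 8 ≤ averageVCG T S₁) (h2 : averageVCG (48 * n * T / ε) S₁ ≤ 132 * T) :
    T / 8 ≤ averageVCG (crudeRevenue S₀ / ε) S₁ ∧
      averageVCG (crudeRevenue S₀ / ε) S₁ ≤ 132 * T := by
  refine ⟨h1.trans (averageVCG_mono_cap ?_ _), (averageVCG_mono_cap ?_ _).trans h2⟩
  · rw [le_div_iff₀ hε]; nlinarith
  · exact div_le_div_of_nonneg_right h0.2 hε.le

end Accuracy

/-! ### Scaling and measurability in the samples -/

section Scaling

variable {n m : ℕ} {A : ℝ}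

/-- `E'` is the distribution of `A` times a variable with distribution `E`, as far as survival
probabilities are concerned. -/
structure IsScaled (A : ℝ) (E E' : Measure ℝ) : Prop where
  Ici_eq : ∀ v, E'.real (Ici (A * v)) = E.real (Ici v)
  Ioi_eq : ∀ v, E'.real (Ioi (A * v)) = E.real (Ioi v)

theorem isScaled_empirical (hA : 0 < A) (s : Fin m → ℝ) :
    IsScaled A (empirical s) (empirical fun k => A * s k) where
  Ici_eq v := by
    rw [empirical_real _ measurableSet_Ici, empirical_real _ measurableSet_Ici]
    congr 1
    refine Finset.sum_congr rfl fun k _ => ?_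
    by_cases h : v ≤ s k
    · rw [indicator_of_mem (show s k ∈ Ici v from h), indicator_of_mem]
      exact mul_le_mul_of_nonneg_left h hA.le
    · rw [indicator_of_notMem (show s k ∉ Ici v from h), indicator_of_notMem]
      exact fun h' => h (le_of_mul_le_mul_left h' hA)
  Ioi_eq v := by
    rw [empirical_real _ measurableSet_Ioi, empirical_real _ measurableSet_Ioi]
    congr 1
    refine Finset.sum_congr rfl fun k _ => ?_
    by_cases h : v < s k
    · rw [indicator_of_mem (show s k ∈ Ioi v from h), indicator_of_mem]
      exact mul_lt_mul_of_pos_left h hA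
    · rw [indicator_of_notMem (show s k ∉ Ioi v from h), indicator_of_notMem]
      exact fun h' => h (lt_of_mul_lt_mul_left h' hA.le)

theorem IsScaled.ironedRevenue_eq {E E' : Measure ℝ} (h : IsScaled A E E') (hA : 0 < A) (q : ℝ) :
    ironedRevenue E' q = A * ironedRevenue E q := by
  unfold ironedRevenue
  rw [← smul_eq_mul, ← Real.sInf_smul_of_nonneg hA.le]
  congr 1
  ext y
  rw [mem_smul_set]
  constructor
  · rintro ⟨a, b, hab, rfl⟩
    refine ⟨a / A + b / A * q, ⟨a / A, b / A, fun v hv => ?_, rfl⟩, ?_⟩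
    · have := hab (A * v) (mul_nonneg hA.le hv)
      rw [h.Ici_eq] at this
      rw [div_mul_eq_mul_div, ← add_div, le_div_iff₀ hA]
      linarith
    · rw [smul_eq_mul]; field_simp
  · rintro ⟨_, ⟨a, b, hab, rfl⟩, rfl⟩
    refine ⟨A * a, A * b, fun v hv => ?_, by rw [smul_eq_mul]; ring⟩
    have := hab (v / A) (div_nonneg hv hA.le)
    rw [← h.Ici_eq, mul_div_cancel₀ _ hA.ne'] at this
    have h2 := mul_le_mul_of_nonneg_left this hA.le
    have h3 : A * (v / A * E'.real (Ici v)) = v * E'.real (Ici v) := by field_simp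
    linarith

/-- Multiplication by a positive number, as an order automorphism of the extended reals. -/
def scaleEReal (hA : 0 < A) : EReal ≃o EReal where
  toFun x := (A : EReal) * x
  invFun x := ((A⁻¹ : ℝ) : EReal) * x
  left_inv x := by
    change ((A⁻¹ : ℝ) : EReal) * ((A : EReal) * x) = x
    rw [← mul_assoc, ← EReal.coe_mul, inv_mul_cancel₀ hA.ne', EReal.coe_one, one_mul]
  right_inv x := by
    change (A : EReal) * (((A⁻¹ : ℝ) : EReal) * x) = x
    rw [← mul_assoc, ← EReal.coe_mul, mul_inv_cancel₀ hA.ne', EReal.coe_one, one_mul]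
  map_rel_iff' {x y} := by
    have key : ∀ {c : ℝ}, 0 < c → ∀ {x y : EReal}, x ≤ y → (c : EReal) * x ≤ c * y :=
      fun hc _ _ h => mul_le_mul_of_nonneg_left h (by exact_mod_cast hc.le)
    refine ⟨fun h => ?_, key hA⟩
    have := key (inv_pos.2 hA) h
    simpa only [Equiv.coe_fn_mk, ← mul_assoc, ← EReal.coe_mul, inv_mul_cancel₀ hA.ne',
      EReal.coe_one, one_mul] using this

theorem scaleEReal_apply (hA : 0 < A) (x : EReal) : scaleEReal hA x = (A : EReal) * x := rfl

theorem IsScaled.ironedVirtualValue_eq {E E' : Measure ℝ} (h : IsScaled A E E') (hA : 0 < A)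
    (v : ℝ) : ironedVirtualValue E' (A * v) = scaleEReal hA (ironedVirtualValue E v) := by
  unfold ironedVirtualValue
  rw [h.Ioi_eq]
  simp_rw [OrderIso.map_iSup]
  congr 1; ext q; congr 1; ext hq
  simp only [h.ironedRevenue_eq hA]
  rw [scaleEReal_apply, ← EReal.coe_mul, ← mul_sub, mul_div_assoc]

variable (τ : Equiv.Perm (Fin n))

theorem myersonWins_scaled {E E' : Fin n → Measure ℝ} (hA : 0 < A)
    (h : ∀ i, IsScaled A (E i) (E' i)) (v : Fin n → ℝ) (i : Fin n) :
    MyersonWins τ E' (fun j => A * v j) i ↔ MyersonWins τ E v i := by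
  unfold MyersonWins
  have h0 : (0 : EReal) = scaleEReal hA 0 := by rw [scaleEReal_apply, mul_zero]
  simp only [fun j => (h j).ironedVirtualValue_eq hA]
  conv_lhs => rw [h0]
  simp only [OrderIso.le_iff_le, OrderIso.lt_iff_lt, EmbeddingLike.apply_eq_iff_eq]

theorem myerson_pay_scaled {E E' : Fin n → Measure ℝ} (hA : 0 < A)
    (h : ∀ i, IsScaled A (E i) (E' i)) (v : Fin n → ℝ) (i : Fin n) :
    (myerson τ E').pay (fun j => A * v j) i = A * (myerson τ E).pay v i := by
  have hupd : ∀ p, Function.update (fun j => A * v j) i (A * p) =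
      fun j => A * Function.update v i p j := fun p => by
    ext j
    by_cases hj : j = i
    · subst hj; simp
    · simp [hj]
  by_cases hwin : MyersonWins τ E v i
  · simp only [myerson, (myersonWins_scaled τ hA h v i).2 hwin, hwin, if_true]
    rw [← smul_eq_mul, ← Real.sInf_smul_of_nonneg hA.le]
    congr 1
    ext p
    rw [mem_smul_set]
    constructor
    · rintro ⟨hp, hw⟩
      refine ⟨p / A, ⟨div_nonneg hp hA.le, ?_⟩, by rw [smul_eq_mul]; field_simp⟩
      rwa [← myersonWins_scaled τ hA h, ← hupd, mul_div_cancel₀ _ hA.ne']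
    · rintro ⟨p, ⟨hp, hw⟩, rfl⟩
      refine ⟨mul_nonneg hA.le hp, ?_⟩
      rwa [smul_eq_mul, hupd, myersonWins_scaled τ hA h]
  · have hwin' := mt (myersonWins_scaled τ hA h v i).1 hwin
    simp only [myerson, hwin, hwin', if_false, mul_zero]

theorem mem_valueGrid_scaled {ε : ℝ} (hA : 0 < A) (w : ℝ) :
    A * w ∈ valueGrid ε A ↔ w ∈ valueGrid ε 1 := by
  simp [valueGrid, hA.ne', mul_comm]

theorem roundDown_scaled {ε : ℝ} (hA : 0 < A) (x : ℝ) :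
    roundDown (valueGrid ε A) x = A * roundDown (valueGrid ε 1) (x / A) := by
  unfold roundDown
  rw [← smul_eq_mul A, ← Real.sSup_smul_of_nonneg hA.le]
  congr 1
  ext w
  rw [mem_smul_set]
  constructor
  · rintro ⟨hw, hwx⟩
    refine ⟨w / A, ⟨?_, by gcongr⟩, by rw [smul_eq_mul]; field_simp⟩
    rwa [← mem_valueGrid_scaled hA, mul_div_cancel₀ _ hA.ne']
  · rintro ⟨w, ⟨hw, hwx⟩, rfl⟩
    refine ⟨(mem_valueGrid_scaled hA w).2 hw, ?_⟩
    rw [smul_eq_mul]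
    rwa [le_div_iff₀' hA] at hwx

/-- The revenue of the auction for the samples `S`, with the grid of scale `A`, on the profile
`v`. -/
def samplePay (ε A : ℝ) (S : Fin m → Fin n → ℝ) (v : Fin n → ℝ) : ℝ :=
  ∑ i, (roundedMyerson τ (valueGrid ε A)
    fun i => empirical fun k => roundDown (valueGrid ε A) (S k i)).pay v i

/-- The auction depends on the samples and the reports only through their rounded ratios to the
scale, of which there are finitely many. -/
theorem samplePay_scaled {ε : ℝ} (hA : 0 < A) (S : Fin m → Fin n → ℝ) (v : Fin n → ℝ) :
    samplePay τ ε A S v = A * ∑ i, (myerson τ fun i => empirical fun k =>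
      roundDown (valueGrid ε 1) (S k i / A)).pay
        (fun i => roundDown (valueGrid ε 1) (v i / A)) i := by
  unfold samplePay
  rw [Finset.mul_sum]
  refine Finset.sum_congr rfl fun i _ => ?_
  have : roundProfile (valueGrid ε A) v = fun i => A * roundDown (valueGrid ε 1) (v i / A) :=
    funext fun i => roundDown_scaled hA _
  simp only [roundedMyerson, this]
  refine myerson_pay_scaled τ hA (fun i => ?_) _ i
  simp_rw [roundDown_scaled hA]
  exact isScaled_empirical hA _

theorem samplePay_nonneg (ε A : ℝ) (S : Fin m → Fin n → ℝ) (v : Fin n → ℝ) :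
    0 ≤ samplePay τ ε A S v :=
  Finset.sum_nonneg fun i _ => roundedMyerson_pay_nonneg τ v i

theorem samplePay_zero {ε : ℝ} (hε : 0 < ε) (hε1 : ε < 1) (S : Fin m → Fin n → ℝ) (v : Fin n → ℝ) :
    samplePay τ ε 0 S v = 0 := by
  refine le_antisymm ?_ (samplePay_nonneg τ ε 0 S v)
  exact roundedMyerson_sum_pay_le τ (isGrid_valueGrid hε hε1 le_rfl)
    (fun w hw => (le_of_mem_valueGrid hε hε1 le_rfl hw).trans (by simp)) v

theorem measurable_samplePay {ε : ℝ} (hε : 0 < ε) (hε1 : ε < 1) :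
    Measurable fun p : (ℝ × (Fin m → Fin n → ℝ)) × (Fin n → ℝ) =>
      samplePay τ ε (max p.1.1 0) p.1.2 p.2 := by
  have hV := isGrid_valueGrid hε hε1 (zero_le_one' ℝ)
  let κ := (Fin m × Fin n) ⊕ Fin n
  -- the profile of all samples and reports, in units of the scale
  let x : (ℝ × (Fin m → Fin n → ℝ)) × (Fin n → ℝ) → κ → ℝ := fun p =>
    Sum.elim (fun c => p.1.2 c.1 c.2 / p.1.1) fun i => p.2 i / p.1.1
  have hx : Measurable x := by
    refine measurable_pi_lambda _ fun c => ?_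
    rcases c with c | i
    · change Measurable fun p : (ℝ × (Fin m → Fin n → ℝ)) × (Fin n → ℝ) => p.1.2 c.1 c.2 / p.1.1
      fun_prop
    · change Measurable fun p : (ℝ × (Fin m → Fin n → ℝ)) × (Fin n → ℝ) => p.2 i / p.1.1
      fun_prop
  have hr : Measurable fun p => roundProfile (valueGrid ε 1) (x p) :=
    (measurable_roundProfile hV).comp hx
  have hc : (range fun p => roundProfile (valueGrid ε 1) (x p)).Countable :=
    (range_roundProfile_countable (ι := κ) hV).mono
      (range_comp_subset_range x (roundProfile (valueGrid ε 1)))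
  have hh := measurable_comp_of_countable_range hr hc fun w : κ → ℝ =>
    ∑ i, (myerson τ fun i => empirical fun k => w (Sum.inl (k, i))).pay (fun i => w (Sum.inr i)) i
  have hA : MeasurableSet {p : (ℝ × (Fin m → Fin n → ℝ)) × (Fin n → ℝ) | 0 < p.1.1} :=
    measurableSet_lt measurable_const (by fun_prop)
  have := ((measurable_fst.comp measurable_fst).mul hh).indicator hA
  convert this using 2 with p
  by_cases h : 0 < p.1.1
  · rw [max_eq_left h.le, samplePay_scaled τ h, indicator_of_mem (by exact h)]
    rfl
  · rw [max_eq_right (not_lt.1 h), samplePay_zero τ hε hε1, indicator_of_notMem (by exact h)]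

theorem measurable_integral_samplePay {ε : ℝ} (hε : 0 < ε) (hε1 : ε < 1) (D : Fin n → Measure ℝ)
    [∀ i, IsProbabilityMeasure (D i)] :
    Measurable fun p : ℝ × (Fin m → Fin n → ℝ) =>
      ∫ v, samplePay τ ε (max p.1 0) p.2 v ∂Measure.pi D :=
  ((measurable_samplePay τ hε hε1).stronglyMeasurable.integral_prod_right
    (ν := Measure.pi D)).measurable

theorem measurable_crudeRevenue : Measurable (crudeRevenue : (Fin m → Fin n → ℝ) → ℝ) :=
  Finset.measurable_sum _ fun i _ => measurable_singleRevenue.comp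
    (measurable_pi_lambda _ fun k => by fun_prop)

theorem measurable_averageVCG {α : Type*} [MeasurableSpace α] {f : α → ℝ}
    {g : α → Fin m × Fin 2 → Fin n → ℝ} (hf : Measurable f) (hg : Measurable g) :
    Measurable fun z => averageVCG (f z) (g z) := by
  refine Measurable.div_const (Finset.measurable_sum _ fun k _ => ?_) _
  have : Measurable fun z => (f z, fun c => g z (k, c)) := by fun_prop
  exact measurable_vcgRun.comp this

end Scaling

/-! ### The guarantee of the algorithm -/

section Guarantee

variable {n m₀ m₁ m₂ : ℕ} {D : Fin n → Measure ℝ} {T ε : ℝ} (τ : Equiv.Perm (Fin n))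

/-- The samples of the three phases. -/
def splitSamples {X : Type*} (S : SampleIdx m₀ m₁ m₂ → X) :
    ((Fin m₀ → X) × (Fin m₁ × Fin 2 → X)) × (Fin m₂ → X) :=
  ((fun k => S (Sum.inl k), fun k => S (Sum.inr (Sum.inl k))), fun k => S (Sum.inr (Sum.inr k)))

theorem measurePreserving_splitSamples (D : Fin n → Measure ℝ)
    [∀ i, IsProbabilityMeasure (D i)] :
    MeasurePreserving (splitSamples : (SampleIdx m₀ m₁ m₂ → Fin n → ℝ) → _)
      (sampleLaw (SampleIdx m₀ m₁ m₂) D)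
      (((Measure.pi fun _ => Measure.pi D).prod (Measure.pi fun _ => Measure.pi D)).prod
        (Measure.pi fun _ => Measure.pi D)) := by
  have h1 := measurePreserving_sumPiEquivProdPi
    (fun _ : Fin m₀ ⊕ (Fin m₁ × Fin 2) ⊕ Fin m₂ => Measure.pi D)
  have h2 := measurePreserving_sumPiEquivProdPi
    (fun _ : (Fin m₁ × Fin 2) ⊕ Fin m₂ => Measure.pi D)
  have h3 := (MeasurePreserving.id (Measure.pi fun _ : Fin m₀ => Measure.pi D)).prod h2
  exact (measurePreserving_prodAssoc _ _ _).symm.comp (h3.comp h1)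

/-- The auction run with the samples `z` of the three phases earns this in expectation, if the
estimate of the optimal revenue is non-negative. -/
def sampleRev (D : Fin n → Measure ℝ) (ε : ℝ)
    (z : ((Fin m₀ → Fin n → ℝ) × (Fin m₁ × Fin 2 → Fin n → ℝ)) × (Fin m₂ → Fin n → ℝ)) : ℝ :=
  ∫ v, samplePay τ ε (max (averageVCG (crudeRevenue z.1.1 / ε) z.1.2) 0) z.2 v ∂Measure.pi D

theorem crudeRevenue_nonneg (S : Fin m₀ → Fin n → ℝ) : 0 ≤ crudeRevenue S :=
  Finset.sum_nonneg fun _ _ => singleRevenue_nonneg _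

theorem apx_eq (ε : ℝ) (S : SampleIdx m₀ m₁ m₂ → Fin n → ℝ) : apx ε S =
    averageVCG (crudeRevenue (splitSamples S).1.1 / ε) (splitSamples S).1.2 := rfl

theorem apx_nonneg (hε : 0 < ε) {S : SampleIdx m₀ m₁ m₂ → Fin n → ℝ} (hS : 0 ≤ S) :
    0 ≤ apx ε S := by
  rw [apx_eq]
  exact averageVCG_nonneg (div_nonneg (crudeRevenue_nonneg _) hε.le)
    fun k => hS (Sum.inr (Sum.inl k))

theorem rev_eq_sampleRev (hε : 0 < ε) {S : SampleIdx m₀ m₁ m₂ → Fin n → ℝ} (hS : 0 ≤ S) :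
    rev (empiricalMyerson τ ε S) D = sampleRev τ D ε (splitSamples S) := by
  have h : max (averageVCG (crudeRevenue (splitSamples S).1.1 / ε) (splitSamples S).1.2) 0 =
      apx ε S := max_eq_left (apx_nonneg hε hS)
  unfold sampleRev
  rw [h]
  rfl

theorem measurable_sampleRev [∀ i, IsProbabilityMeasure (D i)] (hε : 0 < ε) (hε1 : ε < 1) :
    Measurable (sampleRev τ D ε : ((Fin m₀ → Fin n → ℝ) × (Fin m₁ × Fin 2 → Fin n → ℝ)) ×
      (Fin m₂ → Fin n → ℝ) → ℝ) := by
  have h1 : Measurable fun z : ((Fin m₀ → Fin n → ℝ) × (Fin m₁ × Fin 2 → Fin n → ℝ)) ×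
      (Fin m₂ → Fin n → ℝ) => averageVCG (crudeRevenue z.1.1 / ε) z.1.2 :=
    measurable_averageVCG ((measurable_crudeRevenue.comp (measurable_fst.comp
      measurable_fst)).div_const ε) (measurable_snd.comp measurable_fst)
  have h2 := (measurable_integral_samplePay (m := m₂) τ hε hε1 D).comp (h1.prodMk measurable_snd)
  exact h2

theorem empiricalMyerson_isAdmissible (hε : 0 < ε) (hε1 : ε < 1) (hm₂ : m₂ ≠ 0)
    {S : SampleIdx m₀ m₁ m₂ → Fin n → ℝ} (hS : 0 ≤ S) :
    (empiricalMyerson τ ε S).IsAdmissible := by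
  have hV := isGrid_valueGrid hε hε1 (apx_nonneg hε hS)
  exact roundedMyerson_isAdmissible τ hV fun i =>
    isSupportedOn_empirical hV hm₂ fun k => hV.roundDown_mem _

theorem integrable_empiricalMyerson [∀ i, IsProbabilityMeasure (D i)] (hε : 0 < ε) (hε1 : ε < 1)
    {S : SampleIdx m₀ m₁ m₂ → Fin n → ℝ} (hS : 0 ≤ S) :
    Integrable (fun v => ∑ i, (empiricalMyerson τ ε S).pay v i) (Measure.pi D) :=
  integrable_roundedMyerson τ (fun _ => inferInstance)
    (isGrid_valueGrid hε hε1 (apx_nonneg hε hS)) _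

theorem rev_empiricalMyerson_nonneg (S : SampleIdx m₀ m₁ m₂ → Fin n → ℝ) :
    0 ≤ rev (empiricalMyerson τ ε S) D :=
  integral_nonneg fun v => Finset.sum_nonneg fun i _ =>
    roundedMyerson_pay_nonneg τ (V := valueGrid ε (apx ε S)) v i

theorem ae_sampleLaw_nonneg {κ : Type} [Fintype κ] (hD : ∀ i, HasRegularTail (D i)) :
    ∀ᵐ S ∂sampleLaw κ D, 0 ≤ S := by
  have := fun i => (hD i).prob
  have : ∀ k : κ, ∀ᵐ S ∂sampleLaw κ D, 0 ≤ S k := fun k =>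
    (measurePreserving_eval (fun _ : κ => Measure.pi D) k).quasiMeasurePreserving.ae
      (ae_pi_nonneg hD)
  filter_upwards [ae_all_iff.2 this] with S hS k using hS k

instance {κ : Type} [Fintype κ] [∀ i, IsProbabilityMeasure (D i)] :
    IsProbabilityMeasure (sampleLaw κ D) :=
  inferInstanceAs (IsProbabilityMeasure (Measure.pi fun _ : κ => Measure.pi D))

/-- The estimate of the optimal revenue is correct up to a constant factor with high probability. -/
theorem apx_bad_le (hn : 1 ≤ n) (hD : ∀ i, HasRegularTail (D i)) (hT : IsMedianMax D T)
    (hε : 0 < ε) (hε0 : ε ≤ 3 / 16) (hm₀ : 64 * Real.log (n / ε) ≤ m₀)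
    (hm₁ : 64 * (n / ε * Real.log (1 / ε)) ≤ m₁) :
    (sampleLaw (SampleIdx m₀ m₁ m₂) D).real
      {S | 0 ≤ S ∧ ¬(T / 8 ≤ apx ε S ∧ apx ε S ≤ 132 * T)} ≤ 4 * ε := by
  have hprob := fun i => (hD i).prob
  have hTpos := hT.pos
  have hn' : (1 : ℝ) ≤ n := by exact_mod_cast hn
  have hinv : 1 < 1 / ε := by rw [lt_div_iff₀ hε]; linarith
  have hle : 1 / ε ≤ n / ε := by gcongr
  have hl : 0 < Real.log (1 / ε) := Real.log_pos hinv
  have hL : 0 < Real.log (n / ε) := Real.log_pos (by linarith)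
  have hm₀pos : (0 : ℝ) < m₀ := by linarith
  have hm₁pos : (0 : ℝ) < m₁ := lt_of_lt_of_le (by positivity) hm₁
  have hm₀0 : m₀ ≠ 0 := by rintro rfl; simp at hm₀pos
  have hm₁0 : m₁ ≠ 0 := by rintro rfl; simp at hm₁pos
  have hεexp : ε = Real.exp (-Real.log (1 / ε)) := by
    rw [one_div, Real.log_inv, neg_neg, Real.exp_log hε]
  set L := sampleLaw (SampleIdx m₀ m₁ m₂) D
  have hsplit := measurePreserving_splitSamples (m₀ := m₀) (m₁ := m₁) (m₂ := m₂) D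
  have hp0 := measurePreserving_fst.comp (measurePreserving_fst.comp hsplit)
  have hp1 := measurePreserving_snd.comp (measurePreserving_fst.comp hsplit)
  have h0 : L.real {S | ¬(3 / 16 * T ≤ crudeRevenue (splitSamples S).1.1 ∧
      crudeRevenue (splitSamples S).1.1 ≤ 48 * n * T)} ≤ 2 * ε := by
    refine (measureReal_preimage_le hp0 _).trans ((crudeRevenue_bad_le hD hT hm₀0).trans ?_)
    have h1 : Real.exp (-(m₀ / 32)) ≤ (ε / n) ^ 2 := by
      have h2 : (ε / n) ^ 2 = Real.exp (-(2 * Real.log (n / ε))) := by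
        rw [← Nat.cast_ofNat (R := ℝ), ← Real.log_pow, Real.exp_neg,
          Real.exp_log (by positivity), ← inv_pow, inv_div]
      rw [h2]
      exact Real.exp_le_exp.2 (by linarith)
    calc 2 * n * Real.exp (-(m₀ / 32)) ≤ 2 * n * (ε / n) ^ 2 := by gcongr
      _ = 2 * ε * (ε / n) := by field_simp
      _ ≤ 2 * ε * 1 := by
          gcongr
          rw [div_le_one (by linarith)]; linarith
      _ = 2 * ε := mul_one _
  have h1 : L.real {S | 0 ≤ (splitSamples S).1.2 ∧ averageVCG T (splitSamples S).1.2 < T / 8} ≤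
      ε := by
    refine (measureReal_preimage_le hp1 _).trans ((averageVCG_lt_le hD hT hm₁0).trans ?_)
    conv_rhs => rw [hεexp]
    refine Real.exp_le_exp.2 ?_
    have : 1 * Real.log (1 / ε) ≤ n / ε * Real.log (1 / ε) := by
      gcongr; linarith
    linarith
  have h2 : L.real {S | 0 ≤ (splitSamples S).1.2 ∧
      132 * T < averageVCG (48 * n * T / ε) (splitSamples S).1.2} ≤ ε := by
    refine (measureReal_preimage_le hp1 _).trans ((lt_averageVCG_le hD hT hm₁0
      (by positivity)).trans ?_)
    conv_rhs => rw [hεexp]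
    refine Real.exp_le_exp.2 ?_
    have h3 : 96 * m₁ * T / (48 * n * T / ε) = 2 * (ε / n) * m₁ := by field_simp; norm_num
    have h4 : 2 * (ε / n) * (64 * (n / ε * Real.log (1 / ε))) = 128 * Real.log (1 / ε) := by
      field_simp; norm_num
    have h5 : 2 * (ε / n) * (64 * (n / ε * Real.log (1 / ε))) ≤ 2 * (ε / n) * m₁ := by gcongr
    rw [h3]
    linarith
  refine (measureReal_mono (s₂ := {S | ¬(3 / 16 * T ≤ crudeRevenue (splitSamples S).1.1 ∧
      crudeRevenue (splitSamples S).1.1 ≤ 48 * n * T)} ∪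
      ({S | 0 ≤ (splitSamples S).1.2 ∧ averageVCG T (splitSamples S).1.2 < T / 8} ∪
      {S | 0 ≤ (splitSamples S).1.2 ∧
        132 * T < averageVCG (48 * n * T / ε) (splitSamples S).1.2})) ?_).trans
    ((measureReal_union_le _ _).trans ((add_le_add h0 ((measureReal_union_le _ _).trans
      (add_le_add h1 h2))).trans (by linarith)))
  rintro S ⟨hS, hbad⟩
  by_contra hcon
  simp only [mem_union, not_or] at hcon
  have hS1 : 0 ≤ (splitSamples S).1.2 := fun k => hS _
  exact hbad (apx_bounds_of hε hε0 hTpos (not_not.1 hcon.1)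
    (not_lt.1 fun h => hcon.2.1 ⟨hS1, h⟩) (not_lt.1 fun h => hcon.2.2 ⟨hS1, h⟩))

/-- The samples of the third phase are independent of the grid, so the bound for a fixed grid
applies to each value of the first two phases. -/
theorem rev_empiricalMyerson_lt_le (hn : 1 ≤ n) (hD : ∀ i, HasRegularTail (D i)) {γ : ℝ}
    (hε : 0 < ε) (hε0 : ε ≤ 1 / 20000) (hγ : 0 < γ) (hγ1 : γ < 1)
    (hm₀ : 64 * Real.log (n / ε) ≤ m₀) (hm₁ : 64 * (n / ε * Real.log (1 / ε)) ≤ m₁) (hm₂0 : m₂ ≠ 0)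
    (hm₂ : 20 * (1 / ε ^ 3 * (n / ε * Real.log (1 / ε) * Real.log (n / ε) + Real.log (1 / γ))) ≤
      (m₂ : ℝ)) :
    (sampleLaw (SampleIdx m₀ m₁ m₂) D).real
      {S | rev (empiricalMyerson τ ε S) D < (1 - 8500 * ε) * opt D} ≤ 4 * ε + γ := by
  have hprob := fun i => (hD i).prob
  have hε1 : ε < 1 := by linarith
  obtain ⟨T, hT⟩ := exists_isMedianMax hn hD
  set c := (1 - 8500 * ε) * opt D
  set L := sampleLaw (SampleIdx m₀ m₁ m₂) D
  have hsplit := measurePreserving_splitSamples (m₀ := m₀) (m₁ := m₁) (m₂ := m₂) D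
  let A : ((Fin m₀ → Fin n → ℝ) × (Fin m₁ × Fin 2 → Fin n → ℝ)) → ℝ := fun z =>
    averageVCG (crudeRevenue z.1 / ε) z.2
  have hA : Measurable A := measurable_averageVCG
    ((measurable_crudeRevenue.comp measurable_fst).div_const ε) measurable_snd
  let B : Set (((Fin m₀ → Fin n → ℝ) × (Fin m₁ × Fin 2 → Fin n → ℝ)) × (Fin m₂ → Fin n → ℝ)) :=
    {z | (T / 8 ≤ A z.1 ∧ A z.1 ≤ 132 * T) ∧ sampleRev τ D ε z < c}
  have hB : MeasurableSet B := by
    refine MeasurableSet.inter (MeasurableSet.inter ?_ ?_) ?_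
    · exact measurableSet_le measurable_const (hA.comp measurable_fst)
    · exact measurableSet_le (hA.comp measurable_fst) measurable_const
    · exact measurableSet_lt (measurable_sampleRev τ hε hε1) measurable_const
  have hBle : L.real (splitSamples ⁻¹' B) ≤ γ := by
    rw [measureReal_def, hsplit.measure_preimage hB.nullMeasurableSet, Measure.prod_apply hB]
    refine ENNReal.toReal_le_of_le_ofReal hγ.le ?_
    calc ∫⁻ z, (Measure.pi fun _ : Fin m₂ => Measure.pi D) (Prod.mk z ⁻¹' B)
          ∂((Measure.pi fun _ => Measure.pi D).prod (Measure.pi fun _ => Measure.pi D))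
        ≤ ∫⁻ _z, ENNReal.ofReal γ
          ∂((Measure.pi fun _ : Fin m₀ => Measure.pi D).prod
            (Measure.pi fun _ : Fin m₁ × Fin 2 => Measure.pi D)) := by
          refine lintegral_mono fun z => ?_
          by_cases hz : T / 8 ≤ A z ∧ A z ≤ 132 * T
          · have hmax : max (A z) 0 = A z := max_eq_left (by linarith [hT.pos])
            have h := rev_empirical_ge τ hn hD hT hε hε0 hγ hγ1 hz.1 hz.2 hm₂0 hm₂
            rw [← ofReal_measureReal]
            refine ENNReal.ofReal_le_ofReal (le_trans (measureReal_mono ?_) h)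
            intro S hS
            have h2 : sampleRev τ D ε (z, S) < c := hS.2
            unfold sampleRev at h2
            change ∫ v, samplePay τ ε (max (A z) 0) S v ∂Measure.pi D < c at h2
            rw [hmax] at h2
            exact h2
          · have : Prod.mk z ⁻¹' B = ∅ := by
              ext S
              simp only [mem_preimage, mem_empty_iff_false, iff_false]
              exact fun hS => hz hS.1
            rw [this, measure_empty]
            exact zero_le
      _ = ENNReal.ofReal γ := by simp
  have hnull : L.real {S | ¬ 0 ≤ S} = 0 := by
    rw [measureReal_def, ae_iff.1 (ae_sampleLaw_nonneg hD)]; rfl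
  have hbad := apx_bad_le (m₂ := m₂) hn hD hT hε (by linarith) hm₀ hm₁
  refine (measureReal_mono (s₂ := {S | ¬ 0 ≤ S} ∪
    ({S | 0 ≤ S ∧ ¬(T / 8 ≤ apx ε S ∧ apx ε S ≤ 132 * T)} ∪ splitSamples ⁻¹' B)) ?_).trans
    ((measureReal_union_le _ _).trans ((add_le_add hnull.le ((measureReal_union_le _ _).trans
      (add_le_add hbad hBle))).trans (zero_add _).le))
  intro S hS
  by_contra hcon
  simp only [mem_union, not_or] at hcon
  obtain ⟨h0, h1, h2⟩ := hcon
  have h0 : 0 ≤ S := not_not.1 h0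
  have hgood : T / 8 ≤ apx ε S ∧ apx ε S ≤ 132 * T := by
    by_contra h
    exact h1 ⟨h0, h⟩
  refine h2 ⟨hgood, ?_⟩
  rw [← rev_eq_sampleRev τ hε h0]
  exact hS

theorem integrable_rev_empiricalMyerson (hn : 1 ≤ n) (hD : ∀ i, HasRegularTail (D i)) (hε : 0 < ε)
    (hε1 : ε < 1) (hm₂ : m₂ ≠ 0) :
    Integrable (fun S : SampleIdx m₀ m₁ m₂ → Fin n → ℝ => rev (empiricalMyerson τ ε S) D)
      (sampleLaw (SampleIdx m₀ m₁ m₂) D) := by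
  have hprob := fun i => (hD i).prob
  obtain ⟨T, hT⟩ := exists_isMedianMax hn hD
  have hae := ae_sampleLaw_nonneg (κ := SampleIdx m₀ m₁ m₂) hD
  have hm := ((measurable_sampleRev (m₀ := m₀) (m₁ := m₁) (m₂ := m₂) (D := D) τ hε hε1).comp
    (measurePreserving_splitSamples D).measurable).aestronglyMeasurable
      (μ := sampleLaw (SampleIdx m₀ m₁ m₂) D)
  refine Integrable.of_bound (C := opt D) (hm.congr ?_) ?_
  · filter_upwards [hae] with S hS
    exact (rev_eq_sampleRev τ hε hS).symm
  · filter_upwards [hae] with S hS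
    rw [Real.norm_eq_abs, abs_of_nonneg (rev_empiricalMyerson_nonneg τ S)]
    exact rev_le_opt hD hT (empiricalMyerson_isAdmissible τ hε hε1 hm₂ hS)
      (integrable_empiricalMyerson τ hε hε1 hS)

/-- A lower bound that holds with high probability gives one for the expectation, since the revenue
is never negative. -/
theorem integral_ge_of_prob {Ω : Type*} [MeasurableSpace Ω] {μ : Measure Ω} [IsProbabilityMeasure μ]
    {f : Ω → ℝ} (hf : Integrable f μ) (hf0 : ∀ x, 0 ≤ f x) {c p : ℝ} (hc : 0 ≤ c)
    (h : μ.real {x | f x < c} ≤ p) : c * (1 - p) ≤ ∫ x, f x ∂μ := by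
  refine le_trans ?_ (mul_meas_ge_le_integral_of_nonneg (Filter.Eventually.of_forall hf0) hf c)
  refine mul_le_mul_of_nonneg_left ?_ hc
  have h1 : μ.real univ ≤ μ.real {x | c ≤ f x} + μ.real {x | f x < c} :=
    (measureReal_mono fun x _ => le_or_gt c (f x)).trans (measureReal_union_le _ _)
  rw [probReal_univ] at h1
  linarith

end Guarantee

/-! ### The number of samples -/

section SampleSize

variable {c ε γ : ℝ} {n : ℕ}

theorem log_one_div_nonneg (hε : 0 < ε) (hε1 : ε < 1) : 0 ≤ Real.log (1 / ε) :=
  Real.log_nonneg (by rw [le_div_iff₀ hε]; linarith)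

theorem log_div_nonneg (hn : 1 ≤ n) (hε : 0 < ε) (hε1 : ε < 1) : 0 ≤ Real.log (n / ε) := by
  have hn' : (1 : ℝ) ≤ n := by exact_mod_cast hn
  exact Real.log_nonneg (by rw [le_div_iff₀ hε]; linarith)

theorem size₂_ne_zero (hc : 0 < c) (hn : 1 ≤ n) (hε : 0 < ε) (hε1 : ε < 1) (hγ : 0 < γ)
    (hγ1 : γ < 1) : size₂ c n ε γ ≠ 0 := by
  have h1 := log_one_div_nonneg hε hε1
  have h2 := log_div_nonneg hn hε hε1
  have h3 : 0 < Real.log (1 / γ) := Real.log_pos (by rw [lt_div_iff₀ hγ]; linarith)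
  exact (Nat.ceil_pos.2 (by positivity)).ne'

theorem card_allSamples_le {c₀ c₁ c₂ : ℝ} (hc₀ : 0 ≤ c₀) (hc₁ : 0 ≤ c₁) (hc₂ : 0 ≤ c₂)
    (hn : 1 ≤ n) (hε : 0 < ε) (hε1 : ε < 1) (hγ : 0 < γ) (hγ1 : γ < 1) :
    (Fintype.card (AllSamples c₀ c₁ c₂ n ε γ) : ℝ) ≤ (c₀ + 2 * c₁ + c₂ + 4) *
      (n / ε ^ 4 * (1 + Real.log (1 / ε)) * (1 + Real.log (n / ε)) +
        1 / ε ^ 3 * Real.log (1 / γ)) := by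
  have hn' : (1 : ℝ) ≤ n := by exact_mod_cast hn
  have hl := log_one_div_nonneg hε hε1
  have hL := log_div_nonneg hn hε hε1
  have hG := log_one_div_nonneg hγ hγ1
  have h0 : (size₀ c₀ n ε : ℝ) ≤ c₀ * Real.log (n / ε) + 1 :=
    (Nat.ceil_lt_add_one (by positivity)).le
  have h1 : (size₁ c₁ n ε : ℝ) ≤ c₁ * (n / ε * Real.log (1 / ε)) + 1 :=
    (Nat.ceil_lt_add_one (by positivity)).le
  have h2 : (size₂ c₂ n ε γ : ℝ) ≤ c₂ * (1 / ε ^ 3 * (n / ε * Real.log (1 / ε) * Real.log (n / ε) +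
      Real.log (1 / γ))) + 1 := (Nat.ceil_lt_add_one (by positivity)).le
  have hcard : (Fintype.card (AllSamples c₀ c₁ c₂ n ε γ) : ℝ) =
      size₀ c₀ n ε + (size₁ c₁ n ε * 2 + size₂ c₂ n ε γ) := by
    simp [AllSamples, SampleIdx]
  rw [hcard]
  set l := Real.log (1 / ε)
  set L := Real.log (n / ε)
  set G := Real.log (1 / γ)
  set a := n / ε ^ 4 with ha
  have hε4 : ε ^ 4 ≤ ε := by
    have : ε ^ 4 ≤ ε ^ 1 := pow_le_pow_of_le_one hε.le hε1.le (by norm_num)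
    simpa using this
  have ha1 : n / ε ≤ a := by rw [ha]; gcongr
  have hnε : 1 ≤ n / ε := by rw [le_div_iff₀ hε]; linarith
  have ha2 : 1 ≤ a := hnε.trans ha1
  have hX1 : 1 ≤ a * (1 + l) * (1 + L) := by
    have := one_le_mul_of_one_le_of_one_le ha2 (by linarith : 1 ≤ 1 + l)
    exact one_le_mul_of_one_le_of_one_le this (by linarith)
  have hXL : L ≤ a * (1 + l) * (1 + L) := by
    have := one_le_mul_of_one_le_of_one_le ha2 (by linarith : 1 ≤ 1 + l)
    nlinarith
  have hXl : n / ε * l ≤ a * (1 + l) * (1 + L) := by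
    calc n / ε * l ≤ a * (1 + l) * 1 := by rw [mul_one]; gcongr; linarith
      _ ≤ a * (1 + l) * (1 + L) := by gcongr; linarith
  have hXlL : 1 / ε ^ 3 * (n / ε * l * L) ≤ a * (1 + l) * (1 + L) := by
    have : 1 / ε ^ 3 * (n / ε * l * L) = a * l * L := by rw [ha]; field_simp
    rw [this]; gcongr <;> linarith
  have hY : 0 ≤ 1 / ε ^ 3 * G := by positivity
  set X := a * (1 + l) * (1 + L)
  set Y := 1 / ε ^ 3 * G
  have e0 := mul_le_mul_of_nonneg_left hXL hc₀
  have e1 := mul_le_mul_of_nonneg_left hXl hc₁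
  have e2 : c₂ * (1 / ε ^ 3 * (n / ε * l * L + G)) ≤ c₂ * (X + Y) := by
    rw [mul_add (1 / ε ^ 3)]; gcongr
  have e3 : 0 ≤ (c₀ + 2 * c₁ + 4) * Y := by positivity
  linarith

end SampleSize

end

end SampleAuction

open SampleAuction in
theorem mainTheorem3 :
    ∃ K C : ℝ, 0 < K ∧ 0 < C ∧ ∀ c₀ c₁ c₂ : ℝ, K ≤ c₀ → K ≤ c₁ → K ≤ c₂ →
      -- the number of samples
      (∃ B : ℝ, ∀ (n : ℕ) (ε γ : ℝ), 1 ≤ n → 0 < ε → ε < 1 → 0 < γ → γ < 1 →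
        (Fintype.card (AllSamples c₀ c₁ c₂ n ε γ) : ℝ) ≤
          B * (n / ε ^ 4 * (1 + Real.log (1 / ε)) * (1 + Real.log (n / ε)) +
            1 / ε ^ 3 * Real.log (1 / γ))) ∧
      -- the approximation guarantee
      ∀ (n : ℕ) (τ : Equiv.Perm (Fin n)) (ε γ : ℝ), 1 ≤ n → 0 < ε → ε < 1 → 0 < γ → γ < 1 →
        (∀ S : AllSamples c₀ c₁ c₂ n ε γ → Fin n → ℝ, 0 ≤ S →
          (empiricalMyerson τ ε S).IsAdmissible) ∧
        ∀ D : Fin n → MeasureTheory.Measure ℝ, (∀ i, IsRegular (D i)) →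
          BddAbove (achievableRevenues D) ∧
          sampleLaw (AllSamples c₀ c₁ c₂ n ε γ) D
              {S | rev (empiricalMyerson τ ε S) D < (1 - C * ε) * opt D} ≤
            ENNReal.ofReal (C * ε + γ) ∧
          MeasureTheory.Integrable
            (fun S : AllSamples c₀ c₁ c₂ n ε γ → Fin n → ℝ => rev (empiricalMyerson τ ε S) D)
            (sampleLaw (AllSamples c₀ c₁ c₂ n ε γ) D) ∧
          (1 - C * ε - γ) * opt D ≤
            ∫ S : AllSamples c₀ c₁ c₂ n ε γ → Fin n → ℝ, rev (empiricalMyerson τ ε S) D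
              ∂(sampleLaw (AllSamples c₀ c₁ c₂ n ε γ) D) := by
  -- sample sizes with the constants `64`, `64` and `20` suffice; for `ε ≤ 1 / 20000` the loss is
  -- then `8500 * ε`, with failure probability `4 * ε + γ`
  refine ⟨100, 20000, by norm_num, by norm_num, fun c₀ c₁ c₂ hc₀ hc₁ hc₂ => ⟨⟨c₀ + 2 * c₁ + c₂ + 4,
    fun n ε γ hn hε hε1 hγ hγ1 => card_allSamples_le (by linarith) (by linarith) (by linarith)
      hn hε hε1 hγ hγ1⟩, fun n τ ε γ hn hε hε1 hγ hγ1 => ?_⟩⟩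
  have hm₂ : size₂ c₂ n ε γ ≠ 0 := size₂_ne_zero (by linarith) hn hε hε1 hγ hγ1
  refine ⟨fun S hS => empiricalMyerson_isAdmissible τ hε hε1 hm₂ hS, fun D hreg => ?_⟩
  have hD := fun i => (hreg i).hasRegularTail
  have hprob := fun i => (hD i).prob
  obtain ⟨T, hT⟩ := exists_isMedianMax hn hD
  have hopt : 0 ≤ opt D := by linarith [half_le_opt hD hT, hT.pos]
  have hint := integrable_rev_empiricalMyerson (m₀ := size₀ c₀ n ε) (m₁ := size₁ c₁ n ε)
    τ hn hD hε hε1 hm₂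
  have hnonneg := fun S : AllSamples c₀ c₁ c₂ n ε γ → Fin n → ℝ =>
    rev_empiricalMyerson_nonneg (D := D) (ε := ε) τ S
  refine ⟨bddAbove_achievableRevenues hD hT, ?_, hint, ?_⟩
  all_goals rcases le_or_gt ε (1 / 20000) with hε0 | hε0
  -- for larger `ε`, the bounds on the probability and on the revenue are trivial
  rotate_left
  · refine MeasureTheory.prob_le_one.trans ?_
    rw [← ENNReal.ofReal_one]
    exact ENNReal.ofReal_le_ofReal (by linarith)
  rotate_left
  · exact le_trans (mul_nonpos_of_nonpos_of_nonneg (by linarith) hopt)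
      (MeasureTheory.integral_nonneg hnonneg)
  all_goals
    have hlog := log_one_div_nonneg hε hε1
    have hlog' := log_div_nonneg hn hε hε1
    have hlogγ := log_one_div_nonneg hγ hγ1
    have hmain := rev_empiricalMyerson_lt_le (m₀ := size₀ c₀ n ε) (m₁ := size₁ c₁ n ε)
      (m₂ := size₂ c₂ n ε γ) τ hn hD hε hε0 hγ hγ1
      (le_trans (by gcongr; linarith) (Nat.le_ceil _))
      (le_trans (by gcongr; linarith) (Nat.le_ceil _)) hm₂
      (le_trans (by gcongr; linarith) (Nat.le_ceil _))
  · rw [← MeasureTheory.ofReal_measureReal]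
    refine ENNReal.ofReal_le_ofReal (le_trans (MeasureTheory.measureReal_mono fun S hS => ?_)
      (hmain.trans (by linarith)))
    exact lt_of_lt_of_le hS (mul_le_mul_of_nonneg_right (by linarith) hopt)
  · refine le_trans ?_ (integral_ge_of_prob hint hnonneg
      (mul_nonneg (by linarith) hopt) hmain)
    have : 1 - 20000 * ε - γ ≤ (1 - 8500 * ε) * (1 - (4 * ε + γ)) := by nlinarith
    calc (1 - 20000 * ε - γ) * opt D ≤ (1 - 8500 * ε) * (1 - (4 * ε + γ)) * opt D := by gcongr
      _ = _ := by ring
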